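/- **Setting.** Let $X_1,X_2,\dots$ be i.i.d. random variables with values in a measurable space $\mathcal X$ and common distribution $\nu$, let $X$ denote a variable with this distribution, and let $f:\mathcal X^2\to\mathbb R$ be measurable with $\mathbb E|f(X_1,X_2)|^2<\infty$. The cyclic $U$-statistic is $$U^c_n=U^c_n(f):=\sum_{i\in\mathbb Z/n\mathbb Z}\ \sum_{1\le j<n/2} f(X_i,X_{i+j}),$$ the indices of $X_1,\dots,X_n$ being read modulo $n$. Put $\mu:=\mathbb E f(X_1,X_2)$, $f_1(x):=\mathbb E f(x,X)-\mu$, $f_2(y):=\mathbb E f(X,y)-\mu$ and $f_{12}(x,y):=f(x,y)-f_1(x)-f_2(y)-\mu$. Let $f_{12}^s(x,y):=\frac12(f_{12}(x,y)+f_{12}(y,x))$ and $f_{12}^a(x,y):=\frac12(f_{12}(x,y)-f_{12}(y,x))$ be the symmetric and antisymmetric parts of $f_{12}$. For $g\in L^2(\mathcal X^2,\nu\times\nu)$ let $T_g$ be the integral operator $T_g\varphi(x):=\int_{\mathcal X} g(x,y)\varphi(y)\,d\nu(y)$ on $L^2(\mathcal X,\nu)$. A random variable $\eta$ has the stochastic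 area distribution if $\mathbb E e^{\mathrm i t\eta}=1/\cosh t$ for all $t\in\mathbb R$. **Theorem.** (i) $U^c_n(f)$ is square integrable, $\mathbb E[U^c_n(f)]=n\lfloor\frac{n-1}2\rfloor\mu=\frac{n^2}2\mu+O(n)$, and $\frac2{n^2}U^c_n(f)\to\mu$ in probability as $n\to\infty$. (ii) As $n\to\infty$, $$n^{-3}\operatorname{Var}[U^c_n(f)]\to\sigma^2:=\tfrac14\operatorname{Var}[f_1(X)+f_2(X)]=\tfrac14\bigl(\mathbb E[f_1(X)^2]+\mathbb E[f_2(X)^2]+2\,\mathbb E[f_1(X)f_2(X)]\bigr)$$ and $n^{-3/2}\bigl(U^c_n(f)-\frac{n^2}2\mu\bigr)\to N(0,\sigma^2)$ in distribution. Moreover $\sigma^2>0$ unless $f_1(X)+f_2(X)=0$ a.s., in which case $\sigma^2=0$. (iii) Suppose that $f_1(X)+f_2(X)=0$ a.s. Then $$\operatorname{Var}[U^c_n(f)]=n\lfloor\tfrac{n-1}2\rfloor\operatorname{Var}[f_{12}(X_1,X_2)]=\tfrac12n^2\operatorname{Var}[f_{12}(X_1,X_2)]+O(n).$$ The operator $T_{f_{12}^s}$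 on real $L^2(\mathcal X,\nu)$ is self-adjoint, and $T_{f_{12}^a}$ on complex $L^2(\mathcal X,\nu)$ is anti-self-adjoint. There are finite or infinite sequences of real numbers $(\lambda^s_r)_{r=1}^R$ and $(\lambda^a_q)_{q=1}^Q$ such that $(\lambda^s_r)$ lists the nonzero eigenvalues of $T_{f_{12}^s}$ with multiplicities, $(\lambda^a_q)$ lists with multiplicities the positive numbers $\lambda$ such that $\mathrm i\lambda$ is an eigenvalue of $T_{f_{12}^a}$, $$\sum_{r=1}^R(\lambda_r^s)^2=\operatorname{Var}[f_{12}^s(X_1,X_2)],\qquad \sum_{q=1}^Q(\lambda_q^a)^2=\tfrac12\operatorname{Var}[f_{12}^a(X_1,X_2)],$$ and, whenever $\zeta_r$ are standard normal variables and $\eta_q$ are variables with the stochastic area distribution, all independent (such families exist), $$n^{-1}\bigl(U^c_n(f)-\mathbb E[U^c_n(f)]\bigr)\to W:=\sum_{r=1}^R\tfrac12\lambda_r^s(\zeta_r^2-1)+\sum_{q=1}^Q\lambda_q^a\eta_q\quad\text{in distribution},$$ where both sums converge in $L^2$, and $$\operatorname{Var}W=\tfrac12\sum_{r=1}^R(\lambda_r^s)^2+\sum_{q=1}^Q(\lambda_q^a)^2=\tfrac12\operatorname{Var}[f_{12}(X_1,X_2)].$$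 -/

import Mathlib

open MeasureTheory ProbabilityTheory Filter Topology
open scoped ENNReal NNReal

noncomputable section

namespace CyclicU

/-! ### Integral operators with square-integrable kernels -/

section IntegralOperator

variable {𝕜 𝓧 : Type*} [RCLike 𝕜] [MeasurableSpace 𝓧] {ν : Measure 𝓧} [IsProbabilityMeasure ν]

theorem integrable_kernel_mul {g : 𝓧 → 𝓧 → 𝕜} {φ : 𝓧 → 𝕜}
    (hg : MemLp (Function.uncurry g) 2 (ν.prod ν)) (hφ : MemLp φ 2 ν) :
    Integrable (fun p : 𝓧 × 𝓧 => g p.1 p.2 * φ p.2) (ν.prod ν) :=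
  MemLp.integrable_mul hg (hφ.comp_snd ν)

theorem eLpNorm_two_sq {α : Type*} [MeasurableSpace α] {m : Measure α} (h : α → 𝕜) :
    (eLpNorm h 2 m) ^ (2 : ℝ) = ∫⁻ x, ‖h x‖ₑ ^ (2 : ℝ) ∂m := by
  rw [eLpNorm_eq_lintegral_rpow_enorm_toReal (by norm_num) (by norm_num), ← ENNReal.rpow_mul]
  norm_num

theorem eLpNorm_integral_kernel_le {g : 𝓧 → 𝓧 → 𝕜} {φ : 𝓧 → 𝕜}
    (hg : MemLp (Function.uncurry g) 2 (ν.prod ν)) (hφ : MemLp φ 2 ν) :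
    eLpNorm (fun x => ∫ y, g x y * φ y ∂ν) 2 ν
      ≤ eLpNorm (Function.uncurry g) 2 (ν.prod ν) * eLpNorm φ 2 ν := by
  rw [← ENNReal.rpow_le_rpow_iff (z := 2) (by norm_num),
    ENNReal.mul_rpow_of_nonneg _ _ (by norm_num), eLpNorm_two_sq, eLpNorm_two_sq]
  have hpt : ∀ᵐ x ∂ν, ‖∫ y, g x y * φ y ∂ν‖ₑ ^ (2 : ℝ)
      ≤ (∫⁻ y, ‖g x y‖ₑ ^ (2 : ℝ) ∂ν) * (eLpNorm φ 2 ν) ^ (2 : ℝ) := by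
    filter_upwards [hg.1.prodMk_left] with x hx
    have h1 : ‖∫ y, g x y * φ y ∂ν‖ₑ ≤ ∫⁻ y, ‖g x y‖ₑ * ‖φ y‖ₑ ∂ν := by
      refine (enorm_integral_le_lintegral_enorm _).trans (le_of_eq ?_)
      simp [enorm_mul]
    have h2 := ENNReal.lintegral_mul_le_Lp_mul_Lq (p := 2) (q := 2) ν
      Real.HolderConjugate.two_two hx.enorm hφ.1.enorm
    have h3 := h1.trans h2
    calc ‖∫ y, g x y * φ y ∂ν‖ₑ ^ (2 : ℝ) ≤ _ := ENNReal.rpow_le_rpow h3 (by norm_num)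
      _ = _ := by
        rw [ENNReal.mul_rpow_of_nonneg _ _ (by norm_num), ← ENNReal.rpow_mul, ← ENNReal.rpow_mul,
          eLpNorm_two_sq]
        norm_num
  calc _ ≤ ∫⁻ x, (∫⁻ y, ‖g x y‖ₑ ^ (2 : ℝ) ∂ν) * (eLpNorm φ 2 ν) ^ (2 : ℝ) ∂ν :=
        lintegral_mono_ae hpt
    _ = _ := by
        rw [lintegral_mul_const' _ _ (ENNReal.rpow_ne_top_of_nonneg (by norm_num) hφ.2.ne),
          lintegral_prod _ (hg.1.enorm.pow_const _)]
        rfl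

theorem memLp_integral_kernel {g : 𝓧 → 𝓧 → 𝕜} {φ : 𝓧 → 𝕜}
    (hg : MemLp (Function.uncurry g) 2 (ν.prod ν)) (hφ : MemLp φ 2 ν) :
    MemLp (fun x => ∫ y, g x y * φ y ∂ν) 2 ν :=
  ⟨(integrable_kernel_mul hg hφ).1.integral_prod_right',
    (eLpNorm_integral_kernel_le hg hφ).trans_lt (ENNReal.mul_lt_top hg.2 hφ.2)⟩

/-- The integral operator `T_g φ (x) = ∫ g(x, y) φ(y) dν(y)` on `L²(𝓧, ν)` (real or complex),
for a kernel `g ∈ L²(𝓧 × 𝓧, ν × ν)`. -/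
def integralOp (g : 𝓧 → 𝓧 → 𝕜) (hg : MemLp (Function.uncurry g) 2 (ν.prod ν)) :
    Lp 𝕜 2 ν →L[𝕜] Lp 𝕜 2 ν :=
  LinearMap.mkContinuous
    { toFun := fun φ => (memLp_integral_kernel hg (Lp.memLp φ)).toLp
        (fun x => ∫ y, g x y * φ y ∂ν)
      map_add' := by
        intro φ ψ
        rw [← MemLp.toLp_add, MemLp.toLp_eq_toLp_iff]
        filter_upwards [(integrable_kernel_mul hg (Lp.memLp φ)).prod_right_ae,
          (integrable_kernel_mul hg (Lp.memLp ψ)).prod_right_ae] with x h1 h2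
        rw [Pi.add_apply, ← integral_add h1 h2]
        refine integral_congr_ae ?_
        filter_upwards [Lp.coeFn_add φ ψ] with y hy
        rw [hy, Pi.add_apply, mul_add]
      map_smul' := by
        intro c φ
        rw [RingHom.id_apply, ← MemLp.toLp_const_smul, MemLp.toLp_eq_toLp_iff]
        refine Eventually.of_forall fun x => ?_
        rw [Pi.smul_apply, ← integral_smul]
        refine integral_congr_ae ?_
        filter_upwards [Lp.coeFn_smul c φ] with y hy
        rw [hy, Pi.smul_apply, smul_eq_mul, smul_eq_mul, mul_left_comm] }
    (eLpNorm (Function.uncurry g) 2 (ν.prod ν)).toReal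
    (by
      intro φ
      simp only [LinearMap.coe_mk, AddHom.coe_mk]
      rw [Lp.norm_toLp, Lp.norm_def, ← ENNReal.toReal_mul]
      exact ENNReal.toReal_mono (ENNReal.mul_ne_top hg.2.ne (Lp.eLpNorm_ne_top φ))
        (eLpNorm_integral_kernel_le hg (Lp.memLp φ)))

theorem integralOp_apply_ae (g : 𝓧 → 𝓧 → 𝕜) (hg : MemLp (Function.uncurry g) 2 (ν.prod ν))
    (φ : Lp 𝕜 2 ν) : integralOp g hg φ =ᵐ[ν] fun x => ∫ y, g x y * φ y ∂ν :=
  MemLp.coeFn_toLp (memLp_integral_kernel hg (Lp.memLp φ))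

end IntegralOperator

/-- `l` lists the eigenvalues of `T` that lie in the set `S`, each repeated according to its
multiplicity (the dimension of its eigenspace). -/
def ListsEigenvalues {𝕜 H ι : Type*} [NontriviallyNormedField 𝕜] [NormedAddCommGroup H]
    [NormedSpace 𝕜 H] (T : H →L[𝕜] H) (S : Set 𝕜) (l : ι → 𝕜) : Prop :=
  (∀ r, l r ∈ S) ∧
    ∀ c ∈ S, {r | l r = c}.encard =
      Cardinal.toENat (Module.rank 𝕜 (Module.End.eigenspace (T : H →ₗ[𝕜] H) c))

/-- The index set of a finite (`R < ⊤`) or infinite (`R = ⊤`) sequence of length `R`. -/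
abbrev SeqIndex (R : ℕ∞) : Type := {r : ℕ // (r : ℕ∞) < R}

/-! ### The kernel and its Hoeffding decomposition -/

section Kernel

variable {𝓧 : Type*} [MeasurableSpace 𝓧]

/-- `f_∅ = μ = E f(X₁, X₂)`. -/
def kernelMean (f : 𝓧 → 𝓧 → ℝ) (ν : Measure 𝓧) : ℝ := ∫ p, f p.1 p.2 ∂(ν.prod ν)

/-- `f₁(x) = E f(x, X) - μ`. -/
def proj₁ (f : 𝓧 → 𝓧 → ℝ) (ν : Measure 𝓧) (x : 𝓧) : ℝ := ∫ y, f x y ∂ν - kernelMean f ν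

/-- `f₂(y) = E f(X, y) - μ`. -/
def proj₂ (f : 𝓧 → 𝓧 → ℝ) (ν : Measure 𝓧) (y : 𝓧) : ℝ := ∫ x, f x y ∂ν - kernelMean f ν

/-- `f₁₂(x, y) = f(x, y) - f₁(x) - f₂(y) - μ`. -/
def proj₁₂ (f : 𝓧 → 𝓧 → ℝ) (ν : Measure 𝓧) (x y : 𝓧) : ℝ :=
  f x y - proj₁ f ν x - proj₂ f ν y - kernelMean f ν

/-- The symmetric part of a kernel. -/
def symmPart (g : 𝓧 → 𝓧 → ℝ) (x y : 𝓧) : ℝ := (g x y + g y x) / 2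

/-- The antisymmetric part of a kernel. -/
def antisymmPart (g : 𝓧 → 𝓧 → ℝ) (x y : 𝓧) : ℝ := (g x y - g y x) / 2

variable {ν : Measure 𝓧} [IsProbabilityMeasure ν]

theorem memLp_flip {g : 𝓧 → 𝓧 → ℝ} (hg : MemLp (Function.uncurry g) 2 (ν.prod ν)) :
    MemLp (Function.uncurry fun x y => g y x) 2 (ν.prod ν) :=
  hg.comp_measurePreserving Measure.measurePreserving_swap

theorem memLp_symmPart {g : 𝓧 → 𝓧 → ℝ} (hg : MemLp (Function.uncurry g) 2 (ν.prod ν)) :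
    MemLp (Function.uncurry (symmPart g)) 2 (ν.prod ν) := by
  refine ((hg.add (memLp_flip hg)).const_mul (1 / 2)).ae_eq (Eventually.of_forall fun p => ?_)
  simp [symmPart, Function.uncurry]
  ring

theorem memLp_antisymmPart {g : 𝓧 → 𝓧 → ℝ} (hg : MemLp (Function.uncurry g) 2 (ν.prod ν)) :
    MemLp (Function.uncurry (antisymmPart g)) 2 (ν.prod ν) := by
  refine ((hg.sub (memLp_flip hg)).const_mul (1 / 2)).ae_eq (Eventually.of_forall fun p => ?_)
  simp [antisymmPart, Function.uncurry]
  ring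

theorem memLp_proj₁ {f : 𝓧 → 𝓧 → ℝ} (hf : MemLp (Function.uncurry f) 2 (ν.prod ν)) :
    MemLp (proj₁ f ν) 2 ν := by
  have h := (memLp_integral_kernel hf (memLp_const (1 : ℝ))).sub (memLp_const (kernelMean f ν))
  refine h.ae_eq (Eventually.of_forall fun x => ?_)
  simp [proj₁]

theorem memLp_proj₂ {f : 𝓧 → 𝓧 → ℝ} (hf : MemLp (Function.uncurry f) 2 (ν.prod ν)) :
    MemLp (proj₂ f ν) 2 ν := by
  have h := (memLp_integral_kernel (memLp_flip hf) (memLp_const (1 : ℝ))).sub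
    (memLp_const (kernelMean f ν))
  refine h.ae_eq (Eventually.of_forall fun x => ?_)
  simp [proj₂]

theorem memLp_proj₁₂ {f : 𝓧 → 𝓧 → ℝ} (hf : MemLp (Function.uncurry f) 2 (ν.prod ν)) :
    MemLp (Function.uncurry (proj₁₂ f ν)) 2 (ν.prod ν) :=
  ((hf.sub ((memLp_proj₁ hf).comp_fst ν)).sub ((memLp_proj₂ hf).comp_snd ν)).sub
    (memLp_const (kernelMean f ν))

/-- The operator `T_g` on real `L²(𝓧, ν)` for `g` the symmetric part of `f₁₂`. -/
def symmOp (f : 𝓧 → 𝓧 → ℝ) (hf : MemLp (Function.uncurry f) 2 (ν.prod ν)) :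
    Lp ℝ 2 ν →L[ℝ] Lp ℝ 2 ν :=
  integralOp (symmPart (proj₁₂ f ν)) (memLp_symmPart (memLp_proj₁₂ hf))

/-- The operator `T_g` on complex `L²(𝓧, ν)` for `g` the antisymmetric part of `f₁₂`. -/
def antisymmOp (f : 𝓧 → 𝓧 → ℝ) (hf : MemLp (Function.uncurry f) 2 (ν.prod ν)) :
    Lp ℂ 2 ν →L[ℂ] Lp ℂ 2 ν :=
  integralOp (fun x y => ((antisymmPart (proj₁₂ f ν) x y : ℝ) : ℂ))
    (memLp_antisymmPart (memLp_proj₁₂ hf)).ofReal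

end Kernel

/-! ### The cyclic U-statistic and the limit variables -/

/-- The cyclic U-statistic `∑_{i ∈ ℤ/n} ∑_{1 ≤ j < n/2} f(X_i, X_{i+j})`; the `n` variables are
`X 0, …, X (n - 1)`, with indices read modulo `n`. -/
def cyclicU {Ω 𝓧 : Type*} (f : 𝓧 → 𝓧 → ℝ) (X : ℕ → Ω → 𝓧) (n : ℕ) (ω : Ω) : ℝ :=
  ∑ i ∈ Finset.range n, ∑ j ∈ (Finset.Icc 1 n).filter (fun j => 2 * j < n),
    f (X i ω) (X ((i + j) % n) ω)

/-- `η` has the stochastic area distribution, the one with characteristic function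
`E exp(i t η) = 1 / cosh t`. -/
def HasStochasticAreaLaw {Ω : Type*} [MeasurableSpace Ω] (η : Ω → ℝ) (P : Measure Ω) : Prop :=
  AEMeasurable η P ∧ ∀ t : ℝ, charFun (P.map η) t = 1 / ((Real.cosh t : ℝ) : ℂ)

/-- `ζ_r` are standard normal, `η_q` are stochastic areas, and all are independent. -/
structure IsNormalAreaFamily {Ω ι κ : Type*} [MeasurableSpace Ω] (P : Measure Ω)
    (ζ : ι → Ω → ℝ) (η : κ → Ω → ℝ) : Prop where
  normal : ∀ r, HasLaw (ζ r) (gaussianReal 0 1) P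
  area : ∀ q, HasStochasticAreaLaw (η q) P
  indep : iIndepFun (Sum.elim ζ η) P

/-- `W = ∑_r ½ a_r (ζ_r² - 1) + ∑_q b_q η_q`, where both sums converge (unconditionally)
in `L²`. -/
def IsNormalAreaSum {Ω ι κ : Type*} [MeasurableSpace Ω] (P : Measure Ω) (a : ι → ℝ) (b : κ → ℝ)
    (ζ : ι → Ω → ℝ) (η : κ → Ω → ℝ) (W : Ω → ℝ) : Prop :=
  ∃ W₁ W₂ : Ω → ℝ, MemLp W₁ 2 P ∧ MemLp W₂ 2 P ∧
    Tendsto (fun s : Finset ι =>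
      eLpNorm (fun ω => W₁ ω - ∑ r ∈ s, 1 / 2 * a r * (ζ r ω ^ 2 - 1)) 2 P) atTop (𝓝 0) ∧
    Tendsto (fun s : Finset κ =>
      eLpNorm (fun ω => W₂ ω - ∑ q ∈ s, b q * η q ω) 2 P) atTop (𝓝 0) ∧
    ∀ ω, W ω = W₁ ω + W₂ ω

end CyclicU

end

open CyclicU

set_option linter.unusedSectionVars false

noncomputable section

namespace CyclicU

/-! ### Second moments of degenerate double sums -/

section SecondMoment

variable {Ω 𝓧 : Type*} [MeasurableSpace Ω] [MeasurableSpace 𝓧]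
  {P : Measure Ω} [IsProbabilityMeasure P] {ν : Measure 𝓧} [IsProbabilityMeasure ν]
  {X : ℕ → Ω → 𝓧}

/-! Write m for the integer part of (n - 1)/2. The decomposition f = μ + f₁(x) + f₂(y) + f₁₂(x, y)
carries over to the statistic: every index is the first index of m pairs and the second index of m
pairs, so U(f) = n m μ + m Σ (f₁ + f₂)(X_i) + U(f₁₂) (`cyclicU_hoeffding`). The kernel f₁₂
integrates to zero in each variable and no unordered pair occurs twice, so the summands of U(f₁₂)
are orthogonal to each other and to the linear part. This gives the exact variance
(`variance_cyclicU`) and the weak law. At scale n^(3/2) only the linear part survives, and the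
central limit theorem for independent summands applies to it.

In the degenerate case U(f) minus its mean is U(f₁₂) almost surely. The second moment of U(g)/n is
at most the squared L² norm of g, uniformly in n, so a kernel may be replaced by an L²
approximation. The symmetric part of f₁₂ is Σ λ_r e_r ⊗ e_r by the spectral theorem for compact
symmetric operators. The antisymmetric part times -i is Hermitian and purely imaginary, so complex
conjugation maps eigenvectors for c to eigenvectors for -c; the real and imaginary parts of the
eigenvectors with positive eigenvalue yield the expansion Σ λ_q (u_q ⊗ v_q - v_q ⊗ u_q). This
reduces the problem to kernels of finite rank.

For these, the indicator of j < n/2 is 1/2 plus a square wave in j/n, whose Fourier series consists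
of sines of odd frequency with coefficients c_k = 2/(π(2k + 1)). The sine of a difference of
positions factorizes by the addition formula. Once the diagonal is added, the statistic with
truncated weights is therefore a quadratic form in linear statistics with weights 1, cos and sin
(`sum_wavePartial_finiteRankKernel`). The weight 1 sees only the symmetric part and gives ½ λ_r
(ζ_r² - 1), the -1 coming from the diagonal by the law of large numbers. Each frequency k and each
pair (u_q, v_q) gives four squares with signs +, +, -, -, whose characteristic functions multiply to
1/(1 + (t λ_q c_k)²). By Euler's product the product over k is 1/cosh(t λ_q)
(`tendsto_prod_inv_cosh`). All these squares are asymptotically independent because odd harmonics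
average to zero over the grid (`tendsto_gram_rankSummand`).

Every limit is taken on characteristic functions. Mean square errors enter through
`norm_integral_cexp_sub_cexp_le`, and limits are interchanged by `tendsto_of_forall_approx`. The
stochastic area law itself is produced by the finite rank result, applied to Gaussian points of the
plane (`exists_stochasticArea`). -/

/-- A measurable square-integrable kernel both of whose one-dimensional projections vanish. -/
structure IsCanonical (g : 𝓧 → 𝓧 → ℝ) (ν : Measure 𝓧) : Prop where
  measurable : Measurable (Function.uncurry g)
  memLp : MemLp (Function.uncurry g) 2 (ν.prod ν)
  right : ∀ᵐ x ∂ν, ∫ y, g x y ∂ν = 0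
  left : ∀ᵐ y ∂ν, ∫ x, g x y ∂ν = 0

theorem IsCanonical.flip {g : 𝓧 → 𝓧 → ℝ} (hg : IsCanonical g ν) :
    IsCanonical (fun x y => g y x) ν where
  measurable := hg.measurable.comp measurable_swap
  memLp := memLp_flip hg.memLp
  right := hg.left
  left := hg.right

theorem hasLaw_pair (hX : ∀ i, HasLaw (X i) ν P) (hind : iIndepFun X P) {a b : ℕ} (hab : a ≠ b) :
    HasLaw (fun ω => (X a ω, X b ω)) (ν.prod ν) P :=
  (indepFun_iff_hasLaw_prodMk_prod (hX a) (hX b)).1 (hind.indepFun hab)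

theorem memLp_comp_of_hasLaw {𝓩 E : Type*} [MeasurableSpace 𝓩] [NormedAddCommGroup E] {μ : Measure 𝓩}
    {Z : Ω → 𝓩} (hZ : HasLaw Z μ P) {g : 𝓩 → E} {p : ℝ≥0∞} (hg : MemLp g p μ) :
    MemLp (fun ω => g (Z ω)) p P := by
  rw [← hZ.map_eq] at hg
  exact (memLp_map_measure_iff hg.1 hZ.aemeasurable).1 hg

theorem memLp_kernel_pair (hX : ∀ i, HasLaw (X i) ν P) (hind : iIndepFun X P) {a b : ℕ}
    (hab : a ≠ b) {g : 𝓧 → 𝓧 → ℝ} (hg : MemLp (Function.uncurry g) 2 (ν.prod ν)) :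
    MemLp (fun ω => g (X a ω) (X b ω)) 2 P :=
  memLp_comp_of_hasLaw (hasLaw_pair hX hind hab) hg

theorem integral_kernel_pair (hX : ∀ i, HasLaw (X i) ν P) (hind : iIndepFun X P) {a b : ℕ}
    (hab : a ≠ b) {G : 𝓧 × 𝓧 → ℝ} (hG : AEStronglyMeasurable G (ν.prod ν)) :
    ∫ ω, G (X a ω, X b ω) ∂P = ∫ p, G p ∂(ν.prod ν) :=
  (hasLaw_pair hX hind hab).integral_comp hG

/-- Fubini: for a fixed value of Z, the integral over Y is a multiple of ∫ g(c(Z), y) dν(y). All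
orthogonality relations below come from this one. -/
theorem integral_mul_kernel_eq_zero {𝓩 : Type*} [MeasurableSpace 𝓩] {Z : Ω → 𝓩} {Y : Ω → 𝓧}
    (hZ : AEMeasurable Z P) (hY : HasLaw Y ν P) (hind : IndepFun Z Y P) {φ : 𝓩 → ℝ} {c : 𝓩 → 𝓧}
    (hφ : Measurable φ) (hc : Measurable c) (hcZ : HasLaw (fun ω => c (Z ω)) ν P)
    {g : 𝓧 → 𝓧 → ℝ} (hg : Measurable (Function.uncurry g)) (hg0 : ∀ᵐ x ∂ν, ∫ y, g x y ∂ν = 0)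
    (hint : Integrable (fun ω => φ (Z ω) * g (c (Z ω)) (Y ω)) P) :
    ∫ ω, φ (Z ω) * g (c (Z ω)) (Y ω) ∂P = 0 := by
  have hZl : HasLaw Z (P.map Z) P := ⟨hZ, rfl⟩
  have : IsProbabilityMeasure (P.map Z) := Measure.isProbabilityMeasure_map hZ
  have hlaw := (indepFun_iff_hasLaw_prodMk_prod hZl hY).1 hind
  let F : 𝓩 × 𝓧 → ℝ := fun p => φ p.1 * g (c p.1) p.2
  have hF : Measurable F :=
    (hφ.comp measurable_fst).mul (hg.comp ((hc.comp measurable_fst).prodMk measurable_snd))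
  have h1 : ∫ ω, F (Z ω, Y ω) ∂P = ∫ p, F p ∂((P.map Z).prod ν) :=
    hlaw.integral_comp hF.aestronglyMeasurable
  have h2 : Integrable F ((P.map Z).prod ν) := by
    rw [← hlaw.map_eq, integrable_map_measure hF.aestronglyMeasurable hlaw.aemeasurable]
    exact hint
  change ∫ ω, F (Z ω, Y ω) ∂P = 0
  rw [h1, integral_prod _ h2]
  refine integral_eq_zero_of_ae ?_
  -- The projection of g vanishes only off a ν-null set; since c(Z) has law ν, the preimage of this
  -- set under c is null for the law of Z.
  have h3 : ∀ᵐ z ∂(P.map Z), ∫ y, g (c z) y ∂ν = 0 := by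
    have h4 : (P.map Z).map c = ν := by
      rw [AEMeasurable.map_map_of_aemeasurable hc.aemeasurable hZ]
      exact hcZ.map_eq
    rw [← h4] at hg0
    have := ae_of_ae_map hc.aemeasurable hg0
    rwa [h4] at this
  filter_upwards [h3] with z hz
  simp only [F, integral_const_mul, hz, mul_zero, Pi.zero_apply]

/-- A function of finitely many of the variables is orthogonal to `g(X_c, X_d)` if it does not
involve `X_d`. -/
theorem integral_mul_kernel_eq_zero_of_notMem (hX : ∀ i, HasLaw (X i) ν P) (hind : iIndepFun X P)
    {S : Finset ℕ} {c d : ℕ} (hc : c ∈ S) (hd : d ∉ S) {φ : (S → 𝓧) → ℝ} (hφ : Measurable φ)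
    {g : 𝓧 → 𝓧 → ℝ} (hg : Measurable (Function.uncurry g)) (hg0 : ∀ᵐ x ∂ν, ∫ y, g x y ∂ν = 0)
    (hint : Integrable (fun ω => φ (fun i => X i ω) * g (X c ω) (X d ω)) P) :
    ∫ ω, φ (fun i => X i ω) * g (X c ω) (X d ω) ∂P = 0 := by
  have hi := hind.indepFun_finset₀ S {d} (by simpa using hd) (fun i => (hX i).aemeasurable)
  have hi2 : IndepFun (fun ω (i : S) => X i ω) (X d) P :=
    hi.comp measurable_id (measurable_pi_apply (⟨d, by simp⟩ : ({d} : Finset ℕ)))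
  exact integral_mul_kernel_eq_zero (Z := fun ω (i : S) => X i ω) (c := fun z => z ⟨c, hc⟩)
    (aemeasurable_pi_lambda _ fun i => (hX i).aemeasurable) (hX d) hi2 hφ
    (measurable_pi_apply _) (hX c) hg hg0 hint

/-- Two different unordered pairs leave c or d outside {a, b}, and that variable is integrated
first. If it is c, the flipped kernel brings it to the second place. -/
theorem integral_kernel_mul_kernel_eq_zero (hX : ∀ i, HasLaw (X i) ν P) (hind : iIndepFun X P)
    {g : 𝓧 → 𝓧 → ℝ} (hg : IsCanonical g ν) {a b c d : ℕ} (hab : a ≠ b) (hcd : c ≠ d)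
    (h1 : (a, b) ≠ (c, d)) (h2 : (a, b) ≠ (d, c)) :
    ∫ ω, g (X a ω) (X b ω) * g (X c ω) (X d ω) ∂P = 0 := by
  have hint : ∀ {g' : 𝓧 → 𝓧 → ℝ}, IsCanonical g' ν → ∀ {c d : ℕ}, c ≠ d →
      Integrable (fun ω => g (X a ω) (X b ω) * g' (X c ω) (X d ω)) P := fun hg' _ _ hcd =>
    (memLp_kernel_pair hX hind hab hg.memLp).integrable_mul
      (memLp_kernel_pair hX hind hcd hg'.memLp)
  have key : ∀ {g' : 𝓧 → 𝓧 → ℝ}, IsCanonical g' ν → ∀ {c d : ℕ}, c ≠ d → d ≠ a → d ≠ b →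
      ∫ ω, g (X a ω) (X b ω) * g' (X c ω) (X d ω) ∂P = 0 := by
    intro g' hg' c d hcd hda hdb
    let S : Finset ℕ := {a, b, c}
    have hS : d ∉ S := by simp [S, hda, hdb, hcd.symm]
    have hm : Measurable fun z : S → 𝓧 => g (z ⟨a, by simp [S]⟩) (z ⟨b, by simp [S]⟩) :=
      hg.measurable.comp (f := fun z : S → 𝓧 => (z ⟨a, by simp [S]⟩, z ⟨b, by simp [S]⟩))
        ((measurable_pi_apply _).prodMk (measurable_pi_apply _))
    exact integral_mul_kernel_eq_zero_of_notMem hX hind (S := S) (c := c) (by simp [S]) hS hm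
      hg'.measurable hg'.right (hint hg' hcd)
  by_cases hd : d ≠ a ∧ d ≠ b
  · exact key hg hcd hd.1 hd.2
  · have hc : c ≠ a ∧ c ≠ b := by
      simp only [ne_eq, Prod.mk.injEq] at h1 h2
      omega
    exact key hg.flip hcd.symm hc.1 hc.2

/-- At least one of a and b differs from i, and integrating out that variable gives zero. -/
theorem integral_fun_mul_kernel_eq_zero (hX : ∀ i, HasLaw (X i) ν P) (hind : iIndepFun X P)
    {g : 𝓧 → 𝓧 → ℝ} (hg : IsCanonical g ν) {φ : 𝓧 → ℝ} (hφ : Measurable φ) (hφ2 : MemLp φ 2 ν)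
    (i : ℕ) {a b : ℕ} (hab : a ≠ b) :
    ∫ ω, φ (X i ω) * g (X a ω) (X b ω) ∂P = 0 := by
  have key : ∀ {g' : 𝓧 → 𝓧 → ℝ}, IsCanonical g' ν → ∀ {a b : ℕ}, a ≠ b → b ≠ i →
      ∫ ω, φ (X i ω) * g' (X a ω) (X b ω) ∂P = 0 := by
    intro g' hg' a b hab hbi
    let S : Finset ℕ := {i, a}
    have hS : b ∉ S := by simp [S, hbi, hab.symm]
    exact integral_mul_kernel_eq_zero_of_notMem hX hind (S := S) (c := a) (by simp [S]) hS
      (φ := fun z => φ (z ⟨i, by simp [S]⟩)) (hφ.comp (measurable_pi_apply _))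
      hg'.measurable hg'.right ((memLp_comp_of_hasLaw (hX i) hφ2).integrable_mul
        (memLp_kernel_pair hX hind hab hg'.memLp))
  by_cases hb : b ≠ i
  · exact key hg hab hb
  · exact key hg.flip hab.symm (by omega)

theorem integral_kernel_pair_eq_zero (hX : ∀ i, HasLaw (X i) ν P) (hind : iIndepFun X P)
    {g : 𝓧 → 𝓧 → ℝ} (hg : IsCanonical g ν) {a b : ℕ} (hab : a ≠ b) :
    ∫ ω, g (X a ω) (X b ω) ∂P = 0 := by
  simpa using integral_fun_mul_kernel_eq_zero hX hind hg (φ := fun _ => 1) measurable_const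
    (memLp_const 1) 0 hab

theorem integral_sum_sq_of_pairwise_orthogonal {ι : Type*} (A : Finset ι) {Y : ι → Ω → ℝ}
    (hY : ∀ a ∈ A, MemLp (Y a) 2 P)
    (h0 : ∀ a ∈ A, ∀ b ∈ A, a ≠ b → ∫ ω, Y a ω * Y b ω ∂P = 0) :
    ∫ ω, (∑ a ∈ A, Y a ω) ^ 2 ∂P = ∑ a ∈ A, ∫ ω, Y a ω ^ 2 ∂P := by
  have hi : ∀ a ∈ A, ∀ b ∈ A, Integrable (fun ω => Y a ω * Y b ω) P := fun a ha b hb =>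
    (hY a ha).integrable_mul (hY b hb)
  simp_rw [sq, Finset.sum_mul_sum]
  rw [integral_finsetSum _ fun a ha => integrable_finsetSum _ (hi a ha)]
  refine Finset.sum_congr rfl fun a ha => ?_
  rw [integral_finsetSum _ (hi a ha),
    Finset.sum_eq_single a (fun b hb hba => h0 a ha b hb hba.symm) (fun h => absurd ha h)]

/-- `hinj` excludes repeated ordered pairs and `hswap` reversed ones, so all cross terms vanish. -/
theorem integral_weighted_kernel_sum_sq (hX : ∀ i, HasLaw (X i) ν P) (hind : iIndepFun X P)
    {g : 𝓧 → 𝓧 → ℝ} (hg : IsCanonical g ν) {ι : Type*} (A : Finset ι) (p : ι → ℕ × ℕ)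
    (w : ι → ℝ) (hp : ∀ a ∈ A, (p a).1 ≠ (p a).2) (hinj : Set.InjOn p A)
    (hswap : ∀ a ∈ A, ∀ b ∈ A, p a ≠ (p b).swap) :
    ∫ ω, (∑ a ∈ A, w a * g (X (p a).1 ω) (X (p a).2 ω)) ^ 2 ∂P
      = (∑ a ∈ A, w a ^ 2) * ∫ z, g z.1 z.2 ^ 2 ∂(ν.prod ν) := by
  rw [integral_sum_sq_of_pairwise_orthogonal A
    (fun a ha => (memLp_kernel_pair hX hind (hp a ha) hg.memLp).const_mul (w a)), Finset.sum_mul]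
  · refine Finset.sum_congr rfl fun a ha => ?_
    simp_rw [mul_pow, integral_const_mul]
    congr 1
    exact integral_kernel_pair hX hind (hp a ha) (G := fun z => g z.1 z.2 ^ 2)
      (hg.memLp.1.pow 2)
  · intro a ha b hb hab
    have := integral_kernel_mul_kernel_eq_zero hX hind hg (hp a ha) (hp b hb)
      (fun h => hab (hinj ha hb h)) (fun h => hswap a ha b hb h)
    calc _ = ∫ ω, (w a * w b) * (g (X (p a).1 ω) (X (p a).2 ω) * g (X (p b).1 ω) (X (p b).2 ω))
          ∂P := by
          congr 1; ext ω; ring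
      _ = 0 := by rw [integral_const_mul, this, mul_zero]

theorem memLp_weighted_kernel_sum (hX : ∀ i, HasLaw (X i) ν P) (hind : iIndepFun X P)
    {g : 𝓧 → 𝓧 → ℝ} (hg : MemLp (Function.uncurry g) 2 (ν.prod ν)) {ι : Type*} (A : Finset ι)
    (p : ι → ℕ × ℕ) (w : ι → ℝ) (hp : ∀ a ∈ A, (p a).1 ≠ (p a).2) :
    MemLp (fun ω => ∑ a ∈ A, w a * g (X (p a).1 ω) (X (p a).2 ω)) 2 P :=
  memLp_finsetSum _ fun a ha => (memLp_kernel_pair hX hind (hp a ha) hg).const_mul (w a)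

/-- When both (a, b) and (b, a) may occur, orthogonality is lost. Splitting into increasing and
decreasing pairs restores it at the cost of the factor 2. This is needed for truncated Fourier
weights, which do not vanish on shifts beyond n/2. -/
theorem integral_weighted_kernel_sum_sq_le (hX : ∀ i, HasLaw (X i) ν P) (hind : iIndepFun X P)
    {g : 𝓧 → 𝓧 → ℝ} (hg : IsCanonical g ν) {ι : Type*} (A : Finset ι) (p : ι → ℕ × ℕ)
    (w : ι → ℝ) (hp : ∀ a ∈ A, (p a).1 ≠ (p a).2) (hinj : Set.InjOn p A) :
    ∫ ω, (∑ a ∈ A, w a * g (X (p a).1 ω) (X (p a).2 ω)) ^ 2 ∂P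
      ≤ 2 * (∑ a ∈ A, w a ^ 2) * ∫ z, g z.1 z.2 ^ 2 ∂(ν.prod ν) := by
  let A₁ := A.filter fun a => (p a).1 < (p a).2
  let A₂ := A.filter fun a => ¬ (p a).1 < (p a).2
  have hA₁ : A₁ ⊆ A := Finset.filter_subset _ _
  have hA₂ : A₂ ⊆ A := Finset.filter_subset _ _
  have e₁ := integral_weighted_kernel_sum_sq hX hind hg A₁ p w (fun a ha => hp a (hA₁ ha))
    (hinj.mono (by exact_mod_cast hA₁)) (by
      intro a ha b hb h
      have h1 := (Finset.mem_filter.1 ha).2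
      have h2 := (Finset.mem_filter.1 hb).2
      rw [h] at h1
      exact lt_asymm h1 h2)
  have e₂ := integral_weighted_kernel_sum_sq hX hind hg A₂ p w (fun a ha => hp a (hA₂ ha))
    (hinj.mono (by exact_mod_cast hA₂)) (by
      intro a ha b hb h
      have h1 := (Finset.mem_filter.1 ha).2
      have h2 := (Finset.mem_filter.1 hb).2
      have h3 := hp b (hA₂ hb)
      rw [h] at h1
      simp only [Prod.fst_swap, Prod.snd_swap] at h1
      omega)
  have m₁ := memLp_weighted_kernel_sum hX hind hg.memLp A₁ p w (fun a ha => hp a (hA₁ ha))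
  have m₂ := memLp_weighted_kernel_sum hX hind hg.memLp A₂ p w (fun a ha => hp a (hA₂ ha))
  calc ∫ ω, (∑ a ∈ A, w a * g (X (p a).1 ω) (X (p a).2 ω)) ^ 2 ∂P
      ≤ ∫ ω, (2 * (∑ a ∈ A₁, w a * g (X (p a).1 ω) (X (p a).2 ω)) ^ 2
          + 2 * (∑ a ∈ A₂, w a * g (X (p a).1 ω) (X (p a).2 ω)) ^ 2) ∂P := by
        refine integral_mono_of_nonneg (Eventually.of_forall fun ω => sq_nonneg _)
          ((m₁.integrable_sq.const_mul 2).add (m₂.integrable_sq.const_mul 2))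
          (Eventually.of_forall fun ω => ?_)
        simp only
        rw [← Finset.sum_filter_add_sum_filter_not A fun a => (p a).1 < (p a).2]
        nlinarith [sq_nonneg ((∑ a ∈ A₁, w a * g (X (p a).1 ω) (X (p a).2 ω))
          - ∑ a ∈ A₂, w a * g (X (p a).1 ω) (X (p a).2 ω))]
    _ = 2 * (∑ a ∈ A, w a ^ 2) * ∫ z, g z.1 z.2 ^ 2 ∂(ν.prod ν) := by
        rw [integral_add (m₁.integrable_sq.const_mul 2) (m₂.integrable_sq.const_mul 2),
          integral_const_mul, integral_const_mul, e₁, e₂,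
          ← Finset.sum_filter_add_sum_filter_not A fun a => (p a).1 < (p a).2]
        ring

end SecondMoment

/-! ### A central limit theorem for weighted sums -/

section TriangularCLT

/-- Taylor's formula gives |y|³ for small y, and for |y| ≥ 1 the trivial bound 2 + |y| + y²/2 is at
most 4y². The form y² min(1, |y|) permits dominated convergence with second moments only. -/
theorem norm_cexp_sub_quadratic_le (y : ℝ) :
    ‖Complex.exp (y * Complex.I) - (1 + y * Complex.I - (y : ℂ) ^ 2 / 2)‖
      ≤ 4 * (y ^ 2 * min 1 |y|) := by
  have hn : ‖(y : ℂ) * Complex.I‖ = |y| := by simp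
  rcases le_total |y| 1 with h | h
  · have := Complex.exp_bound (x := y * Complex.I) (by rw [hn]; exact h) (n := 3) (by norm_num)
    rw [hn] at this
    simp only [Finset.sum_range_succ, Finset.sum_range_zero, Nat.factorial] at this
    rw [min_eq_right h]
    have e : (0 + ((y : ℂ) * Complex.I) ^ 0 / ((1 : ℕ) : ℂ)
        + ((y : ℂ) * Complex.I) ^ 1 / (((0 + 1) * 1 : ℕ) : ℂ)
        + ((y : ℂ) * Complex.I) ^ 2 / (((1 + 1) * ((0 + 1) * 1) : ℕ) : ℂ))
        = 1 + y * Complex.I - (y : ℂ) ^ 2 / 2 := by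
      have h2 : ((y : ℂ) * Complex.I) ^ 2 = -(y : ℂ) ^ 2 := by
        rw [mul_pow, Complex.I_sq]; ring
      rw [h2]
      push_cast
      ring
    rw [e] at this
    refine this.trans ?_
    have h0 := abs_nonneg y
    have h1 : |y| ^ 3 = y ^ 2 * |y| := by rw [pow_succ, sq_abs]
    rw [h1]
    norm_num
    have : 0 ≤ y ^ 2 * |y| := by positivity
    linarith
  · rw [min_eq_left h]
    have h1 : ‖Complex.exp (y * Complex.I)‖ = 1 := Complex.norm_exp_ofReal_mul_I y
    have h2 : ‖(1 : ℂ) + y * Complex.I - (y : ℂ) ^ 2 / 2‖ ≤ 1 + |y| + y ^ 2 / 2 := by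
      refine (norm_sub_le _ _).trans (add_le_add ((norm_add_le _ _).trans (by simp)) ?_)
      simp [sq_abs]
    refine (norm_sub_le _ _).trans ?_
    rw [h1]
    have h3 : |y| ^ 2 = y ^ 2 := sq_abs y
    nlinarith

/-- Telescoping: the factors are exchanged one at a time, the others having modulus at most 1. -/
theorem norm_prod_sub_prod_le {ι : Type*} (s : Finset ι) (a b : ι → ℂ) (ha : ∀ i ∈ s, ‖a i‖ ≤ 1)
    (hb : ∀ i ∈ s, ‖b i‖ ≤ 1) : ‖∏ i ∈ s, a i - ∏ i ∈ s, b i‖ ≤ ∑ i ∈ s, ‖a i - b i‖ := by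
  classical
  induction s using Finset.induction_on with
  | empty => simp
  | insert j s hj ih =>
    rw [Finset.prod_insert hj, Finset.prod_insert hj, Finset.sum_insert hj]
    have ih' := ih (fun i hi => ha i (Finset.mem_insert_of_mem hi))
      (fun i hi => hb i (Finset.mem_insert_of_mem hi))
    have h1 : ‖∏ i ∈ s, a i‖ ≤ 1 := by
      rw [norm_prod]
      exact Finset.prod_le_one (fun _ _ => norm_nonneg _)
        (fun i hi => ha i (Finset.mem_insert_of_mem hi))
    have h2 := hb j (Finset.mem_insert_self j s)
    calc ‖a j * ∏ i ∈ s, a i - b j * ∏ i ∈ s, b i‖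
        = ‖(a j - b j) * ∏ i ∈ s, a i + b j * (∏ i ∈ s, a i - ∏ i ∈ s, b i)‖ := by
          congr 1; ring
      _ ≤ ‖a j - b j‖ * 1 + 1 * ‖∏ i ∈ s, a i - ∏ i ∈ s, b i‖ := by
          refine (norm_add_le _ _).trans ?_
          rw [norm_mul, norm_mul]
          gcongr
      _ ≤ _ := by linarith

theorem abs_exp_neg_sub_le {x : ℝ} (hx : 0 ≤ x) : |Real.exp (-x) - (1 - x)| ≤ x ^ 2 := by
  rcases le_total x 1 with h | h
  · have := Real.abs_exp_sub_one_sub_id_le (x := -x) (by rw [abs_neg, abs_of_nonneg hx]; exact h)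
    calc |Real.exp (-x) - (1 - x)| = |Real.exp (-x) - 1 - -x| := by congr 1; ring
      _ ≤ (-x) ^ 2 := this
      _ = x ^ 2 := by ring
  · have h1 := Real.exp_le_one_iff.2 (neg_nonpos.2 hx)
    have h2 := Real.add_one_le_exp (-x)
    rw [abs_of_nonneg (by linarith)]
    nlinarith

variable {Ω 𝓧 : Type*} [MeasurableSpace Ω] [MeasurableSpace 𝓧]
  {P : Measure Ω} [IsProbabilityMeasure P] {ν : Measure 𝓧} [IsProbabilityMeasure ν]
  {X : ℕ → Ω → 𝓧}

theorem integrable_cexp_mul_I {α : Type*} [MeasurableSpace α] {m : Measure α} [IsFiniteMeasure m]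
    {Y : α → ℝ} (hY : AEMeasurable Y m) :
    Integrable (fun ω => Complex.exp (Y ω * Complex.I)) m := by
  refine (integrable_const (1 : ℝ)).mono' ?_ (Eventually.of_forall fun ω => ?_)
  · exact (by fun_prop : AEMeasurable (fun ω => Complex.exp (Y ω * Complex.I)) m).aestronglyMeasurable
  · rw [Complex.norm_exp_ofReal_mul_I]

theorem norm_integral_cexp_le_one {α : Type*} [MeasurableSpace α] {m : Measure α}
    [IsProbabilityMeasure m] (Y : α → ℝ) :
    ‖∫ ω, Complex.exp (Y ω * Complex.I) ∂m‖ ≤ 1 := by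
  refine (norm_integral_le_of_norm_le_const (C := 1) (Eventually.of_forall fun ω => ?_)).trans
    (by simp)
  rw [Complex.norm_exp_ofReal_mul_I]

/-- The second order expansion is integrated; the linear term drops out because ψ is centred. The
error involves ψ only through its envelope G, hence is uniform over an array with a common envelope.
-/
theorem norm_integral_cexp_sub_le {ψ G : 𝓧 → ℝ} (hψ : Measurable ψ) (hG : MemLp G 2 ν)
    (hb : ∀ x, |ψ x| ≤ G x) (h0 : ∫ x, ψ x ∂ν = 0) {c : ℝ} (hc : 0 ≤ c) :
    ‖∫ x, Complex.exp ((c * ψ x : ℝ) * Complex.I) ∂ν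
        - ((1 - c ^ 2 * (∫ x, ψ x ^ 2 ∂ν) / 2 : ℝ) : ℂ)‖
      ≤ 4 * c ^ 2 * ∫ x, G x ^ 2 * min 1 (c * G x) ∂ν := by
  have hψ2 : MemLp ψ 2 ν := hG.mono hψ.aestronglyMeasurable (Eventually.of_forall fun x => by
    rw [Real.norm_eq_abs]; exact (hb x).trans (le_abs_self _))
  have i1 : Integrable ψ ν := hψ2.integrable (by norm_num)
  have i2 : Integrable (fun x => ψ x ^ 2) ν := hψ2.integrable_sq
  have hG0 : ∀ x, 0 ≤ G x := fun x => (abs_nonneg _).trans (hb x)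
  have i3 : Integrable (fun x => G x ^ 2 * min 1 (c * G x)) ν := by
    refine hG.integrable_sq.mono (by
      have := hG.1
      exact (this.pow 2).mul (aestronglyMeasurable_const.inf (this.const_mul c)))
      (Eventually.of_forall fun x => ?_)
    rw [norm_mul]
    refine mul_le_of_le_one_right (norm_nonneg _) ?_
    rw [Real.norm_eq_abs, abs_of_nonneg (le_min zero_le_one (mul_nonneg hc (hG0 x)))]
    exact min_le_left _ _
  have hi := integrable_cexp_mul_I (m := ν) (Y := fun x => c * ψ x) (hψ.const_mul c).aemeasurable
  have iq : Integrable (fun x => (1 : ℂ) + ((c * ψ x : ℝ) : ℂ) * Complex.I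
      - ((c * ψ x : ℝ) : ℂ) ^ 2 / 2) ν := by
    have e : (fun x => (1 : ℂ) + ((c * ψ x : ℝ) : ℂ) * Complex.I - ((c * ψ x : ℝ) : ℂ) ^ 2 / 2)
        = fun x => (1 : ℂ) + ((c * ψ x : ℝ) : ℂ) * Complex.I
          - ((c ^ 2 / 2 * ψ x ^ 2 : ℝ) : ℂ) := by
      ext x; push_cast; ring
    rw [e]
    exact ((integrable_const _).add ((i1.const_mul c).ofReal.mul_const _)).sub
      (i2.const_mul (c ^ 2 / 2)).ofReal
  have eq : ∫ x, ((1 : ℂ) + ((c * ψ x : ℝ) : ℂ) * Complex.I - ((c * ψ x : ℝ) : ℂ) ^ 2 / 2) ∂ν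
      = ((1 - c ^ 2 * (∫ x, ψ x ^ 2 ∂ν) / 2 : ℝ) : ℂ) := by
    have e : (fun x => (1 : ℂ) + ((c * ψ x : ℝ) : ℂ) * Complex.I - ((c * ψ x : ℝ) : ℂ) ^ 2 / 2)
        = fun x => (1 : ℂ) + ((c * ψ x : ℝ) : ℂ) * Complex.I
          - ((c ^ 2 / 2 * ψ x ^ 2 : ℝ) : ℂ) := by
      ext x; push_cast; ring
    have j1 : Integrable (fun x => ((c * ψ x : ℝ) : ℂ) * Complex.I) ν :=
      (i1.const_mul c).ofReal.mul_const _
    have j2 : Integrable (fun x => ((c ^ 2 / 2 * ψ x ^ 2 : ℝ) : ℂ)) ν :=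
      (i2.const_mul (c ^ 2 / 2)).ofReal
    have j3 : Integrable (fun x => (1 : ℂ) + ((c * ψ x : ℝ) : ℂ) * Complex.I) ν :=
      (integrable_const _).add j1
    rw [e, integral_sub j3 j2, integral_add (integrable_const _) j1,
      integral_mul_const, integral_complex_ofReal, integral_complex_ofReal, integral_const_mul,
      integral_const_mul, h0]
    simp
    ring
  rw [← eq, ← integral_sub hi iq]
  refine (norm_integral_le_of_norm_le (i3.const_mul (4 * c ^ 2))
    (Eventually.of_forall fun x => ?_)).trans (by rw [integral_const_mul])
  refine (norm_cexp_sub_quadratic_le (c * ψ x)).trans ?_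
  have h1 : (c * ψ x) ^ 2 ≤ c ^ 2 * G x ^ 2 := by
    rw [mul_pow, ← sq_abs (ψ x)]
    have := hb x
    gcongr
  have h2 : min 1 |c * ψ x| ≤ min 1 (c * G x) := by
    rw [abs_mul, abs_of_nonneg hc]
    exact min_le_min le_rfl (mul_le_mul_of_nonneg_left (hb x) hc)
  calc 4 * ((c * ψ x) ^ 2 * min 1 |c * ψ x|) ≤ 4 * ((c ^ 2 * G x ^ 2) * min 1 (c * G x)) := by
        gcongr
    _ = _ := by ring

/-- Dominated convergence with majorant G². For arrays dominated by G this plays the part of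
Lindeberg's condition. -/
theorem tendsto_integral_sq_mul_min {G : 𝓧 → ℝ} (hG : MemLp G 2 ν) (hG0 : ∀ x, 0 ≤ G x) :
    Tendsto (fun n : ℕ => ∫ x, G x ^ 2 * min 1 ((√(n : ℝ))⁻¹ * G x) ∂ν) atTop (𝓝 0) := by
  have h := tendsto_integral_of_dominated_convergence (μ := ν)
    (F := fun (n : ℕ) x => G x ^ 2 * min 1 ((√(n : ℝ))⁻¹ * G x)) (f := fun _ => 0)
    (fun x => G x ^ 2) (fun n => (hG.1.pow 2).mul
      (aestronglyMeasurable_const.inf (hG.1.const_mul _))) hG.integrable_sq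
    (fun n => Eventually.of_forall fun x => ?_) (Eventually.of_forall fun x => ?_)
  · simpa using h
  · rw [norm_mul, norm_pow, Real.norm_of_nonneg (hG0 x), Real.norm_of_nonneg
      (le_min zero_le_one (mul_nonneg (by positivity) (hG0 x)))]
    exact mul_le_of_le_one_right (sq_nonneg _) (min_le_left _ _)
  · have h1 : Tendsto (fun n : ℕ => (√(n : ℝ))⁻¹ * G x) atTop (𝓝 (0 * G x)) :=
      (tendsto_inv_atTop_zero.comp
        (Real.tendsto_sqrt_atTop.comp tendsto_natCast_atTop_atTop)).mul_const _
    have h2 := (tendsto_const_nhds (x := (1 : ℝ))).min h1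
    have h3 := h2.const_mul (G x ^ 2)
    simpa using h3

theorem integral_cexp_sum_eq_prod (hX : ∀ i, HasLaw (X i) ν P) (hind : iIndepFun X P)
    {ψ : ℕ → 𝓧 → ℝ} (hψ : ∀ i, Measurable (ψ i)) (n : ℕ) :
    ∫ ω, Complex.exp ((∑ i ∈ Finset.range n, ψ i (X i ω) : ℝ) * Complex.I) ∂P
      = ∏ i ∈ Finset.range n, ∫ x, Complex.exp (ψ i x * Complex.I) ∂ν := by
  have h := (hind.precomp (g := fun i : Fin n => (i : ℕ)) Fin.val_injective).integral_fun_prod_comp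
    (f := fun (i : Fin n) x => Complex.exp (ψ i x * Complex.I))
    (fun i => (hX i).aemeasurable) (fun i =>
      (by have := hψ i; fun_prop : Measurable fun x => Complex.exp (ψ i x * Complex.I)).aestronglyMeasurable)
  rw [Finset.prod_range]
  refine Eq.trans ?_ (h.trans ?_)
  · congr 1
    ext ω
    rw [← Complex.exp_sum, Finset.sum_range, Complex.ofReal_sum, Finset.sum_mul]
  · refine Finset.prod_congr rfl fun i _ => ?_
    exact (hX i).integral_comp (f := fun x => Complex.exp (ψ i x * Complex.I))
      (by have := hψ i; fun_prop : Measurable fun x => Complex.exp (ψ i x * Complex.I)).aestronglyMeasurable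

/-- Central limit theorem for triangular arrays `ψ n i (X i)` dominated by a square-integrable
function, in terms of characteristic functions. -/
theorem tendsto_integral_cexp_triangular (hX : ∀ i, HasLaw (X i) ν P) (hind : iIndepFun X P)
    {ψ : ℕ → ℕ → 𝓧 → ℝ} (hψ : ∀ n i, Measurable (ψ n i)) {G : 𝓧 → ℝ} (hG : MemLp G 2 ν)
    (hb : ∀ n i x, |ψ n i x| ≤ G x) (h0 : ∀ n i, ∫ x, ψ n i x ∂ν = 0) {s : ℝ}
    (hs : Tendsto (fun n : ℕ => (n : ℝ)⁻¹ * ∑ i ∈ Finset.range n, ∫ x, ψ n i x ^ 2 ∂ν) atTop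
      (𝓝 s)) :
    Tendsto (fun n : ℕ => ∫ ω, Complex.exp
      (((√(n : ℝ))⁻¹ * ∑ i ∈ Finset.range n, ψ n i (X i ω) : ℝ) * Complex.I) ∂P) atTop
      (𝓝 (Complex.exp (-(s : ℂ) / 2))) := by
  have hG0 : ∀ x, 0 ≤ G x := fun x => (abs_nonneg _).trans (hb 0 0 x)
  let σ : ℕ → ℕ → ℝ := fun n i => ∫ x, ψ n i x ^ 2 ∂ν
  let C : ℝ := ∫ x, G x ^ 2 ∂ν
  have hσ0 : ∀ n i, 0 ≤ σ n i := fun n i => integral_nonneg fun x => sq_nonneg _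
  have hσC : ∀ n i, σ n i ≤ C := fun n i => by
    refine integral_mono_of_nonneg (Eventually.of_forall fun x => sq_nonneg _) hG.integrable_sq
      (Eventually.of_forall fun x => ?_)
    simp only
    rw [← sq_abs]
    have := hb n i x
    gcongr
  let δ : ℕ → ℝ := fun n => ∫ x, G x ^ 2 * min 1 ((√(n : ℝ))⁻¹ * G x) ∂ν
  have hδ : Tendsto δ atTop (𝓝 0) := tendsto_integral_sq_mul_min hG hG0
  -- Each characteristic function is compared with the Gaussian one of the same variance. The error
  -- per factor is o(1/n), uniformly in i, so n factors contribute o(1).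
  let b : ℕ → ℕ → ℂ := fun n i => ((Real.exp (-(((√(n : ℝ))⁻¹) ^ 2 * σ n i / 2)) : ℝ) : ℂ)
  let a : ℕ → ℕ → ℂ := fun n i =>
    ∫ x, Complex.exp (((√(n : ℝ))⁻¹ * ψ n i x : ℝ) * Complex.I) ∂ν
  have hprod : ∀ n : ℕ, ∫ ω, Complex.exp
      (((√(n : ℝ))⁻¹ * ∑ i ∈ Finset.range n, ψ n i (X i ω) : ℝ) * Complex.I) ∂P
      = ∏ i ∈ Finset.range n, a n i := by
    intro n
    rw [← integral_cexp_sum_eq_prod hX hind (ψ := fun i x => (√(n : ℝ))⁻¹ * ψ n i x)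
      (fun i => (hψ n i).const_mul _) n]
    simp_rw [Finset.mul_sum]
  have hsq : ∀ n : ℕ, ((√(n : ℝ))⁻¹) ^ 2 = (n : ℝ)⁻¹ := fun n => by
    rw [inv_pow, Real.sq_sqrt (Nat.cast_nonneg n)]
  have hdiff : ∀ n i, ‖a n i - b n i‖ ≤ 4 * (n : ℝ)⁻¹ * δ n + ((n : ℝ)⁻¹ * C / 2) ^ 2 := by
    intro n i
    have h1 := norm_integral_cexp_sub_le (hψ n i) hG (hb n i) (h0 n i)
      (c := (√(n : ℝ))⁻¹) (by positivity)
    rw [hsq] at h1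
    have h2 := abs_exp_neg_sub_le (x := (n : ℝ)⁻¹ * σ n i / 2)
      (by have := hσ0 n i; positivity)
    have h3 : ‖((1 - (n : ℝ)⁻¹ * σ n i / 2 : ℝ) : ℂ) - b n i‖ ≤ ((n : ℝ)⁻¹ * C / 2) ^ 2 := by
      simp only [b, hsq]
      rw [← Complex.ofReal_sub, Complex.norm_real, Real.norm_eq_abs, abs_sub_comm]
      refine h2.trans ?_
      have h4 := hσC n i
      have h5 := hσ0 n i
      gcongr
    calc ‖a n i - b n i‖ = ‖(a n i - ((1 - (n : ℝ)⁻¹ * σ n i / 2 : ℝ) : ℂ))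
          + (((1 - (n : ℝ)⁻¹ * σ n i / 2 : ℝ) : ℂ) - b n i)‖ := by congr 1; ring
      _ ≤ _ := (norm_add_le _ _).trans (add_le_add h1 h3)
  have hb1 : ∀ n i, ‖b n i‖ ≤ 1 := fun n i => by
    simp only [b]
    rw [Complex.norm_real, Real.norm_of_nonneg (Real.exp_pos _).le, Real.exp_le_one_iff,
      neg_nonpos]
    have := hσ0 n i
    positivity
  have hlim1 : Tendsto (fun n : ℕ => ∏ i ∈ Finset.range n, a n i - ∏ i ∈ Finset.range n, b n i)
      atTop (𝓝 0) := by
    have hlim : Tendsto (fun n : ℕ => 4 * δ n + C ^ 2 / 4 * (n : ℝ)⁻¹) atTop (𝓝 0) := by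
      have := (hδ.const_mul 4).add ((tendsto_inv_atTop_nhds_zero_nat (𝕜 := ℝ)).const_mul (C ^ 2 / 4))
      simpa using this
    refine squeeze_zero_norm' ?_ hlim
    filter_upwards [eventually_gt_atTop 0] with n hn
    refine (norm_prod_sub_prod_le _ _ _ (fun i _ => norm_integral_cexp_le_one _)
      (fun i _ => hb1 n i)).trans ?_
    refine (Finset.sum_le_sum fun i _ => hdiff n i).trans (le_of_eq ?_)
    have : (n : ℝ) ≠ 0 := by positivity
    rw [Finset.sum_const, Finset.card_range, nsmul_eq_mul]
    field_simp
    ring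
  have hlim2 : Tendsto (fun n : ℕ => ∏ i ∈ Finset.range n, b n i) atTop
      (𝓝 (Complex.exp (-(s : ℂ) / 2))) := by
    have e : ∀ n : ℕ, ∏ i ∈ Finset.range n, b n i
        = ((Real.exp (-((n : ℝ)⁻¹ * ∑ i ∈ Finset.range n, σ n i) / 2) : ℝ) : ℂ) := by
      intro n
      simp only [b, hsq]
      rw [← Complex.ofReal_prod, ← Real.exp_sum]
      congr 2
      rw [Finset.mul_sum, neg_div, Finset.sum_div, ← Finset.sum_neg_distrib]
    simp_rw [e]
    have h1 : Complex.exp (-(s : ℂ) / 2) = ((Real.exp (-s / 2) : ℝ) : ℂ) := by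
      push_cast; rfl
    rw [h1]
    exact (Complex.continuous_ofReal.tendsto _).comp ((Real.continuous_exp.tendsto _).comp
      (hs.neg.div_const 2))
  simp_rw [hprod]
  simpa using hlim1.add hlim2

/-- The map y ↦ exp(iy) is 1-Lipschitz on the real line; Cauchy–Schwarz does the rest. Through this
bound every mean square approximation passes to characteristic functions. -/
theorem norm_integral_cexp_sub_cexp_le {Y Z : Ω → ℝ} (hY : MemLp Y 2 P) (hZ : MemLp Z 2 P) :
    ‖∫ ω, Complex.exp (Y ω * Complex.I) ∂P - ∫ ω, Complex.exp (Z ω * Complex.I) ∂P‖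
      ≤ √(∫ ω, (Y ω - Z ω) ^ 2 ∂P) := by
  rw [← integral_sub (integrable_cexp_mul_I hY.1.aemeasurable)
    (integrable_cexp_mul_I hZ.1.aemeasurable)]
  have hYZ : MemLp (fun ω => Y ω - Z ω) 2 P := hY.sub hZ
  have h1 : ‖∫ ω, (Complex.exp (Y ω * Complex.I) - Complex.exp (Z ω * Complex.I)) ∂P‖
      ≤ ∫ ω, |Y ω - Z ω| ∂P := by
    refine norm_integral_le_of_norm_le (hYZ.integrable (by norm_num)).abs
      (Eventually.of_forall fun ω => ?_)
    have e : Complex.exp (Y ω * Complex.I) - Complex.exp (Z ω * Complex.I)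
        = Complex.exp (Z ω * Complex.I)
          * (Complex.exp (Complex.I * ((Y ω - Z ω : ℝ) : ℂ)) - 1) := by
      rw [mul_sub, ← Complex.exp_add, mul_one]
      congr 2
      push_cast; ring
    rw [e, norm_mul, Complex.norm_exp_ofReal_mul_I, one_mul]
    simpa using Real.norm_exp_I_mul_ofReal_sub_one_le (x := Y ω - Z ω)
  refine h1.trans (Real.le_sqrt_of_sq_le ?_)
  -- Nonnegativity of the variance of |Y - Z| is the inequality (E|Y - Z|)² ≤ E(Y - Z)².
  have hv := variance_nonneg (fun ω => |Y ω - Z ω|) P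
  have ha : MemLp (fun ω => |Y ω - Z ω|) 2 P := hYZ.abs
  rw [variance_eq_sub ha] at hv
  simp only [Pi.pow_apply, sq_abs] at hv
  linarith

/-- Interchange of limits. It serves twice: to truncate the Fourier series of the weights, and to
truncate the spectral expansions of the kernel. -/
theorem tendsto_of_forall_approx {E : Type*} [SeminormedAddCommGroup E] {a : ℕ → E} {A : E}
    (h : ∀ ε > 0, ∃ (b : ℕ → E) (B : E), Tendsto b atTop (𝓝 B) ∧
      (∀ᶠ n in atTop, ‖a n - b n‖ ≤ ε) ∧ ‖A - B‖ ≤ ε) : Tendsto a atTop (𝓝 A) := by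
  rw [Metric.tendsto_nhds]
  intro ε hε
  obtain ⟨b, B, hb, hab, hAB⟩ := h (ε / 4) (by positivity)
  filter_upwards [hab, Metric.tendsto_nhds.1 hb (ε / 4) (by positivity)] with n h1 h2
  rw [dist_eq_norm] at h2 ⊢
  calc ‖a n - A‖ = ‖(a n - b n) + (b n - B) - (A - B)‖ := by congr 1; abel
    _ ≤ ‖a n - b n‖ + ‖b n - B‖ + ‖A - B‖ :=
        (norm_sub_le _ _).trans (add_le_add_left (norm_add_le _ _) _)
    _ < ε := by linarith

end TriangularCLT

/-! ### Riemann sums, the square wave, and the product formula for `cosh` -/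

section Analysis

/-- The Riemann sum is the integral over [0, 1] of the step function x ↦ F(⌊nx⌋/n), which converges
wherever F is continuous. Continuity almost everywhere is asked because the square wave jumps. -/
theorem tendsto_riemann_sum {F : ℝ → ℝ} (hm : Measurable F) {C : ℝ} (hC : ∀ x, |F x| ≤ C)
    (hc : ∀ᵐ x, ContinuousAt F x) :
    Tendsto (fun n : ℕ => (n : ℝ)⁻¹ * ∑ i ∈ Finset.range n, F (i / n)) atTop
      (𝓝 (∫ x in (0 : ℝ)..1, F x)) := by
  have hmeas : ∀ n : ℕ, Measurable fun x : ℝ => F ((⌊(n : ℝ) * x⌋₊ : ℝ) / n) := fun n =>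
    hm.comp ((measurable_from_nat.comp (Nat.measurable_floor.comp (measurable_const_mul _))).div_const _)
  have hint : ∀ (n : ℕ) (a b : ℝ),
      IntervalIntegrable (fun x : ℝ => F ((⌊(n : ℝ) * x⌋₊ : ℝ) / n)) volume a b := fun n a b =>
    (intervalIntegrable_const (c := C)).mono_fun (hmeas n).aestronglyMeasurable
      (Eventually.of_forall fun x => (hC _).trans (le_abs_self _))
  have h1 : Tendsto (fun n : ℕ => ∫ x in (0 : ℝ)..1, F ((⌊(n : ℝ) * x⌋₊ : ℝ) / n)) atTop
      (𝓝 (∫ x in (0 : ℝ)..1, F x)) := by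
    refine intervalIntegral.tendsto_integral_filter_of_dominated_convergence (fun _ => C)
      (Eventually.of_forall fun n => (hmeas n).aestronglyMeasurable)
      (Eventually.of_forall fun n => Eventually.of_forall fun x _ => hC _)
      intervalIntegrable_const ?_
    filter_upwards [hc] with x hx hx2
    rw [Set.uIoc_of_le zero_le_one] at hx2
    refine hx.tendsto.comp ?_
    have := (tendsto_nat_floor_mul_div_atTop hx2.1.le).comp (tendsto_natCast_atTop_atTop (R := ℝ))
    refine this.congr fun n => ?_
    simp [mul_comm]
  refine h1.congr' ?_
  filter_upwards [eventually_gt_atTop 0] with n hn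
  have hn' : (0 : ℝ) < n := by exact_mod_cast hn
  have h2 := intervalIntegral.sum_integral_adjacent_intervals (μ := volume) (n := n)
    (a := fun i : ℕ => (i : ℝ) / n) (fun k _ => hint n _ _)
  simp only [CharP.cast_eq_zero, zero_div, div_self hn'.ne'] at h2
  rw [← h2, Finset.mul_sum]
  refine Finset.sum_congr rfl fun i _ => ?_
  have h3 : ∫ x in ((i : ℝ) / n)..(((i + 1 : ℕ) : ℝ) / n), F ((⌊(n : ℝ) * x⌋₊ : ℝ) / n)
      = ∫ x in ((i : ℝ) / n)..(((i + 1 : ℕ) : ℝ) / n), F (i / n) := by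
    refine intervalIntegral.integral_congr_Ioo_of_le (by gcongr; simp) fun x hx => ?_
    have hf : ⌊(n : ℝ) * x⌋₊ = i := by
      rw [Set.mem_Ioo, div_lt_iff₀ hn', lt_div_iff₀ hn'] at hx
      refine (Nat.floor_eq_iff (by nlinarith [hx.1, (Nat.cast_nonneg i : (0 : ℝ) ≤ i)])).2
        ⟨by linarith [hx.1, mul_comm (n : ℝ) x], ?_⟩
      have := hx.2
      push_cast at this
      linarith [mul_comm (n : ℝ) x]
    simp only [hf]
  rw [h3, intervalIntegral.integral_const, smul_eq_mul]
  push_cast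
  field_simp
  ring

/-- The average of `F` over the grid `0, 1/n, …, (n-1)/n`. -/
def gridAvg (F : ℝ → ℝ) (n : ℕ) : ℝ := (n : ℝ)⁻¹ * ∑ i ∈ Finset.range n, F (i / n)

theorem tendsto_gridAvg_const (c : ℝ) : Tendsto (gridAvg fun _ => c) atTop (𝓝 c) := by
  refine tendsto_const_nhds.congr' ?_
  filter_upwards [eventually_gt_atTop 0] with n hn
  have : (n : ℝ) ≠ 0 := by positivity
  simp [gridAvg, this]

theorem tendsto_gridAvg_of_continuous {F : ℝ → ℝ} (hF : Continuous F) {C : ℝ}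
    (hC : ∀ x, |F x| ≤ C) : Tendsto (gridAvg F) atTop (𝓝 (∫ x in (0 : ℝ)..1, F x)) :=
  tendsto_riemann_sum hF.measurable hC (Eventually.of_forall fun _ => hF.continuousAt)

theorem tendsto_gridAvg_cos {m : ℤ} (hm : m ≠ 0) :
    Tendsto (gridAvg fun τ => Real.cos (2 * Real.pi * m * τ)) atTop (𝓝 0) := by
  have hω : 2 * Real.pi * (m : ℝ) ≠ 0 := by
    have : (m : ℝ) ≠ 0 := by exact_mod_cast hm
    have := Real.pi_ne_zero
    positivity
  have h := tendsto_gridAvg_of_continuous (F := fun τ => Real.cos (2 * Real.pi * m * τ)) (by fun_prop)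
    (C := 1) (fun x => Real.abs_cos_le_one _)
  have e : ∫ x in (0 : ℝ)..1, Real.cos (2 * Real.pi * m * x) = 0 := by
    rw [intervalIntegral.integral_comp_mul_left (f := Real.cos) hω, integral_cos]
    have : 2 * Real.pi * (m : ℝ) * 1 = m * (2 * Real.pi) := by ring
    rw [this, show Real.sin (m * (2 * Real.pi)) = 0 by simpa using Real.sin_add_int_mul_two_pi 0 m]
    simp
  rwa [e] at h

theorem tendsto_gridAvg_sin (m : ℤ) :
    Tendsto (gridAvg fun τ => Real.sin (2 * Real.pi * m * τ)) atTop (𝓝 0) := by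
  by_cases hm : m = 0
  · simpa [hm] using tendsto_gridAvg_const 0
  have hω : 2 * Real.pi * (m : ℝ) ≠ 0 := by
    have : (m : ℝ) ≠ 0 := by exact_mod_cast hm
    have := Real.pi_ne_zero
    positivity
  have h := tendsto_gridAvg_of_continuous (F := fun τ => Real.sin (2 * Real.pi * m * τ)) (by fun_prop)
    (C := 1) (fun x => Real.abs_sin_le_one _)
  have e : ∫ x in (0 : ℝ)..1, Real.sin (2 * Real.pi * m * x) = 0 := by
    rw [intervalIntegral.integral_comp_mul_left (f := Real.sin) hω, integral_sin]
    have : 2 * Real.pi * (m : ℝ) * 1 = m * (2 * Real.pi) := by ring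
    rw [this, Real.cos_int_mul_two_pi]
    simp
  rwa [e] at h

theorem gridAvg_add (F G : ℝ → ℝ) (n : ℕ) :
    gridAvg (fun τ => F τ + G τ) n = gridAvg F n + gridAvg G n := by
  simp only [gridAvg, Finset.sum_add_distrib, mul_add]

theorem gridAvg_sub (F G : ℝ → ℝ) (n : ℕ) :
    gridAvg (fun τ => F τ - G τ) n = gridAvg F n - gridAvg G n := by
  simp only [gridAvg, Finset.sum_sub_distrib, mul_sub]

theorem gridAvg_const_mul (c : ℝ) (F : ℝ → ℝ) (n : ℕ) :
    gridAvg (fun τ => c * F τ) n = c * gridAvg F n := by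
  simp only [gridAvg, ← Finset.mul_sum]
  ring

theorem gridAvg_sum {ι : Type*} (s : Finset ι) (F : ι → ℝ → ℝ) (n : ℕ) :
    gridAvg (fun τ => ∑ k ∈ s, F k τ) n = ∑ k ∈ s, gridAvg (F k) n := by
  simp only [gridAvg]
  rw [Finset.sum_comm, Finset.mul_sum]

/-- The cosine of odd frequency `2k + 1` on the circle `ℝ/ℤ`. -/
def oddCos (k : ℕ) (τ : ℝ) : ℝ := Real.cos (2 * Real.pi * (2 * k + 1) * τ)

/-- The sine of odd frequency `2k + 1` on the circle `ℝ/ℤ`. -/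
def oddSin (k : ℕ) (τ : ℝ) : ℝ := Real.sin (2 * Real.pi * (2 * k + 1) * τ)

theorem continuous_oddSin (k : ℕ) : Continuous (oddSin k) := by unfold oddSin; fun_prop

theorem abs_oddCos_le_one (k : ℕ) (τ : ℝ) : |oddCos k τ| ≤ 1 := Real.abs_cos_le_one _

theorem abs_oddSin_le_one (k : ℕ) (τ : ℝ) : |oddSin k τ| ≤ 1 := Real.abs_sin_le_one _

theorem tendsto_gridAvg_oddCos (k : ℕ) : Tendsto (gridAvg (oddCos k)) atTop (𝓝 0) := by
  have := tendsto_gridAvg_cos (m := 2 * k + 1) (by omega)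
  push_cast at this
  exact this

theorem tendsto_gridAvg_oddSin (k : ℕ) : Tendsto (gridAvg (oddSin k)) atTop (𝓝 0) := by
  have := tendsto_gridAvg_sin (2 * k + 1)
  push_cast at this
  exact this

theorem tendsto_gridAvg_cos_sub (k l : ℕ) :
    Tendsto (gridAvg fun τ => Real.cos (2 * Real.pi * ((k - l : ℤ) : ℝ) * τ)) atTop
      (𝓝 (if k = l then 1 else 0)) := by
  split_ifs with h
  · subst h
    simpa using tendsto_gridAvg_const 1
  · exact tendsto_gridAvg_cos (by omega)

/-- The product-to-sum formula reduces to single cosines. The sum frequency 2k + 2l + 2 is never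
zero and the difference frequency 2k - 2l vanishes only for k = l. The next two lemmas follow the
same pattern. -/
theorem tendsto_gridAvg_oddCos_mul_oddCos (k l : ℕ) :
    Tendsto (gridAvg fun τ => oddCos k τ * oddCos l τ) atTop (𝓝 (if k = l then 1 / 2 else 0)) := by
  have e : (fun τ => oddCos k τ * oddCos l τ) = fun τ =>
      1 / 2 * (Real.cos (2 * Real.pi * (((2 * k : ℕ) - (2 * l : ℕ) : ℤ) : ℝ) * τ)
        + Real.cos (2 * Real.pi * ((2 * k + 2 * l + 2 : ℤ) : ℝ) * τ)) := by
    ext τ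
    have := Real.two_mul_cos_mul_cos (2 * Real.pi * (2 * k + 1) * τ) (2 * Real.pi * (2 * l + 1) * τ)
    rw [← sub_mul, ← mul_sub, ← add_mul, ← mul_add] at this
    simp only [oddCos]
    push_cast
    ring_nf at this ⊢
    linarith
  rw [e]
  have h1 := tendsto_gridAvg_cos_sub (2 * k) (2 * l)
  have h2 := tendsto_gridAvg_cos (m := 2 * k + 2 * l + 2) (by omega)
  have h3 := (h1.add h2).const_mul (1 / 2)
  have e2 : (1 / 2 : ℝ) * ((if 2 * k = 2 * l then 1 else 0) + 0) = if k = l then 1 / 2 else 0 := by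
    by_cases h : k = l <;> simp [h]
  rw [e2] at h3
  refine h3.congr fun n => ?_
  rw [gridAvg_const_mul, gridAvg_add]

theorem tendsto_gridAvg_oddSin_mul_oddSin (k l : ℕ) :
    Tendsto (gridAvg fun τ => oddSin k τ * oddSin l τ) atTop (𝓝 (if k = l then 1 / 2 else 0)) := by
  have e : (fun τ => oddSin k τ * oddSin l τ) = fun τ =>
      1 / 2 * (Real.cos (2 * Real.pi * (((2 * k : ℕ) - (2 * l : ℕ) : ℤ) : ℝ) * τ)
        - Real.cos (2 * Real.pi * ((2 * k + 2 * l + 2 : ℤ) : ℝ) * τ)) := by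
    ext τ
    have := Real.two_mul_sin_mul_sin (2 * Real.pi * (2 * k + 1) * τ) (2 * Real.pi * (2 * l + 1) * τ)
    rw [← sub_mul, ← mul_sub, ← add_mul, ← mul_add] at this
    simp only [oddSin]
    push_cast
    ring_nf at this ⊢
    linarith
  rw [e]
  have h1 := tendsto_gridAvg_cos_sub (2 * k) (2 * l)
  have h2 := tendsto_gridAvg_cos (m := 2 * k + 2 * l + 2) (by omega)
  have h3 := (h1.sub h2).const_mul (1 / 2)
  have e2 : (1 / 2 : ℝ) * ((if 2 * k = 2 * l then 1 else 0) - 0) = if k = l then 1 / 2 else 0 := by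
    by_cases h : k = l <;> simp [h]
  rw [e2] at h3
  refine h3.congr fun n => ?_
  rw [gridAvg_const_mul, gridAvg_sub]

theorem tendsto_gridAvg_oddSin_mul_oddCos (k l : ℕ) :
    Tendsto (gridAvg fun τ => oddSin k τ * oddCos l τ) atTop (𝓝 0) := by
  have e : (fun τ => oddSin k τ * oddCos l τ) = fun τ =>
      1 / 2 * (Real.sin (2 * Real.pi * ((2 * k - 2 * l : ℤ) : ℝ) * τ)
        + Real.sin (2 * Real.pi * ((2 * k + 2 * l + 2 : ℤ) : ℝ) * τ)) := by
    ext τ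
    have := Real.two_mul_sin_mul_cos (2 * Real.pi * (2 * k + 1) * τ) (2 * Real.pi * (2 * l + 1) * τ)
    rw [← sub_mul, ← mul_sub, ← add_mul, ← mul_add] at this
    simp only [oddSin, oddCos]
    push_cast
    ring_nf at this ⊢
    linarith
  rw [e]
  have h3 := ((tendsto_gridAvg_sin (2 * k - 2 * l)).add
    (tendsto_gridAvg_sin (2 * k + 2 * l + 2))).const_mul (1 / 2)
  simp only [add_zero, mul_zero] at h3
  refine h3.congr fun n => ?_
  rw [gridAvg_const_mul, gridAvg_add]

/-- The Fourier coefficients of the square wave. -/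
def waveCoeff (k : ℕ) : ℝ := 2 / (Real.pi * (2 * k + 1))

/-- The centred square wave `½` on `[0, ½)`, `-½` on `[½, 1)`. -/
def squareWave (τ : ℝ) : ℝ := if τ < 1 / 2 then 1 / 2 else -1 / 2

/-- A partial sum of the Fourier series of the square wave. -/
def wavePartial (M : ℕ) (τ : ℝ) : ℝ := ∑ k ∈ Finset.range M, waveCoeff k * oddSin k τ

/-- The factor 1/2 is the mean square of the sine: `waveCoeff` is the coefficient in the Fourier
series, not the inner product. -/
theorem integral_squareWave_mul_oddSin (k : ℕ) :
    ∫ τ in (0 : ℝ)..1, squareWave τ * oddSin k τ = waveCoeff k / 2 := by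
  have hω : 2 * Real.pi * (2 * (k : ℝ) + 1) ≠ 0 := by have := Real.pi_pos; positivity
  have h1 : ∫ τ in (0 : ℝ)..(1 / 2), squareWave τ * oddSin k τ
      = ∫ τ in (0 : ℝ)..(1 / 2), 1 / 2 * oddSin k τ :=
    intervalIntegral.integral_congr_Ioo_of_le (by norm_num) fun τ hτ => by
      simp [squareWave, show τ < 2⁻¹ by simpa using hτ.2]
  have h2 : ∫ τ in (1 / 2 : ℝ)..1, squareWave τ * oddSin k τ
      = ∫ τ in (1 / 2 : ℝ)..1, -1 / 2 * oddSin k τ :=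
    intervalIntegral.integral_congr_Ioo_of_le (by norm_num) fun τ hτ => by
      have : ¬ τ < 1 / 2 := not_lt.2 hτ.1.le
      simp only [squareWave, this, if_false]
  have hi : ∀ a b : ℝ, IntervalIntegrable (fun τ => squareWave τ * oddSin k τ) volume a b := by
    intro a b
    refine (intervalIntegrable_const (c := (1 : ℝ))).mono_fun
      (Measurable.aestronglyMeasurable ?_) (Eventually.of_forall fun x => ?_)
    · exact (Measurable.ite measurableSet_Iio measurable_const measurable_const).mul
        (continuous_oddSin k).measurable
    · have h3 := abs_oddSin_le_one k x
      have h4 : |squareWave x| ≤ 1 := by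
        unfold squareWave; split_ifs <;> norm_num [abs_le]
      simp only [norm_mul, Real.norm_eq_abs, abs_one]
      nlinarith [abs_nonneg (oddSin k x), abs_nonneg (squareWave x)]
  have hs : ∀ a b : ℝ, ∫ τ in a..b, oddSin k τ = (2 * Real.pi * (2 * (k : ℝ) + 1))⁻¹
      * (Real.cos (2 * Real.pi * (2 * k + 1) * a) - Real.cos (2 * Real.pi * (2 * k + 1) * b)) := by
    intro a b
    unfold oddSin
    rw [intervalIntegral.integral_comp_mul_left (f := Real.sin) hω, integral_sin, smul_eq_mul]
  rw [← intervalIntegral.integral_add_adjacent_intervals (hi 0 (1 / 2)) (hi (1 / 2) 1), h1, h2,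
    intervalIntegral.integral_const_mul, intervalIntegral.integral_const_mul, hs, hs]
  have c1 : Real.cos (2 * Real.pi * (2 * k + 1) * (1 / 2)) = -1 := by
    rw [show 2 * Real.pi * (2 * (k : ℝ) + 1) * (1 / 2) = Real.pi + k * (2 * Real.pi) by ring,
      Real.cos_add_nat_mul_two_pi, Real.cos_pi]
  have c2 : Real.cos (2 * Real.pi * (2 * k + 1) * 1) = 1 := by
    rw [show 2 * Real.pi * (2 * (k : ℝ) + 1) * 1 = ((2 * k + 1 : ℕ) : ℝ) * (2 * Real.pi) by push_cast; ring,
      Real.cos_nat_mul_two_pi]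
  rw [c1, c2, mul_zero, Real.cos_zero, waveCoeff]
  have := Real.pi_pos
  field_simp
  norm_num

theorem tendsto_gridAvg_squareWave_mul_oddSin (k : ℕ) :
    Tendsto (gridAvg fun τ => squareWave τ * oddSin k τ) atTop (𝓝 (waveCoeff k / 2)) := by
  rw [← integral_squareWave_mul_oddSin]
  refine tendsto_riemann_sum (C := 1) ?_ ?_ ?_
  · exact (Measurable.ite measurableSet_Iio measurable_const measurable_const).mul
      (continuous_oddSin k).measurable
  · intro x
    have h3 := abs_oddSin_le_one k x
    have h4 : |squareWave x| ≤ 1 := by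
      unfold squareWave; split_ifs <;> norm_num [abs_le]
    rw [abs_mul]
    nlinarith [abs_nonneg (oddSin k x), abs_nonneg (squareWave x)]
  · filter_upwards [Measure.ae_ne volume (1 / 2 : ℝ)] with x hx
    refine ContinuousAt.mul ?_ (continuous_oddSin k).continuousAt
    rcases lt_or_gt_of_ne hx with h | h
    · refine (continuousAt_const (y := (1 / 2 : ℝ))).congr ?_
      filter_upwards [Iio_mem_nhds h] with y hy
      simp only [squareWave, if_pos (Set.mem_Iio.1 hy)]
    · refine (continuousAt_const (y := (-1 / 2 : ℝ))).congr ?_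
      filter_upwards [Ioi_mem_nhds h] with y hy
      simp only [squareWave, if_neg (not_lt.2 (Set.mem_Ioi.1 hy).le)]

/-- Bessel's identity on the grid: the square wave has constant square 1/4, the cross terms
contribute -Σ c_k² and the square of the partial sum contributes ½ Σ c_k². -/
theorem tendsto_gridAvg_wave_error (M : ℕ) :
    Tendsto (gridAvg fun τ => (squareWave τ - wavePartial M τ) ^ 2) atTop
      (𝓝 (1 / 4 - 1 / 2 * ∑ k ∈ Finset.range M, waveCoeff k ^ 2)) := by
  have e : (fun τ => (squareWave τ - wavePartial M τ) ^ 2) = fun τ =>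
      (1 / 4 - 2 * ∑ k ∈ Finset.range M, waveCoeff k * (squareWave τ * oddSin k τ))
      + ∑ k ∈ Finset.range M, ∑ l ∈ Finset.range M,
        (waveCoeff k * waveCoeff l) * (oddSin k τ * oddSin l τ) := by
    ext τ
    have h1 : squareWave τ ^ 2 = 1 / 4 := by unfold squareWave; split_ifs <;> norm_num
    have h2 : wavePartial M τ ^ 2 = ∑ k ∈ Finset.range M, ∑ l ∈ Finset.range M,
        (waveCoeff k * waveCoeff l) * (oddSin k τ * oddSin l τ) := by
      rw [sq, wavePartial, Finset.sum_mul_sum]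
      refine Finset.sum_congr rfl fun k _ => Finset.sum_congr rfl fun l _ => by ring
    have h3 : squareWave τ * wavePartial M τ
        = ∑ k ∈ Finset.range M, waveCoeff k * (squareWave τ * oddSin k τ) := by
      rw [wavePartial, Finset.mul_sum]
      refine Finset.sum_congr rfl fun k _ => by ring
    rw [← h2, ← h3, ← h1]
    ring
  have h : Tendsto (fun n => (gridAvg (fun _ => 1 / 4) n
      - 2 * ∑ k ∈ Finset.range M, waveCoeff k * gridAvg (fun τ => squareWave τ * oddSin k τ) n)
      + ∑ k ∈ Finset.range M, ∑ l ∈ Finset.range M,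
        (waveCoeff k * waveCoeff l) * gridAvg (fun τ => oddSin k τ * oddSin l τ) n) atTop
      (𝓝 ((1 / 4 - 2 * ∑ k ∈ Finset.range M, waveCoeff k * (waveCoeff k / 2))
      + ∑ k ∈ Finset.range M, ∑ l ∈ Finset.range M,
        (waveCoeff k * waveCoeff l) * (if k = l then 1 / 2 else 0))) :=
    ((tendsto_gridAvg_const _).sub ((tendsto_finsetSum _ fun k _ =>
      (tendsto_gridAvg_squareWave_mul_oddSin k).const_mul _).const_mul 2)).add
      (tendsto_finsetSum _ fun k _ => tendsto_finsetSum _ fun l _ =>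
        (tendsto_gridAvg_oddSin_mul_oddSin k l).const_mul _)
  have e2 : (1 / 4 - 2 * ∑ k ∈ Finset.range M, waveCoeff k * (waveCoeff k / 2))
      + ∑ k ∈ Finset.range M, ∑ l ∈ Finset.range M,
        (waveCoeff k * waveCoeff l) * (if k = l then 1 / 2 else 0)
      = 1 / 4 - 1 / 2 * ∑ k ∈ Finset.range M, waveCoeff k ^ 2 := by
    have : ∀ k ∈ Finset.range M, ∑ l ∈ Finset.range M,
        (waveCoeff k * waveCoeff l) * (if k = l then 1 / 2 else 0) = 1 / 2 * waveCoeff k ^ 2 := by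
      intro k hk
      rw [Finset.sum_eq_single k]
      · simp; ring
      · intro l _ hl; simp [hl.symm]
      · exact fun h => absurd hk h
    rw [Finset.sum_congr rfl this, ← Finset.mul_sum,
      Finset.sum_congr rfl (fun k _ => (by ring : waveCoeff k * (waveCoeff k / 2)
        = 1 / 2 * waveCoeff k ^ 2)), ← Finset.mul_sum]
    ring
  rw [e2] at h
  refine h.congr fun n => ?_
  rw [e, gridAvg_add, gridAvg_sub, gridAvg_const_mul, gridAvg_sum, gridAvg_sum]
  simp only [gridAvg_sum, gridAvg_const_mul]

theorem prod_range_two_mul {R : Type*} [CommMonoid R] (a : ℕ → R) (N : ℕ) :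
    ∏ j ∈ Finset.range (2 * N), a j
      = (∏ k ∈ Finset.range N, a (2 * k)) * ∏ k ∈ Finset.range N, a (2 * k + 1) := by
  induction N with
  | zero => simp
  | succ N ih =>
    rw [show 2 * (N + 1) = 2 * N + 1 + 1 by ring, Finset.prod_range_succ, Finset.prod_range_succ, ih,
      Finset.prod_range_succ, Finset.prod_range_succ]
    simp only [mul_assoc, mul_left_comm, mul_comm]

theorem sum_range_two_mul {R : Type*} [AddCommMonoid R] (a : ℕ → R) (N : ℕ) :
    ∑ j ∈ Finset.range (2 * N), a j
      = (∑ k ∈ Finset.range N, a (2 * k)) + ∑ k ∈ Finset.range N, a (2 * k + 1) := by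
  induction N with
  | zero => simp
  | succ N ih =>
    rw [show 2 * (N + 1) = 2 * N + 1 + 1 by ring, Finset.sum_range_succ, Finset.sum_range_succ, ih,
      Finset.sum_range_succ, Finset.sum_range_succ]
    simp only [add_assoc, add_left_comm, add_comm]

/-- Parseval's identity for the square wave. It amounts to Σ 1/(2k + 1)² = π²/8, which is ζ(2) with
the even terms removed. Convergence in mean square suffices; pointwise convergence of the series
plays no part. -/
theorem tendsto_wave_error :
    Tendsto (fun M : ℕ => 1 / 4 - 1 / 2 * ∑ k ∈ Finset.range M, waveCoeff k ^ 2) atTop (𝓝 0) := by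
  let Z : ℕ → ℝ := fun N => ∑ j ∈ Finset.range N, 1 / ((j : ℝ) + 1) ^ 2
  have hZ : Tendsto Z atTop (𝓝 (Real.pi ^ 2 / 6)) := by
    have h1 := (hasSum_nat_add_iff' (f := fun n : ℕ => (1 : ℝ) / (n : ℝ) ^ 2) 1).2 hasSum_zeta_two
    have h2 := h1.tendsto_sum_nat
    simpa [Z] using h2
  -- The denominators are shifted by one, so even j yield the odd squares and odd j yield a quarter
  -- of `Z N`.
  have hO : ∀ N, ∑ k ∈ Finset.range N, waveCoeff k ^ 2
      = 4 / Real.pi ^ 2 * (Z (2 * N) - 1 / 4 * Z N) := by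
    intro N
    have h1 : Z (2 * N) = _ := sum_range_two_mul (fun j : ℕ => 1 / ((j : ℝ) + 1) ^ 2) N
    have h2 : ∑ k ∈ Finset.range N, 1 / (((2 * k + 1 : ℕ) : ℝ) + 1) ^ 2 = 1 / 4 * Z N := by
      simp only [Z, Finset.mul_sum]
      refine Finset.sum_congr rfl fun k _ => ?_
      push_cast
      have : (k : ℝ) + 1 ≠ 0 := by positivity
      field_simp
      ring
    rw [h1, h2, add_sub_cancel_right, Finset.mul_sum]
    refine Finset.sum_congr rfl fun k _ => ?_
    push_cast
    unfold waveCoeff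
    have := Real.pi_pos
    field_simp
    norm_num
  have h3 := ((hZ.comp (tendsto_id.const_mul_atTop' (two_pos (α := ℕ)))).sub
    (hZ.const_mul (1 / 4))).const_mul (4 / Real.pi ^ 2)
  have h4 := (h3.const_mul (1 / 2)).const_sub (1 / 4)
  have e : (1 / 4 - 1 / 2 * (4 / Real.pi ^ 2 * (Real.pi ^ 2 / 6 - 1 / 4 * (Real.pi ^ 2 / 6))) : ℝ) = 0 := by
    have := Real.pi_pos
    field_simp
    norm_num
  rw [e] at h4
  refine h4.congr fun M => ?_
  rw [hO]
  rfl

/-- Euler's product for the sine at the imaginary argument ix. -/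
theorem tendsto_sinh_prod (x : ℝ) (hx : x ≠ 0) :
    Tendsto (fun N : ℕ => ∏ j ∈ Finset.range N, (1 + x ^ 2 / ((j : ℝ) + 1) ^ 2)) atTop
      (𝓝 (Real.sinh (Real.pi * x) / (Real.pi * x))) := by
  have h := Complex.tendsto_euler_sin_prod (x * Complex.I)
  have h1 : Complex.sin (Real.pi * (x * Complex.I)) = Real.sinh (Real.pi * x) * Complex.I := by
    rw [← mul_assoc, Complex.sin_mul_I]
    push_cast; rfl
  have hpx : (Real.pi : ℂ) * x * Complex.I ≠ 0 := by
    simp [Real.pi_ne_zero, hx, Complex.I_ne_zero]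
  rw [h1] at h
  have h2 := h.const_mul ((Real.pi : ℂ) * x * Complex.I)⁻¹
  have h3 : (((Real.pi : ℂ) * x * Complex.I)⁻¹ * ((Real.sinh (Real.pi * x) : ℝ) * Complex.I))
      = ((Real.sinh (Real.pi * x) / (Real.pi * x) : ℝ) : ℂ) := by
    push_cast
    have hp : (Real.pi : ℂ) ≠ 0 := by exact_mod_cast Real.pi_ne_zero
    have hx' : (x : ℂ) ≠ 0 := by exact_mod_cast hx
    field_simp [Complex.I_ne_zero]
  rw [h3] at h2
  have h4 := (Complex.continuous_re.tendsto _).comp h2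
  rw [Complex.ofReal_re] at h4
  refine h4.congr fun N => ?_
  simp only [Function.comp]
  rw [← mul_assoc (Real.pi : ℂ), inv_mul_cancel_left₀ hpx]
  have : ∏ j ∈ Finset.range N, ((1 : ℂ) - (x * Complex.I) ^ 2 / ((j : ℂ) + 1) ^ 2)
      = ((∏ j ∈ Finset.range N, (1 + x ^ 2 / ((j : ℝ) + 1) ^ 2) : ℝ) : ℂ) := by
    push_cast
    refine Finset.prod_congr rfl fun j _ => ?_
    rw [mul_pow, Complex.I_sq]
    ring
  rw [this, Complex.ofReal_re]

/-- This is cosh t = sinh(2t) / (2 sinh t) on the level of products. With x = t/π, the factors of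
the product for sinh at 2x with even denominators form the product at x, and those with odd
denominators are the factors 1 + (t c_k)². The case t = 0 is separate because x is divided by. -/
theorem tendsto_prod_inv_cosh (t : ℝ) :
    Tendsto (fun M : ℕ => ∏ k ∈ Finset.range M, (1 + (t * waveCoeff k) ^ 2)⁻¹) atTop
      (𝓝 (Real.cosh t)⁻¹) := by
  by_cases ht : t = 0
  · simp [ht]
  have hpi := Real.pi_pos
  let x : ℝ := t / Real.pi
  have hx : x ≠ 0 := div_ne_zero ht hpi.ne'
  let p : ℝ → ℕ → ℝ := fun x N => ∏ j ∈ Finset.range N, (1 + x ^ 2 / ((j : ℝ) + 1) ^ 2)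
  have hp : ∀ x N, 0 < p x N := fun x N => Finset.prod_pos fun j _ => by positivity
  have hO : ∀ M, ∏ k ∈ Finset.range M, (1 + (t * waveCoeff k) ^ 2)⁻¹
      = p x M / p (2 * x) (2 * M) := by
    intro M
    have h1 : p (2 * x) (2 * M) = _ :=
      prod_range_two_mul (fun j : ℕ => 1 + (2 * x) ^ 2 / ((j : ℝ) + 1) ^ 2) M
    have h2 : ∏ k ∈ Finset.range M, (1 + (2 * x) ^ 2 / (((2 * k + 1 : ℕ) : ℝ) + 1) ^ 2) = p x M := by
      refine Finset.prod_congr rfl fun k _ => ?_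
      push_cast
      have : (k : ℝ) + 1 ≠ 0 := by positivity
      field_simp
      ring
    rw [h1, h2, div_mul_cancel_right₀ (hp x M).ne', Finset.prod_inv_distrib]
    congr 1
    refine Finset.prod_congr rfl fun k _ => ?_
    push_cast
    simp only [waveCoeff, x]
    field_simp
  have h1 := tendsto_sinh_prod x hx
  have h2 := (tendsto_sinh_prod (2 * x) (by simpa using hx)).comp
    (tendsto_id.const_mul_atTop' (two_pos (α := ℕ)))
  have e1 : Real.pi * x = t := by simp only [x]; field_simp
  have e2 : Real.pi * (2 * x) = 2 * t := by simp only [x]; field_simp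
  rw [e1] at h1
  rw [e2, Real.sinh_two_mul] at h2
  have hs : Real.sinh t ≠ 0 := by simpa using ht
  have hc := Real.cosh_pos t
  have h3 := h1.div h2 (by positivity)
  have e3 : Real.sinh t / t / (2 * Real.sinh t * Real.cosh t / (2 * t)) = (Real.cosh t)⁻¹ := by
    field_simp
  rw [e3] at h3
  exact h3.congr fun M => (hO M).symm

end Analysis

/-! ### Quadratic exponential moments of the normal law -/

section GaussianQuadratic

/-- The characteristic function of `½ (Z² - 1)` for a standard normal `Z`. -/
def chiSqCharFun (a : ℝ) : ℂ :=
  ∫ z, Complex.exp ((a * (1 / 2 * (z ^ 2 - 1)) : ℝ) * Complex.I) ∂(gaussianReal 0 1)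

/-- The Gaussian integral with complex parameter is a complex square root. Squaring removes the
choice of a branch, and only even powers are needed to evaluate the antisymmetric contribution. -/
theorem chiSqCharFun_sq (a : ℝ) :
    chiSqCharFun a ^ 2 = Complex.exp (-(a * Complex.I)) * (1 - a * Complex.I)⁻¹ := by
  have hpi : (2 * Real.pi : ℂ) ≠ 0 := by simp [Real.pi_ne_zero]
  have h1 : (1 - a * Complex.I : ℂ) ≠ 0 := fun h => by
    have := congrArg Complex.re h
    simp at this
  -- Coefficient of -z² after joining the density exponent -z²/2 with i a z²/2.
  let b : ℂ := (1 - a * Complex.I) / 2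
  have hb : 0 < b.re := by simp [b]
  have e : chiSqCharFun a
      = Complex.exp (-(a * Complex.I) / 2) * (((√(2 * Real.pi))⁻¹ : ℝ) * (Real.pi / b) ^ (1 / 2 : ℂ)) := by
    rw [chiSqCharFun, integral_gaussianReal_eq_integral_smul one_ne_zero,
      ← integral_gaussian_complex hb, ← integral_const_mul, ← integral_const_mul]
    congr 1
    ext z
    rw [gaussianPDFReal, Complex.real_smul]
    push_cast
    have h2 : Complex.exp (-((z : ℂ) - 0) ^ 2 / (2 * 1))
        * Complex.exp (a * (1 / 2 * ((z : ℂ) ^ 2 - 1)) * Complex.I)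
        = Complex.exp (-(a * Complex.I) / 2) * Complex.exp (-b * (z : ℂ) ^ 2) := by
      rw [← Complex.exp_add, ← Complex.exp_add]
      congr 1
      simp only [b]
      ring
    rw [mul_assoc, h2, mul_one]
    ring
  rw [e, mul_pow, mul_pow, ← Complex.exp_nat_mul, ← Complex.cpow_nat_mul]
  have h2 : (((√(2 * Real.pi))⁻¹ : ℝ) : ℂ) ^ 2 = (2 * Real.pi : ℂ)⁻¹ := by
    rw [Complex.ofReal_inv, inv_pow, ← Complex.ofReal_pow, Real.sq_sqrt (by positivity)]
    push_cast; rfl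
  rw [h2]
  have h3 : ((2 : ℕ) : ℂ) * (1 / 2) = 1 := by norm_num
  rw [h3, Complex.cpow_one]
  congr 1
  · congr 1; push_cast; ring
  · simp only [b]
    field_simp

/-- One frequency of one antisymmetric pair carries the coefficients a, a, -a, -a. The exponential
factors cancel and (1 - ia)(1 + ia) = 1 + a² remains. -/
theorem chiSqCharFun_block (a : ℝ) :
    chiSqCharFun a ^ 2 * chiSqCharFun (-a) ^ 2 = (((1 + a ^ 2)⁻¹ : ℝ) : ℂ) := by
  rw [chiSqCharFun_sq, chiSqCharFun_sq]
  have h : Complex.exp (-(a * Complex.I)) * (1 - a * Complex.I)⁻¹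
      * (Complex.exp (-(((-a : ℝ) : ℂ) * Complex.I)) * (1 - ((-a : ℝ) : ℂ) * Complex.I)⁻¹)
      = (Complex.exp (-(a * Complex.I)) * Complex.exp (-(((-a : ℝ) : ℂ) * Complex.I)))
        * ((1 - a * Complex.I) * (1 - ((-a : ℝ) : ℂ) * Complex.I))⁻¹ := by
    rw [mul_inv]; ring
  rw [h, ← Complex.exp_add]
  have h2 : -(a * Complex.I) + -(((-a : ℝ) : ℂ) * Complex.I) = 0 := by push_cast; ring
  rw [h2, Complex.exp_zero, one_mul]
  push_cast
  congr 1
  ring_nf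
  rw [Complex.I_sq]
  ring

end GaussianQuadratic

/-! ### Compact symmetric operators and Hermitian kernels -/

section Spectral

variable {𝕜 H : Type*} [RCLike 𝕜] [NormedAddCommGroup H] [InnerProductSpace 𝕜 H]
  [CompleteSpace H]

/-- A compact symmetric operator vanishes on vectors orthogonal to all eigenvectors with nonzero
eigenvalue. -/
theorem apply_eq_zero_of_orthogonal_eigenspaces {T : H →L[𝕜] H} (hc : IsCompactOperator T)
    (hs : (T : H →ₗ[𝕜] H).IsSymmetric) {φ : H}
    (hφ : ∀ c : ℝ, c ≠ 0 → ∀ ψ ∈ Module.End.eigenspace (T : H →ₗ[𝕜] H) (c : 𝕜),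
      inner 𝕜 ψ φ = 0) : T φ = 0 := by
  -- T φ is orthogonal to the null space by symmetry of T and to the other eigenspaces by the
  -- assumption on φ, while the eigenspaces together have trivial orthogonal complement.
  have hmem : T φ ∈ (⨆ μ, Module.End.eigenspace (T : H →ₗ[𝕜] H) μ)ᗮ := by
    rw [← Submodule.iInf_orthogonal, Submodule.mem_iInf]
    intro μ ψ hψ
    have h1 : inner 𝕜 ψ (T φ) = starRingEnd 𝕜 μ * inner 𝕜 ψ φ := by
      rw [← ContinuousLinearMap.coe_coe, ← hs ψ φ, Module.End.mem_eigenspace_iff.1 hψ,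
        inner_smul_left]
    rw [h1]
    by_cases h0 : ψ = 0
    · simp [h0]
    have hev : Module.End.HasEigenvalue (T : H →ₗ[𝕜] H) μ :=
      Module.End.hasEigenvalue_of_hasEigenvector ⟨hψ, h0⟩
    have hreal := hs.conj_eigenvalue_eq_self hev
    by_cases hμ : μ = 0
    · simp [hμ]
    · obtain ⟨c, rfl⟩ := RCLike.conj_eq_iff_real.1 hreal
      rw [hφ c (by rintro rfl; simp at hμ) ψ hψ, mul_zero]
  rw [ContinuousLinearMap.orthogonalComplement_iSup_eigenspaces_eq_bot hc hs] at hmem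
  simpa using hmem

/-- Orthonormal eigenvectors of a compact symmetric operator spanning the eigenspaces whose
eigenvalues lie in a given set of nonzero reals. -/
theorem exists_orthonormal_eigenvectors {T : H →L[𝕜] H} (hc : IsCompactOperator T)
    (hs : (T : H →ₗ[𝕜] H).IsSymmetric) {S : Set ℝ} (h0 : (0 : ℝ) ∉ S) :
    ∃ (ι : Type) (l : ι → ℝ) (e : ι → H), Orthonormal 𝕜 e ∧ (∀ i, l i ∈ S) ∧
      (∀ i, T (e i) = (l i : 𝕜) • e i) ∧
      (∀ c ∈ S, {i | l i = c}.encard =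
        Cardinal.toENat (Module.rank 𝕜 (Module.End.eigenspace (T : H →ₗ[𝕜] H) (c : 𝕜)))) ∧
      ∀ φ : H, (∀ i, inner 𝕜 (e i) φ = 0) →
        ∀ c ∈ S, ∀ ψ ∈ Module.End.eigenspace (T : H →ₗ[𝕜] H) (c : 𝕜), inner 𝕜 ψ φ = 0 := by
  -- Compactness makes eigenspaces finite-dimensional only for nonzero eigenvalues; this is where 0
  -- ∉ S enters.
  have hfd : ∀ c : {c : ℝ // c ∈ S},
      FiniteDimensional 𝕜 (Module.End.eigenspace (T : H →ₗ[𝕜] H) ((c : ℝ) : 𝕜)) := fun c =>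
    ContinuousLinearMap.finite_dimensional_eigenspace hc _ (by
      have : (c : ℝ) ≠ 0 := fun h => h0 (h ▸ c.2)
      exact_mod_cast this)
  let b := fun c : {c : ℝ // c ∈ S} =>
    stdOrthonormalBasis 𝕜 (Module.End.eigenspace (T : H →ₗ[𝕜] H) ((c : ℝ) : 𝕜))
  have hfam := hs.orthogonalFamily_eigenspaces.comp
    (f := fun c : {c : ℝ // c ∈ S} => ((c : ℝ) : 𝕜)) (fun c d h => by
      exact Subtype.ext (RCLike.ofReal_injective h))
  refine ⟨Σ c : {c : ℝ // c ∈ S},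
    Fin (Module.finrank 𝕜 (Module.End.eigenspace (T : H →ₗ[𝕜] H) ((c : ℝ) : 𝕜))),
    fun i => i.1, fun i => (b i.1 i.2 : H),
    hfam.orthonormal_sigma_orthonormal fun c => (b c).orthonormal, fun i => i.1.2, fun i =>
      Module.End.mem_eigenspace_iff.1 (b i.1 i.2).2, fun c hcS => ?_, fun φ hφ c hcS ψ hψ => ?_⟩
  · have hrange : {i : Σ c : {c : ℝ // c ∈ S},
        Fin (Module.finrank 𝕜 (Module.End.eigenspace (T : H →ₗ[𝕜] H) ((c : ℝ) : 𝕜)))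
          | (i.1 : ℝ) = c} = Set.range (Sigma.mk (⟨c, hcS⟩ : {c : ℝ // c ∈ S})) := by
      ext ⟨⟨d, hd⟩, k⟩
      simp only [Set.mem_ofPred_eq, Set.mem_range]
      constructor
      · rintro rfl; exact ⟨k, rfl⟩
      · rintro ⟨k', hk'⟩
        exact (congrArg (fun i => (i.1 : ℝ)) hk').symm
    have hfin := hfd ⟨c, hcS⟩
    rw [hrange, ← Set.image_univ, (sigma_mk_injective).encard_image, Set.encard_univ,
      ← Module.finrank_eq_rank]
    simp
  · have hsum := (b ⟨c, hcS⟩).sum_repr ⟨ψ, hψ⟩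
    have hψ' : ψ = ∑ k, (b ⟨c, hcS⟩).repr ⟨ψ, hψ⟩ k • (b ⟨c, hcS⟩ k : H) := by
      have := congrArg (Submodule.subtype _) hsum
      simpa using this.symm
    rw [hψ', sum_inner]
    refine Finset.sum_eq_zero fun k _ => ?_
    rw [inner_smul_left, hφ ⟨⟨c, hcS⟩, k⟩, mul_zero]

end Spectral

/-! ### Square-integrable kernels as Hilbert–Schmidt operators, and their eigenexpansions -/

section KernelOp

variable {𝕜 𝓧 : Type*} [RCLike 𝕜] [MeasurableSpace 𝓧] {ν : Measure 𝓧} [IsProbabilityMeasure ν]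

theorem integralOp_congr {g h : 𝓧 → 𝓧 → 𝕜} {hg : MemLp (Function.uncurry g) 2 (ν.prod ν)}
    {hh : MemLp (Function.uncurry h) 2 (ν.prod ν)}
    (hgh : Function.uncurry g =ᵐ[ν.prod ν] Function.uncurry h) :
    integralOp g hg = integralOp h hh := by
  ext φ
  filter_upwards [integralOp_apply_ae g hg φ, integralOp_apply_ae h hh φ,
    Measure.ae_ae_of_ae_prod hgh] with x h1 h2 h3
  rw [h1, h2]
  refine integral_congr_ae ?_
  filter_upwards [h3] with y hy
  rw [show g x y = h x y from hy]

/-- The integral operator of an element of `L²(ν × ν)`. -/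
def kernelOp (K : Lp 𝕜 2 (ν.prod ν)) : Lp 𝕜 2 ν →L[𝕜] Lp 𝕜 2 ν :=
  integralOp (fun x y => K (x, y)) (Lp.memLp K)

theorem kernelOp_apply_ae (K : Lp 𝕜 2 (ν.prod ν)) (φ : Lp 𝕜 2 ν) :
    kernelOp K φ =ᵐ[ν] fun x => ∫ y, K (x, y) * φ y ∂ν :=
  integralOp_apply_ae (fun x y => K (x, y)) (Lp.memLp K) φ

theorem kernelOp_toLp {g : 𝓧 → 𝓧 → 𝕜} (hg : MemLp (Function.uncurry g) 2 (ν.prod ν)) :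
    kernelOp hg.toLp = integralOp g hg :=
  integralOp_congr hg.coeFn_toLp

theorem memLp_mul_conj {φ ψ : 𝓧 → 𝕜} (hφ : MemLp φ 2 ν) (hψ : MemLp ψ 2 ν) :
    MemLp (fun p : 𝓧 × 𝓧 => φ p.1 * starRingEnd 𝕜 (ψ p.2)) 2 (ν.prod ν) := by
  have hm : AEStronglyMeasurable (fun p : 𝓧 × 𝓧 => φ p.1 * starRingEnd 𝕜 (ψ p.2)) (ν.prod ν) :=
    hφ.1.comp_fst.mul (RCLike.continuous_conj.comp_aestronglyMeasurable hψ.1.comp_snd)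
  rw [memLp_two_iff_integrable_sq_norm hm]
  have := (hφ.integrable_norm_pow two_ne_zero).mul_prod (hψ.integrable_norm_pow two_ne_zero)
  refine this.congr (Eventually.of_forall fun p => ?_)
  simp [mul_pow]

/-- The rank-one kernel `φ(x) * conj ψ(y)`. -/
def tensor (φ ψ : Lp 𝕜 2 ν) : Lp 𝕜 2 (ν.prod ν) :=
  (memLp_mul_conj (Lp.memLp φ) (Lp.memLp ψ)).toLp _

theorem tensor_ae (φ ψ : Lp 𝕜 2 ν) :
    tensor φ ψ =ᵐ[ν.prod ν] fun p => φ p.1 * starRingEnd 𝕜 (ψ p.2) :=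
  MemLp.coeFn_toLp _

/-- Fubini. The pairings of a kernel with rank-one kernels are the matrix elements of its operator,
so identities can be moved between kernels and operators. -/
theorem inner_tensor_left (φ ψ : Lp 𝕜 2 ν) (K : Lp 𝕜 2 (ν.prod ν)) :
    inner 𝕜 (tensor φ ψ) K = inner 𝕜 φ (kernelOp K ψ) := by
  rw [L2.inner_def, L2.inner_def]
  have h1 : ∫ p, inner 𝕜 (tensor φ ψ p) (K p) ∂(ν.prod ν)
      = ∫ p, K p * (starRingEnd 𝕜 (φ p.1) * ψ p.2) ∂(ν.prod ν) := by
    refine integral_congr_ae ?_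
    filter_upwards [tensor_ae φ ψ] with p hp
    rw [hp, RCLike.inner_apply, map_mul, RCLike.conj_conj]
  have hint : Integrable (fun p : 𝓧 × 𝓧 => K p * (starRingEnd 𝕜 (φ p.1) * ψ p.2))
      (ν.prod ν) := by
    have := memLp_mul_conj (Lp.memLp φ) (Lp.memLp ψ)
    refine ((Lp.memLp K).integrable_mul this.star).congr (Eventually.of_forall fun p => ?_)
    simp
  rw [h1, integral_prod _ hint]
  refine integral_congr_ae ?_
  filter_upwards [kernelOp_apply_ae K ψ] with x hx
  rw [hx, RCLike.inner_apply, ← integral_mul_const]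
  refine integral_congr_ae (Eventually.of_forall fun y => ?_)
  simp only
  ring

theorem kernelOp_tensor (φ ψ χ : Lp 𝕜 2 ν) : kernelOp (tensor φ ψ) χ = inner 𝕜 ψ χ • φ := by
  ext
  filter_upwards [kernelOp_apply_ae (tensor φ ψ) χ,
    Lp.coeFn_smul (inner 𝕜 ψ χ) φ, Measure.ae_ae_of_ae_prod (tensor_ae φ ψ)] with x h1 h2 h3
  rw [h1, h2, Pi.smul_apply, L2.inner_def, smul_eq_mul, ← integral_mul_const]
  refine integral_congr_ae ?_
  filter_upwards [h3] with y hy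
  rw [hy, RCLike.inner_apply]
  ring

theorem inner_tensor_tensor (a b c d : Lp 𝕜 2 ν) :
    inner 𝕜 (tensor a b) (tensor c d) = inner 𝕜 d b * inner 𝕜 a c := by
  rw [inner_tensor_left, kernelOp_tensor, inner_smul_right]

/-- An element of `L²(ν × ν)` orthogonal to all rank-one kernels vanishes. -/
theorem eq_zero_of_forall_inner_tensor {K : Lp 𝕜 2 (ν.prod ν)}
    (h : ∀ φ ψ : Lp 𝕜 2 ν, inner 𝕜 (tensor φ ψ) K = 0) : K = 0 := by
  have hint : Integrable K (ν.prod ν) := (Lp.memLp K).integrable (by norm_num)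
  rw [Lp.eq_zero_iff_ae_eq_zero]
  refine Lp.ae_eq_zero_of_forall_setIntegral_eq_zero K (by norm_num) (by norm_num)
    (fun s _ _ => hint.integrableOn) (fun s hs _ => ?_)
  -- A π-λ argument: the indicator of a rectangle is a rank-one kernel, and the sets over which K
  -- integrates to zero are stable under complements and disjoint unions.
  refine MeasurableSpace.induction_on_inter (C := fun s _ => ∫ p in s, K p ∂(ν.prod ν) = 0)
    generateFrom_prod.symm isPiSystem_prod (by simp) ?_ ?_ ?_ s hs
  · rintro _ ⟨A, hA, B, hB, rfl⟩
    have hA' := memLp_indicator_const (μ := ν) 2 (s := A) hA (1 : 𝕜) (Or.inr (by simp))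
    have hB' := memLp_indicator_const (μ := ν) 2 (s := B) hB (1 : 𝕜) (Or.inr (by simp))
    have key := h hA'.toLp hB'.toLp
    rw [L2.inner_def] at key
    rw [← integral_indicator (hA.prod hB), ← key]
    refine integral_congr_ae ?_
    have e1 : ∀ᵐ p ∂(ν.prod ν), hA'.toLp _ p.1 = A.indicator (fun _ => (1 : 𝕜)) p.1 :=
      Measure.quasiMeasurePreserving_fst.ae hA'.coeFn_toLp
    have e2 : ∀ᵐ p ∂(ν.prod ν), hB'.toLp _ p.2 = B.indicator (fun _ => (1 : 𝕜)) p.2 :=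
      Measure.quasiMeasurePreserving_snd.ae hB'.coeFn_toLp
    filter_upwards [tensor_ae hA'.toLp hB'.toLp, e1, e2] with p h1 h2 h3
    rw [h1, h2, h3, RCLike.inner_apply]
    by_cases p1 : p.1 ∈ A <;> by_cases p2 : p.2 ∈ B <;> simp [p1, p2, Set.indicator]
  · intro t ht h0
    have htot : ∫ p, K p ∂(ν.prod ν) = 0 := by
      have h1' := memLp_const (μ := ν) (p := 2) (1 : 𝕜)
      have key := h h1'.toLp h1'.toLp
      rw [L2.inner_def] at key
      rw [← key]
      refine integral_congr_ae ?_
      have e1 : ∀ᵐ p ∂(ν.prod ν), h1'.toLp _ p.1 = (1 : 𝕜) :=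
        Measure.quasiMeasurePreserving_fst.ae h1'.coeFn_toLp
      have e2 : ∀ᵐ p ∂(ν.prod ν), h1'.toLp _ p.2 = (1 : 𝕜) :=
        Measure.quasiMeasurePreserving_snd.ae h1'.coeFn_toLp
      filter_upwards [tensor_ae h1'.toLp h1'.toLp, e1, e2] with p h1 h2 h3
      rw [h1, h2, h3, RCLike.inner_apply]
      simp
    have := integral_add_compl ht hint
    rwa [h0, htot, zero_add] at this
  · intro s hd hm h0
    rw [integral_iUnion hm hd hint.integrableOn]
    simp [h0]

theorem norm_kernelOp_le (K : Lp 𝕜 2 (ν.prod ν)) : ‖kernelOp K‖ ≤ ‖K‖ := by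
  rw [Lp.norm_def]
  unfold kernelOp integralOp
  exact LinearMap.mkContinuous_norm_le _ ENNReal.toReal_nonneg _

theorem kernelOp_add (K L : Lp 𝕜 2 (ν.prod ν)) : kernelOp (K + L) = kernelOp K + kernelOp L := by
  refine ContinuousLinearMap.ext fun ψ => ext_inner_left 𝕜 fun φ => ?_
  rw [← inner_tensor_left, inner_add_right, add_apply, inner_add_right,
    inner_tensor_left, inner_tensor_left]

theorem kernelOp_smul (c : 𝕜) (K : Lp 𝕜 2 (ν.prod ν)) : kernelOp (c • K) = c • kernelOp K := by
  refine ContinuousLinearMap.ext fun ψ => ext_inner_left 𝕜 fun φ => ?_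
  rw [← inner_tensor_left, inner_smul_right, smul_apply, inner_smul_right,
    inner_tensor_left]

/-- `kernelOp` as a continuous linear map. -/
def kernelOpL : Lp 𝕜 2 (ν.prod ν) →L[𝕜] (Lp 𝕜 2 ν →L[𝕜] Lp 𝕜 2 ν) :=
  LinearMap.mkContinuous
    { toFun := kernelOp, map_add' := kernelOp_add, map_smul' := kernelOp_smul } 1
    (fun K => by simpa using norm_kernelOp_le K)

theorem kernelOpL_apply (K : Lp 𝕜 2 (ν.prod ν)) : kernelOpL K = kernelOp K := rfl

/-- Equal operators have equal matrix elements, so the difference of the kernels is orthogonal to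
all rank-one kernels. -/
theorem kernelOp_injective {K L : Lp 𝕜 2 (ν.prod ν)} (h : kernelOp K = kernelOp L) : K = L := by
  rw [← sub_eq_zero]
  refine eq_zero_of_forall_inner_tensor fun φ ψ => ?_
  rw [inner_sub_right, inner_tensor_left, inner_tensor_left, h, sub_self]

/-- Rank-one kernels give compact operators and span a dense subspace of L²(ν × ν). The operator
depends continuously on the kernel, and compact operators are closed in norm. -/
theorem isCompactOperator_kernelOp (K : Lp 𝕜 2 (ν.prod ν)) : IsCompactOperator (kernelOp K) := by
  let V : Submodule 𝕜 (Lp 𝕜 2 (ν.prod ν)) :=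
    Submodule.span 𝕜 (Set.range fun q : Lp 𝕜 2 ν × Lp 𝕜 2 ν => tensor q.1 q.2)
  have hdense : V.topologicalClosure = ⊤ := by
    rw [Submodule.topologicalClosure_eq_top_iff, Submodule.eq_bot_iff]
    intro L hL
    exact eq_zero_of_forall_inner_tensor fun φ ψ =>
      hL _ (Submodule.subset_span ⟨(φ, ψ), rfl⟩)
  have hclosed : IsClosed {L : Lp 𝕜 2 (ν.prod ν) | IsCompactOperator (kernelOp L)} :=
    (isClosed_setOfPred_isCompactOperator (𝕜₁ := 𝕜) (𝕜₂ := 𝕜) (σ₁₂ := RingHom.id 𝕜)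
      (M₁ := Lp 𝕜 2 ν) (M₂ := Lp 𝕜 2 ν)).preimage
      (kernelOpL (𝕜 := 𝕜) (ν := ν)).continuous
  have hV : (V : Set (Lp 𝕜 2 (ν.prod ν))) ⊆ {L | IsCompactOperator (kernelOp L)} := by
    intro L hL
    refine Submodule.span_induction (p := fun L _ => IsCompactOperator (kernelOp L))
      ?_ ?_ ?_ ?_ hL
    · rintro _ ⟨⟨φ, ψ⟩, rfl⟩
      have heq : kernelOp (tensor φ ψ)
          = (ContinuousLinearMap.toSpanSingleton 𝕜 φ).comp (innerSL 𝕜 ψ) := by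
        ext1 χ
        rw [kernelOp_tensor]; simp
      change IsCompactOperator (kernelOp (tensor φ ψ))
      rw [heq]
      exact (isCompactOperator_of_locallyCompactSpace_dom (innerSL 𝕜 ψ)).clm_comp
        (ContinuousLinearMap.toSpanSingleton 𝕜 φ)
    · rw [← kernelOpL_apply, map_zero]
      exact isCompactOperator_zero
    · intro a b _ _ ha hb
      rw [kernelOp_add]
      exact ha.add hb
    · intro c a _ ha
      rw [kernelOp_smul]
      exact ha.smul c
  have := hclosed.closure_subset_iff.2 hV
  have hmem : K ∈ closure (V : Set (Lp 𝕜 2 (ν.prod ν))) := by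
    rw [← Submodule.topologicalClosure_coe, hdense]; trivial
  exact this hmem

theorem memLp_conj_flip {g : 𝓧 → 𝓧 → 𝕜} (hg : MemLp (Function.uncurry g) 2 (ν.prod ν)) :
    MemLp (Function.uncurry fun x y => starRingEnd 𝕜 (g y x)) 2 (ν.prod ν) :=
  (hg.comp_measurePreserving Measure.measurePreserving_swap).star

theorem adjoint_integralOp {g : 𝓧 → 𝓧 → 𝕜} (hg : MemLp (Function.uncurry g) 2 (ν.prod ν)) :
    ContinuousLinearMap.adjoint (integralOp g hg)
      = integralOp (fun x y => starRingEnd 𝕜 (g y x)) (memLp_conj_flip hg) := by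
  symm
  rw [ContinuousLinearMap.eq_adjoint_iff]
  intro φ ψ
  rw [← inner_conj_symm, ← kernelOp_toLp, ← kernelOp_toLp, ← inner_tensor_left,
    ← inner_tensor_left, L2.inner_def, L2.inner_def, ← integral_conj,
    ← integral_prod_swap]
  refine integral_congr_ae ?_
  have hq := (Measure.measurePreserving_swap (μ := ν) (ν := ν)).quasiMeasurePreserving
  filter_upwards [hq.ae (tensor_ae ψ φ), tensor_ae φ ψ, hq.ae (memLp_conj_flip hg).coeFn_toLp,
    hg.coeFn_toLp] with p h1 h2 h3 h4
  rw [h1, h2, h3, h4]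
  simp only [RCLike.inner_apply, Function.uncurry, Prod.fst_swap, Prod.snd_swap, map_mul,
    RCLike.conj_conj]
  ring

theorem orthonormal_tensor_self {ι : Type*} {e : ι → Lp 𝕜 2 ν} (he : Orthonormal 𝕜 e) :
    Orthonormal 𝕜 (fun i => tensor (e i) (e i)) := by
  classical
  have hee : ∀ i j, inner 𝕜 (e i) (e j) = if i = j then (1 : 𝕜) else 0 :=
    orthonormal_iff_ite.1 he
  rw [orthonormal_iff_ite]
  intro i j
  rw [inner_tensor_tensor, hee, hee]
  by_cases hij : i = j
  · simp [hij]
  · simp [hij]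

theorem inner_tensor_self_eigenvector {ι : Type*} {K : Lp 𝕜 2 (ν.prod ν)} {e : ι → Lp 𝕜 2 ν}
    {l : ι → ℝ} (he : Orthonormal 𝕜 e) (hl : ∀ i, kernelOp K (e i) = (l i : 𝕜) • e i) (i : ι) :
    inner 𝕜 (tensor (e i) (e i)) K = (l i : 𝕜) := by
  rw [inner_tensor_left, hl, inner_smul_right, inner_self_eq_norm_sq_to_K, he.1]
  simp

/-- Bessel's inequality: the numbers l_i are the coefficients of K along the orthonormal kernels
e_i(x) conj e_i(y). Countability of the nonzero spectrum is drawn from this as well. -/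
theorem summable_sq_of_eigenvectors {ι : Type*} {K : Lp 𝕜 2 (ν.prod ν)} {e : ι → Lp 𝕜 2 ν}
    {l : ι → ℝ} (he : Orthonormal 𝕜 e) (hl : ∀ i, kernelOp K (e i) = (l i : 𝕜) • e i) :
    Summable fun i => l i ^ 2 := by
  have := (orthonormal_tensor_self he).inner_products_summable K
  simpa [inner_tensor_self_eigenvector he hl] using this

/-- Expansion of an `L²` kernel along orthonormal eigenvectors of its operator. -/
theorem hasSum_tensor_of_eigenvectors {ι : Type*} {K : Lp 𝕜 2 (ν.prod ν)} {e : ι → Lp 𝕜 2 ν}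
    {l : ι → ℝ} (he : Orthonormal 𝕜 e) (hl : ∀ i, kernelOp K (e i) = (l i : 𝕜) • e i)
    (hcompl : ∀ φ, (∀ i, inner 𝕜 (e i) φ = 0) → kernelOp K φ = 0) :
    HasSum (fun i => (l i : 𝕜) • tensor (e i) (e i)) K ∧ HasSum (fun i => l i ^ 2) (‖K‖ ^ 2) := by
  classical
  have hee : ∀ i j, inner 𝕜 (e i) (e j) = if i = j then (1 : 𝕜) else 0 :=
    orthonormal_iff_ite.1 he
  have hte := orthonormal_tensor_self he
  have hcoef := inner_tensor_self_eigenvector he hl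
  have hsq := summable_sq_of_eigenvectors he hl
  have hsum : Summable fun i => (l i : 𝕜) • tensor (e i) (e i) := by
    have := (hte.orthogonalFamily.summable_iff_norm_sq_summable (fun i => (l i : 𝕜))).2
      (by simpa using hsq)
    simpa using this
  have hop : ∀ χ, HasSum (fun i => ((l i : 𝕜) * inner 𝕜 (e i) χ) • e i)
      (kernelOp (∑' i, (l i : 𝕜) • tensor (e i) (e i)) χ) := by
    intro χ
    have h1 := (hsum.hasSum.mapL (kernelOpL (𝕜 := 𝕜) (ν := ν))).mapL
      (ContinuousLinearMap.apply 𝕜 (Lp 𝕜 2 ν) χ)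
    have h2 : ∀ i, ContinuousLinearMap.apply 𝕜 (Lp 𝕜 2 ν) χ
        (kernelOpL ((l i : 𝕜) • tensor (e i) (e i))) = ((l i : 𝕜) * inner 𝕜 (e i) χ) • e i := by
      intro i
      rw [ContinuousLinearMap.apply_apply, kernelOpL_apply, kernelOp_smul, smul_apply,
        kernelOp_tensor, smul_smul]
    simp only [h2] at h1
    exact h1
  -- Both operators agree on every e_j, hence on the closed span, and both vanish on its orthogonal
  -- complement. Injectivity of the passage from kernels to operators then identifies the sum of the
  -- series with K.
  have hKop : kernelOp (∑' i, (l i : 𝕜) • tensor (e i) (e i)) = kernelOp K := by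
    set V := (Submodule.span 𝕜 (Set.range e)).topologicalClosure
    set D := kernelOp (∑' i, (l i : 𝕜) • tensor (e i) (e i)) - kernelOp K with hD
    have hV : V ≤ LinearMap.ker (D : Lp 𝕜 2 ν →ₗ[𝕜] Lp 𝕜 2 ν) := by
      refine Submodule.topologicalClosure_minimal _ ?_ D.isClosed_ker
      rw [Submodule.span_le]
      rintro _ ⟨j, rfl⟩
      have h1 := (hop (e j)).unique (hasSum_single j fun i hij => by rw [hee, if_neg hij]; simp)
      change D (e j) = 0
      rw [hD, sub_apply, h1, hl, hee]
      simp
    have : D = 0 := by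
      ext1 ψ
      obtain ⟨y, hy, z, hz, rfl⟩ := V.exists_add_mem_mem_orthogonal ψ
      have hz' : ∀ i, inner 𝕜 (e i) z = 0 := fun i =>
        hz _ (Submodule.le_topologicalClosure _ (Submodule.subset_span ⟨i, rfl⟩))
      have hy' : D y = 0 := hV hy
      have h1 : HasSum (fun _ : ι => (0 : Lp 𝕜 2 ν))
          (kernelOp (∑' i, (l i : 𝕜) • tensor (e i) (e i)) z) := by simpa [hz'] using hop z
      replace h1 := h1.unique hasSum_zero
      rw [map_add, hy', hD, sub_apply, h1, hcompl z hz']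
      simp
    exact sub_eq_zero.1 this
  have hK := hsum.hasSum
  rw [kernelOp_injective hKop] at hK
  refine ⟨hK, ?_⟩
  -- Pairing the expansion with K itself gives Parseval's identity.
  have h2 := (hK.mapL (innerSL 𝕜 K)).mapL (RCLike.reCLM (K := 𝕜))
  rw [innerSL_apply_apply, inner_self_eq_norm_sq_to_K] at h2
  have h3 : ∀ i, RCLike.reCLM (innerSL 𝕜 K ((l i : 𝕜) • tensor (e i) (e i))) = l i ^ 2 := by
    intro i
    rw [innerSL_apply_apply, inner_smul_right, ← inner_conj_symm, hcoef]
    simp [sq]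
  have h4 : RCLike.reCLM ((‖K‖ : 𝕜) ^ 2) = ‖K‖ ^ 2 := by
    rw [← RCLike.ofReal_pow, RCLike.reCLM_apply, RCLike.ofReal_re]
  simpa only [h3, h4] using h2

end KernelOp

/-! ### Expansions of symmetric and antisymmetric kernels -/

section Expansion

variable {𝓧 : Type*} [MeasurableSpace 𝓧] {ν : Measure 𝓧} [IsProbabilityMeasure ν]

theorem exists_equiv_seqIndex (ι : Type*) [Countable ι] :
    ∃ R : ℕ∞, Nonempty (SeqIndex R ≃ ι) := by
  rcases finite_or_infinite ι with h | h
  · obtain ⟨n, ⟨e⟩⟩ := Finite.exists_equiv_fin ι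
    refine ⟨n, ⟨(Equiv.subtypeEquivRight fun r => ?_).trans (Fin.equivSubtype.symm.trans e.symm)⟩⟩
    exact Nat.cast_lt
  · obtain ⟨hd⟩ := nonempty_denumerable ι
    exact ⟨⊤, ⟨(Equiv.subtypeUnivEquiv fun r => WithTop.coe_lt_top r).trans
      (Denumerable.eqv ι).symm⟩⟩

theorem tendsto_finset_sum_of_hasSum {ι E : Type*} [AddCommMonoid E] [TopologicalSpace E]
    {f : ι → E} {a : E} (h : HasSum f a) :
    Tendsto (fun F : Finset ι => ∑ i ∈ F, f i) atTop (𝓝 a) := by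
  rwa [HasSum, SummationFilter.unconditional_filter] at h

theorem norm_sq_Lp_two {α 𝕜 : Type*} [RCLike 𝕜] [MeasurableSpace α] {m : Measure α}
    (F : Lp 𝕜 2 m) : ‖F‖ ^ 2 = ∫ a, ‖F a‖ ^ 2 ∂m := by
  have h := L2.inner_def (𝕜 := 𝕜) F F
  simp only [inner_self_eq_norm_sq_to_K] at h
  have h2 : (fun a => (‖F a‖ : 𝕜) ^ 2) = fun a => ((‖F a‖ ^ 2 : ℝ) : 𝕜) := by
    ext a; simp
  rw [h2, integral_ofReal, ← RCLike.ofReal_pow] at h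
  exact_mod_cast h

theorem coeFn_sum_smul_tensor {𝕜 ι : Type*} [RCLike 𝕜] (F : Finset ι) (c : ι → 𝕜)
    (a b : ι → Lp 𝕜 2 ν) :
    ⇑(∑ i ∈ F, c i • tensor (a i) (b i))
      =ᵐ[ν.prod ν] fun p => ∑ i ∈ F, c i * (a i p.1 * starRingEnd 𝕜 (b i p.2)) := by
  classical
  induction F using Finset.induction_on with
  | empty =>
    simp only [Finset.sum_empty]
    exact Lp.coeFn_zero 𝕜 2 (ν.prod ν)
  | insert i F hi ih =>
    rw [Finset.sum_insert hi]
    filter_upwards [ih, Lp.coeFn_add (c i • tensor (a i) (b i))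
      (∑ i ∈ F, c i • tensor (a i) (b i)), Lp.coeFn_smul (c i) (tensor (a i) (b i)),
      tensor_ae (a i) (b i)] with p h1 h2 h3 h4
    rw [h2, Pi.add_apply, h1, h3, Pi.smul_apply, h4, Finset.sum_insert hi, smul_eq_mul]

/-- Orthonormal eigenvectors of a Hermitian `L²` kernel, listed in a sequence. -/
theorem exists_seq_eigenvectors {𝕜 : Type*} [RCLike 𝕜] {K : Lp 𝕜 2 (ν.prod ν)}
    (hs : (kernelOp K : Lp 𝕜 2 ν →ₗ[𝕜] Lp 𝕜 2 ν).IsSymmetric) {S : Set ℝ} (h0 : (0 : ℝ) ∉ S) :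
    ∃ (R : ℕ∞) (l : SeqIndex R → ℝ) (e : SeqIndex R → Lp 𝕜 2 ν), Orthonormal 𝕜 e ∧
      (∀ i, l i ∈ S) ∧ (∀ i, kernelOp K (e i) = (l i : 𝕜) • e i) ∧
      (∀ c ∈ S, {i | l i = c}.encard = Cardinal.toENat (Module.rank 𝕜
        (Module.End.eigenspace (kernelOp K : Lp 𝕜 2 ν →ₗ[𝕜] Lp 𝕜 2 ν) (c : 𝕜)))) ∧
      ∀ φ : Lp 𝕜 2 ν, (∀ i, inner 𝕜 (e i) φ = 0) → ∀ c ∈ S,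
        ∀ ψ ∈ Module.End.eigenspace (kernelOp K : Lp 𝕜 2 ν →ₗ[𝕜] Lp 𝕜 2 ν) (c : 𝕜),
          inner 𝕜 ψ φ = 0 := by
  obtain ⟨ι, l, e, he, hS, hl, hcard, hcompl⟩ :=
    exists_orthonormal_eigenvectors (isCompactOperator_kernelOp K) hs h0
  have hcount : Countable ι := by
    rw [← Set.countable_univ_iff]
    refine (summable_sq_of_eigenvectors he hl).countable_support.mono fun i _ => ?_
    have : l i ≠ 0 := fun h => h0 (h ▸ hS i)
    simpa using this
  obtain ⟨R, ⟨σ⟩⟩ := exists_equiv_seqIndex ι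
  refine ⟨R, l ∘ σ, e ∘ σ, he.comp σ σ.injective, fun i => hS _, fun i => hl _, fun c hc => ?_,
    fun φ hφ => hcompl φ fun i => by simpa using hφ (σ.symm i)⟩
  rw [← hcard c hc, ← σ.injective.encard_image]
  congr 1
  ext i
  simp only [Set.mem_image, Set.mem_ofPred_eq, Function.comp_apply]
  exact ⟨fun ⟨j, hj, hji⟩ => hji ▸ hj, fun h => ⟨σ.symm i, by simpa using h, by simp⟩⟩

/-- A finite or infinite system of centred orthonormal functions in `L²(ν)`. -/
structure IsCentredSystem {ι : Type*} (e : ι → 𝓧 → ℝ) (ν : Measure 𝓧) : Prop where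
  measurable : ∀ i, Measurable (e i)
  memLp : ∀ i, MemLp (e i) 2 ν
  integral_eq_zero : ∀ i, ∫ x, e i x ∂ν = 0
  integral_mul_self : ∀ i, ∫ x, e i x * e i x ∂ν = 1
  integral_mul : ∀ i j, i ≠ j → ∫ x, e i x * e j x ∂ν = 0

/-- The constant 1 lies in the null space of the operator, and for a symmetric operator the null
space is orthogonal to eigenvectors with nonzero eigenvalue. The eigenfunctions are thus centred, as
the central limit theorem requires. -/
theorem integral_eq_zero_of_eigenvector {𝕜 : Type*} [RCLike 𝕜] {K : Lp 𝕜 2 (ν.prod ν)}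
    (hs : (kernelOp K : Lp 𝕜 2 ν →ₗ[𝕜] Lp 𝕜 2 ν).IsSymmetric)
    (hK : ∀ᵐ x ∂ν, ∫ y, K (x, y) ∂ν = 0) {φ : Lp 𝕜 2 ν} {l : 𝕜} (hl0 : l ≠ 0)
    (hl : kernelOp K φ = l • φ) : ∫ x, φ x ∂ν = 0 := by
  have h1 := memLp_const (μ := ν) (p := 2) (1 : 𝕜)
  have hT1 : kernelOp K h1.toLp = 0 := by
    rw [Lp.eq_zero_iff_ae_eq_zero]
    filter_upwards [kernelOp_apply_ae K h1.toLp, hK] with x hx hx0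
    rw [hx, Pi.zero_apply, ← hx0]
    refine integral_congr_ae ?_
    filter_upwards [h1.coeFn_toLp] with y hy
    rw [hy, mul_one]
  have h2 : inner 𝕜 h1.toLp φ = ∫ x, φ x ∂ν := by
    rw [L2.inner_def]
    refine integral_congr_ae ?_
    filter_upwards [h1.coeFn_toLp] with y hy
    rw [hy, RCLike.inner_apply]; simp
  have h3 := hs h1.toLp φ
  simp only [ContinuousLinearMap.coe_coe] at h3
  rw [hT1, inner_zero_left, hl, inner_smul_right, h2] at h3
  exact (mul_eq_zero.1 h3.symm).resolve_left hl0

/-- The spectral expansion of a symmetric canonical kernel. -/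
theorem exists_symm_expansion {g : 𝓧 → 𝓧 → ℝ} (hg : IsCanonical g ν)
    (hsymm : ∀ x y, g y x = g x y) :
    ∃ (R : ℕ∞) (l : SeqIndex R → ℝ) (e : SeqIndex R → 𝓧 → ℝ), IsCentredSystem e ν ∧
      ListsEigenvalues (integralOp g hg.memLp) {c : ℝ | c ≠ 0} l ∧
      HasSum (fun r => l r ^ 2) (∫ p, g p.1 p.2 ^ 2 ∂(ν.prod ν)) ∧
      Tendsto (fun F : Finset (SeqIndex R) => ∫ p, (g p.1 p.2
        - ∑ r ∈ F, l r * (e r p.1 * e r p.2)) ^ 2 ∂(ν.prod ν)) atTop (𝓝 0) := by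
  obtain ⟨K, hK, hop⟩ : ∃ K : Lp ℝ 2 (ν.prod ν), K =ᵐ[ν.prod ν] Function.uncurry g ∧
      kernelOp K = integralOp g hg.memLp := ⟨_, hg.memLp.coeFn_toLp, kernelOp_toLp hg.memLp⟩
  have hs : (kernelOp K : Lp ℝ 2 ν →ₗ[ℝ] Lp ℝ 2 ν).IsSymmetric := by
    rw [← ContinuousLinearMap.isSelfAdjoint_iff_isSymmetric, ContinuousLinearMap.isSelfAdjoint_iff',
      hop, adjoint_integralOp]
    refine integralOp_congr (Eventually.of_forall fun p => ?_)
    simp [Function.uncurry, hsymm]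
  obtain ⟨R, l, e, he, hS, hl, hcard, hcompl⟩ :=
    exists_seq_eigenvectors hs (S := {c : ℝ | c ≠ 0}) (by simp)
  have hK0 : ∀ᵐ x ∂ν, ∫ y, K (x, y) ∂ν = 0 := by
    filter_upwards [Measure.ae_ae_of_ae_prod hK, hg.right] with x h1 h2
    rw [← h2]
    exact integral_congr_ae h1
  have hker : ∀ φ, (∀ i, inner ℝ (e i) φ = 0) → kernelOp K φ = 0 := fun φ hφ =>
    apply_eq_zero_of_orthogonal_eigenspaces (isCompactOperator_kernelOp K) hs
      (fun c hc => hcompl φ hφ c hc)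
  have hexp := hasSum_tensor_of_eigenvectors (𝕜 := ℝ) he hl hker
  have hsum := hexp.1
  have hsq := hexp.2
  have hin : ∀ i j, ∫ x, e i x * e j x ∂ν = inner ℝ (e i) (e j) := by
    intro i j
    rw [L2.inner_def]
    refine integral_congr_ae (Eventually.of_forall fun x => ?_)
    simp [mul_comm]
  refine ⟨R, l, fun r => e r, ⟨fun r => (Lp.stronglyMeasurable (e r)).measurable,
    fun r => Lp.memLp (e r), fun r => integral_eq_zero_of_eigenvector hs hK0 (hS r) (hl r),
    fun r => ?_, fun r s hrs => ?_⟩, ⟨hS, ?_⟩, ?_, ?_⟩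
  · rw [hin, real_inner_self_eq_norm_sq, he.1]; norm_num
  · rw [hin, he.2 hrs]
  · rw [← hop]
    exact hcard
  · convert hsq using 1
    rw [norm_sq_Lp_two]
    refine integral_congr_ae ?_
    filter_upwards [hK] with p hp
    rw [hp]
    simp [Function.uncurry]
  · have h1 : Tendsto (fun F : Finset (SeqIndex R) =>
        ‖K - ∑ i ∈ F, l i • tensor (e i) (e i)‖ ^ 2) atTop (𝓝 0) := by
      have := (tendsto_const_nhds (x := K)).sub (tendsto_finset_sum_of_hasSum hsum)
      simpa using (this.norm.pow 2)
    refine h1.congr fun F => ?_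
    rw [norm_sq_Lp_two]
    refine integral_congr_ae ?_
    filter_upwards [hK, coeFn_sum_smul_tensor F l e e,
      Lp.coeFn_sub K (∑ i ∈ F, l i • tensor (e i) (e i))] with p h1 h2 h3
    rw [h3, Pi.sub_apply, h1, h2]
    simp [Function.uncurry]

theorem star_smul_Lp (c : ℂ) (φ : Lp ℂ 2 ν) : star (c • φ) = starRingEnd ℂ c • star φ := by
  ext
  filter_upwards [Lp.coeFn_star (c • φ), Lp.coeFn_smul c φ,
    Lp.coeFn_smul (starRingEnd ℂ c) (star φ), Lp.coeFn_star φ] with x h1 h2 h3 h4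
  rw [h1, h3, Pi.star_apply, h2, Pi.smul_apply, Pi.smul_apply, h4]
  simp

theorem inner_star_star_Lp (φ ψ : Lp ℂ 2 ν) : inner ℂ (star φ) (star ψ) = inner ℂ ψ φ := by
  rw [L2.inner_def, L2.inner_def]
  refine integral_congr_ae ?_
  filter_upwards [Lp.coeFn_star φ, Lp.coeFn_star ψ] with x h1 h2
  rw [h1, h2]
  simp [mul_comm]

theorem inner_star_left_Lp (φ ψ : Lp ℂ 2 ν) : inner ℂ (star φ) ψ = inner ℂ (star ψ) φ := by
  rw [← inner_star_star_Lp, star_star]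

theorem kernelOp_star {K : Lp ℂ 2 (ν.prod ν)}
    (hK : ∀ᵐ p ∂(ν.prod ν), starRingEnd ℂ (K p) = -K p) (φ : Lp ℂ 2 ν) :
    kernelOp K (star φ) = -star (kernelOp K φ) := by
  ext
  filter_upwards [kernelOp_apply_ae K (star φ), kernelOp_apply_ae K φ,
    Lp.coeFn_neg (star (kernelOp K φ)), Lp.coeFn_star (kernelOp K φ),
    Measure.ae_ae_of_ae_prod hK] with x h1 h2 h3 h4 h5
  rw [h1, h3, Pi.neg_apply, h4, Pi.star_apply, h2, RCLike.star_def, ← integral_conj,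
    ← integral_neg]
  refine integral_congr_ae ?_
  filter_upwards [Lp.coeFn_star φ, h5] with y h6 h7
  rw [h6, map_mul, h7]
  simp

/-- Conjugation reflects the spectrum of a purely imaginary Hermitian kernel about 0, so its
positive half carries all information. -/
theorem kernelOp_star_eigenvector {K : Lp ℂ 2 (ν.prod ν)}
    (hK : ∀ᵐ p ∂(ν.prod ν), starRingEnd ℂ (K p) = -K p) {φ : Lp ℂ 2 ν} {c : ℝ}
    (h : kernelOp K φ = (c : ℂ) • φ) : kernelOp K (star φ) = ((-c : ℝ) : ℂ) • star φ := by
  rw [kernelOp_star hK, h, star_smul_Lp]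
  simp

/-- The positive half of the spectrum of a purely imaginary Hermitian kernel determines its
expansion. -/
theorem hasSum_tensor_of_imaginary {ι : Type*} {K : Lp ℂ 2 (ν.prod ν)}
    (hs : (kernelOp K : Lp ℂ 2 ν →ₗ[ℂ] Lp ℂ 2 ν).IsSymmetric)
    (hK : ∀ᵐ p ∂(ν.prod ν), starRingEnd ℂ (K p) = -K p) {e : ι → Lp ℂ 2 ν} {l : ι → ℝ}
    (he : Orthonormal ℂ e) (hpos : ∀ i, 0 < l i) (hl : ∀ i, kernelOp K (e i) = (l i : ℂ) • e i)
    (hcompl : ∀ φ : Lp ℂ 2 ν, (∀ i, inner ℂ (e i) φ = 0) → ∀ c : ℝ, 0 < c →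
      ∀ ψ ∈ Module.End.eigenspace (kernelOp K : Lp ℂ 2 ν →ₗ[ℂ] Lp ℂ 2 ν) (c : ℂ),
        inner ℂ ψ φ = 0) :
    (∀ i j, inner ℂ (star (e i)) (e j) = 0) ∧
    HasSum (fun i => ((Sum.elim l (fun i => -l i) i : ℝ) : ℂ) •
      tensor (Sum.elim e (fun i => star (e i)) i) (Sum.elim e (fun i => star (e i)) i)) K ∧
    HasSum (fun i => (Sum.elim l (fun i => -l i) i) ^ 2) (‖K‖ ^ 2) := by
  classical
  -- The vectors conj e_i and e_j belong to the eigenvalues -l_i < 0 < l_j, which differ.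
  have hstar : ∀ i j, inner ℂ (star (e i)) (e j) = 0 := by
    intro i j
    have h1 := hs (star (e i)) (e j)
    simp only [ContinuousLinearMap.coe_coe] at h1
    rw [kernelOp_star_eigenvector hK (hl i), hl j, inner_smul_left, inner_smul_right,
      Complex.conj_ofReal] at h1
    have h2 : ((l i + l j : ℝ) : ℂ) * inner ℂ (star (e i)) (e j) = 0 := by
      push_cast at h1 ⊢
      linear_combination -h1
    refine (mul_eq_zero.1 h2).resolve_left ?_
    have := hpos i
    have := hpos j
    exact_mod_cast (by positivity : l i + l j ≠ 0)
  have horth : Orthonormal ℂ (Sum.elim e (fun i => star (e i))) := by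
    rw [orthonormal_iff_ite]
    have hee : ∀ i j, inner ℂ (e i) (e j) = if i = j then (1 : ℂ) else 0 :=
      orthonormal_iff_ite.1 he
    rintro (i | i) (j | j)
    · simp [hee]
    · rw [Sum.elim_inl, Sum.elim_inr, ← inner_conj_symm, hstar]; simp
    · rw [Sum.elim_inl, Sum.elim_inr, hstar]; simp
    · rw [Sum.elim_inr, Sum.elim_inr, inner_star_star_Lp, hee]; simp [eq_comm]
  have heig : ∀ i, kernelOp K (Sum.elim e (fun i => star (e i)) i)
      = ((Sum.elim l (fun i => -l i) i : ℝ) : ℂ) • Sum.elim e (fun i => star (e i)) i := by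
    rintro (i | i)
    · exact hl i
    · exact kernelOp_star_eigenvector hK (hl i)
  have hker : ∀ φ, (∀ i, inner ℂ (Sum.elim e (fun i => star (e i)) i) φ = 0) →
      kernelOp K φ = 0 := by
    intro φ hφ
    refine apply_eq_zero_of_orthogonal_eigenspaces (isCompactOperator_kernelOp K) hs
      (fun c hc ψ hψ => ?_)
    -- A negative eigenvalue becomes positive when both ψ and φ are conjugated.
    rcases lt_or_gt_of_ne hc with hc | hc
    · have h1 := hcompl (star φ) (fun i => by
        have := hφ (Sum.inr i)
        rw [Sum.elim_inr, inner_star_left_Lp] at this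
        rw [← inner_conj_symm, this, map_zero]) (-c) (by linarith) (star ψ)
        (Module.End.mem_eigenspace_iff.2
          (kernelOp_star_eigenvector hK (Module.End.mem_eigenspace_iff.1 hψ)))
      rw [inner_star_star_Lp] at h1
      rw [← inner_conj_symm, h1, map_zero]
    · exact hcompl φ (fun i => hφ (Sum.inl i)) c hc ψ hψ
  have hexp := hasSum_tensor_of_eigenvectors (𝕜 := ℂ) horth heig hker
  exact ⟨hstar, hexp⟩

/-- Real and imaginary parts of an orthonormal family which is orthogonal to its conjugates. -/
theorem isCentredSystem_re_im {ι : Type*} {e : ι → Lp ℂ 2 ν} (he : Orthonormal ℂ e)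
    (hstar : ∀ i j, inner ℂ (star (e i)) (e j) = 0) (h0 : ∀ i, ∫ x, e i x ∂ν = 0) :
    IsCentredSystem (fun (q : ι × Bool) x =>
      √2 * (if q.2 then (e q.1 x).re else (e q.1 x).im)) ν := by
  classical
  have hint : ∀ i, Integrable (e i) ν := fun i => (Lp.memLp (e i)).integrable (by norm_num)
  have hmeas : ∀ i, Measurable (e i) := fun i => (Lp.stronglyMeasurable (e i)).measurable
  have hE : ∀ i j, ∫ x, e i x * e j x ∂ν = 0 := by
    intro i j
    rw [← hstar i j, L2.inner_def]
    refine integral_congr_ae ?_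
    filter_upwards [Lp.coeFn_star (e i)] with x hx
    rw [hx]; simp [mul_comm]
  have hD : ∀ i j, ∫ x, starRingEnd ℂ (e i x) * e j x ∂ν = if i = j then 1 else 0 := by
    intro i j
    rw [← orthonormal_iff_ite.1 he i j, L2.inner_def]
    refine integral_congr_ae (Eventually.of_forall fun x => ?_)
    simp [mul_comm]
  have hEi : ∀ i j, Integrable (fun x => e i x * e j x) ν := fun i j =>
    (Lp.memLp (e i)).integrable_mul (Lp.memLp (e j))
  have hDi : ∀ i j, Integrable (fun x => starRingEnd ℂ (e i x) * e j x) ν := fun i j =>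
    (Lp.memLp (e i)).star.integrable_mul (Lp.memLp (e j))
  -- For complex z and w, conj(z) w + z w = 2 Re(z) w and conj(z) w - z w = -2i Im(z) w. The real
  -- and imaginary parts of these two integrals are the four products of real and imaginary parts,
  -- each with a factor 2; hence the normalization √2.
  have hP : ∀ i j, ∫ x, (starRingEnd ℂ (e i x) * e j x + e i x * e j x) ∂ν
      = if i = j then 1 else 0 := fun i j => by
    rw [integral_add (hDi i j) (hEi i j), hD, hE, add_zero]
  have hM : ∀ i j, ∫ x, (starRingEnd ℂ (e i x) * e j x - e i x * e j x) ∂ν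
      = if i = j then 1 else 0 := fun i j => by
    rw [integral_sub (hDi i j) (hEi i j), hD, hE, sub_zero]
  have hPi := fun i j => (hDi i j).add (hEi i j)
  have hMi := fun i j => (hDi i j).sub (hEi i j)
  have hs2 : √2 * √2 = (2 : ℝ) := Real.mul_self_sqrt (by norm_num)
  have hprod : ∀ p q : ι × Bool, ∫ x, (√2 * (if p.2 then (e p.1 x).re else (e p.1 x).im)) *
      (√2 * (if q.2 then (e q.1 x).re else (e q.1 x).im)) ∂ν = if p = q then 1 else 0 := by
    rintro ⟨i, a⟩ ⟨j, b⟩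
    cases a <;> cases b
    · have h := integral_re (hMi i j)
      simp only [Pi.sub_apply] at h
      rw [hM] at h
      have h' : RCLike.re (if i = j then (1 : ℂ) else 0) = if i = j then (1 : ℝ) else 0 := by
        split_ifs <;> simp
      rw [h'] at h
      simp only [Prod.mk.injEq, and_true]
      rw [← h]
      refine integral_congr_ae (Eventually.of_forall fun x => ?_)
      simp
      linear_combination ((e i x).im * (e j x).im) * hs2
    · have h := integral_im (hPi j i)
      simp only [Pi.add_apply] at h
      rw [hP] at h
      have h' : RCLike.im (if j = i then (1 : ℂ) else 0) = 0 := by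
        split_ifs <;> simp
      rw [h'] at h
      simp only [Prod.mk.injEq, Bool.false_eq_true, and_false, if_false]
      rw [← h]
      refine integral_congr_ae (Eventually.of_forall fun x => ?_)
      simp
      linear_combination ((e j x).re * (e i x).im) * hs2
    · have h := integral_im (hPi i j)
      simp only [Pi.add_apply] at h
      rw [hP] at h
      have h' : RCLike.im (if i = j then (1 : ℂ) else 0) = 0 := by
        split_ifs <;> simp
      rw [h'] at h
      simp only [Prod.mk.injEq, Bool.true_eq_false, and_false, if_false]
      rw [← h]
      refine integral_congr_ae (Eventually.of_forall fun x => ?_)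
      simp
      linear_combination ((e i x).re * (e j x).im) * hs2
    · have h := integral_re (hPi i j)
      simp only [Pi.add_apply] at h
      rw [hP] at h
      have h' : RCLike.re (if i = j then (1 : ℂ) else 0) = if i = j then (1 : ℝ) else 0 := by
        split_ifs <;> simp
      rw [h'] at h
      simp only [Prod.mk.injEq, and_true]
      rw [← h]
      refine integral_congr_ae (Eventually.of_forall fun x => ?_)
      simp
      linear_combination ((e i x).re * (e j x).re) * hs2
  refine ⟨?_, ?_, ?_, fun p => by rw [hprod, if_pos rfl], fun p q hpq => by rw [hprod, if_neg hpq]⟩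
  · rintro ⟨i, a⟩
    cases a
    · exact (Complex.measurable_im.comp (hmeas i)).const_mul _
    · exact (Complex.measurable_re.comp (hmeas i)).const_mul _
  · rintro ⟨i, a⟩
    cases a
    · exact (Lp.memLp (e i)).im.const_mul _
    · exact (Lp.memLp (e i)).re.const_mul _
  · rintro ⟨i, a⟩
    cases a
    · have h := integral_im (hint i)
      rw [h0] at h
      simpa [integral_const_mul] using h
    · have h := integral_re (hint i)
      rw [h0] at h
      simpa [integral_const_mul] using h

/-- The spectral expansion of an antisymmetric canonical kernel. -/
theorem exists_antisymm_expansion {g : 𝓧 → 𝓧 → ℝ} (hg : IsCanonical g ν)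
    (hanti : ∀ x y, g y x = -g x y) :
    ∃ (Q : ℕ∞) (l : SeqIndex Q → ℝ) (w : SeqIndex Q × Bool → 𝓧 → ℝ), IsCentredSystem w ν ∧
      ListsEigenvalues (integralOp (fun x y => ((g x y : ℝ) : ℂ)) hg.memLp.ofReal)
        {c : ℂ | ∃ t : ℝ, 0 < t ∧ c = Complex.I * t} (fun q => Complex.I * l q) ∧
      HasSum (fun q => l q ^ 2) (1 / 2 * ∫ p, g p.1 p.2 ^ 2 ∂(ν.prod ν)) ∧
      Tendsto (fun F : Finset (SeqIndex Q) => ∫ p, (g p.1 p.2 - ∑ q ∈ F,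
        l q * (w (q, true) p.1 * w (q, false) p.2 - w (q, false) p.1 * w (q, true) p.2)) ^ 2
          ∂(ν.prod ν)) atTop (𝓝 0) := by
  have hC : MemLp (Function.uncurry fun x y => ((g x y : ℝ) : ℂ)) 2 (ν.prod ν) := hg.memLp.ofReal
  -- The factor -i makes the real antisymmetric kernel Hermitian, and an eigenvalue t of the new
  -- operator is the eigenvalue it of the original one.
  have hC2 : MemLp (Function.uncurry fun x y => -Complex.I * ((g x y : ℝ) : ℂ)) 2 (ν.prod ν) :=
    hC.const_mul (-Complex.I)
  obtain ⟨K, hK, hop⟩ : ∃ K : Lp ℂ 2 (ν.prod ν),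
      K =ᵐ[ν.prod ν] Function.uncurry (fun x y => -Complex.I * ((g x y : ℝ) : ℂ)) ∧
      kernelOp K = integralOp _ hC2 := ⟨_, hC2.coeFn_toLp, kernelOp_toLp hC2⟩
  have hA : integralOp (fun x y => ((g x y : ℝ) : ℂ)) hg.memLp.ofReal
      = Complex.I • kernelOp K := by
    rw [← kernelOp_smul, kernelOp]
    refine integralOp_congr ?_
    filter_upwards [hK, Lp.coeFn_smul Complex.I K] with p h1 h2
    simp only [Function.uncurry, Prod.mk.eta] at h1 ⊢
    rw [h2, Pi.smul_apply, h1, smul_eq_mul, ← mul_assoc]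
    simp
  have hs : (kernelOp K : Lp ℂ 2 ν →ₗ[ℂ] Lp ℂ 2 ν).IsSymmetric := by
    rw [← ContinuousLinearMap.isSelfAdjoint_iff_isSymmetric, ContinuousLinearMap.isSelfAdjoint_iff',
      hop, adjoint_integralOp]
    refine integralOp_congr (Eventually.of_forall fun p => ?_)
    simp [Function.uncurry, hanti p.1 p.2]
  have hKc : ∀ᵐ p ∂(ν.prod ν), starRingEnd ℂ (K p) = -K p := by
    filter_upwards [hK] with p hp
    rw [hp]; simp [Function.uncurry]
  have hK0 : ∀ᵐ x ∂ν, ∫ y, K (x, y) ∂ν = 0 := by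
    filter_upwards [Measure.ae_ae_of_ae_prod hK, hg.right] with x h1 h2
    rw [integral_congr_ae h1]
    simp only [Function.uncurry]
    rw [integral_const_mul, integral_complex_ofReal, h2]; simp
  obtain ⟨Q, l, e, he, hS, hl, hcard, hcompl⟩ :=
    exists_seq_eigenvectors hs (S := {c : ℝ | 0 < c}) (by simp)
  have hmain := hasSum_tensor_of_imaginary hs hKc he hS hl hcompl
  have hstar := hmain.1
  have hsum := hmain.2.1
  have hsq := hmain.2.2
  have hnorm : ‖K‖ ^ 2 = ∫ p, g p.1 p.2 ^ 2 ∂(ν.prod ν) := by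
    rw [norm_sq_Lp_two]
    refine integral_congr_ae ?_
    filter_upwards [hK] with p hp
    rw [hp]
    simp [Function.uncurry]
  -- Partial sums are taken along index sets containing both members of each conjugate pair; these
  -- sets are cofinal among the finite ones.
  have hdisj : Tendsto (fun F : Finset (SeqIndex Q) => F.disjSum F) atTop atTop := by
    refine tendsto_atTop_finset_of_monotone (fun F G hFG => Finset.disjSum_mono hFG hFG) ?_
    rintro (i | i) <;> exact ⟨{i}, by simp⟩
  have hs2 : √2 * √2 = (2 : ℝ) := Real.mul_self_sqrt (by norm_num)
  refine ⟨Q, l, _, isCentredSystem_re_im he hstar fun i =>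
    integral_eq_zero_of_eigenvector hs hK0 (Complex.ofReal_ne_zero.2 (hS i : 0 < l i).ne') (hl i), ⟨?_, ?_⟩, ?_, ?_⟩
  · exact fun q => ⟨l q, hS q, rfl⟩
  · rintro _ ⟨t, ht, rfl⟩
    have h1 : {r | Complex.I * (l r : ℂ) = Complex.I * t} = {r | l r = t} := by
      ext r; simp
    have h2 : Module.End.eigenspace ((integralOp (fun x y => ((g x y : ℝ) : ℂ)) hg.memLp.ofReal :
        Lp ℂ 2 ν →L[ℂ] Lp ℂ 2 ν) : Lp ℂ 2 ν →ₗ[ℂ] Lp ℂ 2 ν) (Complex.I * t)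
        = Module.End.eigenspace (kernelOp K : Lp ℂ 2 ν →ₗ[ℂ] Lp ℂ 2 ν) (t : ℂ) := by
      rw [hA]
      ext φ
      rw [Module.End.mem_eigenspace_iff, Module.End.mem_eigenspace_iff]
      simp only [ContinuousLinearMap.coe_coe, ContinuousLinearMap.toLinearMap_smul, LinearMap.smul_apply]
      rw [mul_smul]
      exact smul_right_inj Complex.I_ne_zero
    rw [h1, h2]
    exact hcard t ht
  · have hsl := (summable_sq_of_eigenvectors he hl).hasSum
    have h1 : HasSum (fun i => (Sum.elim l (fun i => -l i) i) ^ 2)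
        (∑' q, l q ^ 2 + ∑' q, l q ^ 2) := by
      refine HasSum.sum hsl ?_
      simpa [Function.comp_def] using hsl
    -- The squared norm counts each l_q² twice, once for l_q and once for -l_q, which accounts for
    -- the factor 1/2.
    have h2 := hsq.unique h1
    convert hsl using 1
    rw [← hnorm, h2]; ring
  · have h1 : Tendsto (fun F : Finset (SeqIndex Q) => ‖K - ∑ i ∈ F.disjSum F,
        ((Sum.elim l (fun i => -l i) i : ℝ) : ℂ) • tensor (Sum.elim e (fun i => star (e i)) i)
          (Sum.elim e (fun i => star (e i)) i)‖ ^ 2) atTop (𝓝 0) := by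
      have := (tendsto_const_nhds (x := K)).sub ((tendsto_finset_sum_of_hasSum hsum).comp hdisj)
      simpa using (this.norm.pow 2)
    refine h1.congr fun F => ?_
    rw [norm_sq_Lp_two]
    refine integral_congr_ae ?_
    have hst : ∀ᵐ x ∂ν, ∀ i : SeqIndex Q, star (e i) x = star (e i x) :=
      ae_all_iff.2 fun i => Lp.coeFn_star (e i)
    filter_upwards [hK, coeFn_sum_smul_tensor (F.disjSum F)
        (fun i => ((Sum.elim l (fun i => -l i) i : ℝ) : ℂ)) (Sum.elim e (fun i => star (e i)))
        (Sum.elim e (fun i => star (e i))),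
      Lp.coeFn_sub K (∑ i ∈ F.disjSum F, ((Sum.elim l (fun i => -l i) i : ℝ) : ℂ) •
        tensor (Sum.elim e (fun i => star (e i)) i) (Sum.elim e (fun i => star (e i)) i)),
      Measure.quasiMeasurePreserving_fst.ae hst, Measure.quasiMeasurePreserving_snd.ae hst]
      with p h1 h2 h3 h4 h5
    rw [h3, Pi.sub_apply, h1, h2, Finset.sum_disjSum, ← Finset.sum_add_distrib]
    -- With z and z' the values of e_i at the two arguments, z conj(z') - conj(z) z' = -2i (Re z Im
    -- z' - Im z Re z'); the 2 is absorbed by the two factors √2.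
    have h6 : ∀ i ∈ F, ((Sum.elim l (fun i => -l i) (Sum.inl i) : ℝ) : ℂ) *
          (Sum.elim e (fun i => star (e i)) (Sum.inl i) p.1 *
            starRingEnd ℂ (Sum.elim e (fun i => star (e i)) (Sum.inl i) p.2))
        + ((Sum.elim l (fun i => -l i) (Sum.inr i) : ℝ) : ℂ) *
          (Sum.elim e (fun i => star (e i)) (Sum.inr i) p.1 *
            starRingEnd ℂ (Sum.elim e (fun i => star (e i)) (Sum.inr i) p.2))
        = -Complex.I * ((l i * (√2 * (e i p.1).re * (√2 * (e i p.2).im)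
          - √2 * (e i p.1).im * (√2 * (e i p.2).re)) : ℝ) : ℂ) := by
      intro i _
      simp only [Sum.elim_inl, Sum.elim_inr, h4, h5]
      apply Complex.ext
      · simp
      · simp
        linear_combination (l i * ((e i p.1).re * (e i p.2).im
          - (e i p.1).im * (e i p.2).re)) * hs2
    rw [Finset.sum_congr rfl h6, ← Finset.mul_sum, Function.uncurry, ← mul_sub, norm_mul,
      ← Complex.ofReal_sum, ← Complex.ofReal_sub, Complex.norm_real]
    simp

end Expansion

/-! ### Quadratic forms of asymptotically Gaussian linear statistics -/

section Quadratic

variable {Ω 𝓧 : Type*} [MeasurableSpace Ω] [MeasurableSpace 𝓧] {P : Measure Ω}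
  [IsProbabilityMeasure P] {ν : Measure 𝓧} [IsProbabilityMeasure ν] {X : ℕ → Ω → 𝓧}

theorem tendstoInDistribution_of_tendsto_integral_cexp {E Ω' : Type*} [NormedAddCommGroup E]
    [InnerProductSpace ℝ E] [FiniteDimensional ℝ E] [MeasurableSpace E] [BorelSpace E]
    [MeasurableSpace Ω'] {P' : Measure Ω'} [IsProbabilityMeasure P'] {Y : ℕ → Ω → E}
    {Z : Ω' → E} (hY : ∀ n, AEMeasurable (Y n) P) (hZ : AEMeasurable Z P')
    (h : ∀ ξ : E, Tendsto (fun n => ∫ ω, Complex.exp ((inner ℝ (Y n ω) ξ : ℝ) * Complex.I) ∂P)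
      atTop (𝓝 (∫ ω, Complex.exp ((inner ℝ (Z ω) ξ : ℝ) * Complex.I) ∂P'))) :
    TendstoInDistribution Y atTop Z (fun _ => P) P' where
  forall_aemeasurable := hY
  aemeasurable_limit := hZ
  tendsto := by
    refine ProbabilityMeasure.tendsto_of_tendsto_charFun fun ξ => ?_
    simp only [ProbabilityMeasure.coe_mk, charFun_apply]
    rw [integral_map hZ (by fun_prop)]
    refine (h ξ).congr fun n => ?_
    rw [integral_map (hY n) (by fun_prop)]

theorem _root_.MeasureTheory.TendstoInDistribution.tendsto_integral_cexp {Ω' : Type*}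
    [MeasurableSpace Ω'] {P' : Measure Ω'} [IsProbabilityMeasure P'] {Y : ℕ → Ω → ℝ} {Z : Ω' → ℝ}
    (h : TendstoInDistribution Y atTop Z (fun _ => P) P') (t : ℝ) :
    Tendsto (fun n => ∫ ω, Complex.exp ((t * Y n ω : ℝ) * Complex.I) ∂P) atTop
      (𝓝 (∫ ω, Complex.exp ((t * Z ω : ℝ) * Complex.I) ∂P')) := by
  have h1 := ProbabilityMeasure.tendsto_iff_tendsto_charFun.1 h.tendsto t
  simp only [ProbabilityMeasure.coe_mk, charFun_apply_real] at h1
  rw [integral_map h.aemeasurable_limit (by fun_prop)] at h1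
  simp only [Complex.ofReal_mul]
  refine h1.congr fun n => ?_
  rw [integral_map (h.forall_aemeasurable n) (by fun_prop)]

theorem integral_cexp_pi_gaussian {A : Type*} [Fintype A] (κ : A → ℝ) (t : ℝ) :
    ∫ z : A → ℝ, Complex.exp ((t * (∑ α, 1 / 2 * κ α * z α ^ 2 - 1 / 2 * ∑ α, κ α) : ℝ)
      * Complex.I) ∂(Measure.pi fun _ => gaussianReal 0 1) = ∏ α, chiSqCharFun (t * κ α) := by
  simp only [chiSqCharFun]
  rw [← integral_fintype_prod_eq_prod (𝕜 := ℂ)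
    (f := fun α z => Complex.exp ((t * κ α * (1 / 2 * (z ^ 2 - 1)) : ℝ) * Complex.I))]
  refine integral_congr_ae (Eventually.of_forall fun z => ?_)
  simp only
  rw [← Complex.exp_sum, ← Finset.sum_mul, ← Complex.ofReal_sum]
  congr 3
  rw [Finset.mul_sum, ← Finset.sum_sub_distrib, Finset.mul_sum]
  exact Finset.sum_congr rfl fun α _ => by ring

/-- The Cramér–Wold device: a combination with coefficients ξ_α is again a centred triangular array,
with envelope (Σ |ξ_α|) G, and the Gram condition makes its limiting variance Σ ξ_α². -/
theorem tendstoInDistribution_linear_statistics (hX : ∀ i, HasLaw (X i) ν P)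
    (hind : iIndepFun X P) {A : Type*} [Fintype A] [DecidableEq A] {ψ : A → ℕ → ℕ → 𝓧 → ℝ}
    (hψ : ∀ α n i, Measurable (ψ α n i)) {G : 𝓧 → ℝ} (hG : MemLp G 2 ν)
    (hb : ∀ α n i x, |ψ α n i x| ≤ G x) (h0 : ∀ α n i, ∫ x, ψ α n i x ∂ν = 0)
    (hgram : ∀ α β, Tendsto (fun n : ℕ => (n : ℝ)⁻¹ * ∑ i ∈ Finset.range n,
      ∫ x, ψ α n i x * ψ β n i x ∂ν) atTop (𝓝 (if α = β then 1 else 0))) :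
    TendstoInDistribution (fun (n : ℕ) ω => (WithLp.toLp 2 fun α =>
        (√(n : ℝ))⁻¹ * ∑ i ∈ Finset.range n, ψ α n i (X i ω) : EuclideanSpace ℝ A)) atTop
      (fun z : A → ℝ => (WithLp.toLp 2 z : EuclideanSpace ℝ A)) (fun _ => P)
      (Measure.pi fun _ => gaussianReal 0 1) := by
  have hmem : ∀ α n i, MemLp (ψ α n i) 2 ν := fun α n i =>
    hG.mono (hψ α n i).aestronglyMeasurable (Eventually.of_forall fun x => by
      rw [Real.norm_eq_abs]; exact (hb α n i x).trans (le_abs_self _))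
  have hmeas : ∀ (n : ℕ) α, AEMeasurable
      (fun ω => (√(n : ℝ))⁻¹ * ∑ i ∈ Finset.range n, ψ α n i (X i ω)) P := fun n α =>
    (Finset.aemeasurable_fun_sum _ fun i _ =>
      (hψ α n i).comp_aemeasurable (hX i).aemeasurable).const_mul _
  refine tendstoInDistribution_of_tendsto_integral_cexp (fun n => ?_) (by fun_prop) fun ξ => ?_
  · exact (WithLp.measurable_toLp 2 (A → ℝ)).comp_aemeasurable (aemeasurable_pi_lambda _ (hmeas n))
  have hlim : ∫ z : A → ℝ, Complex.exp ((inner ℝ (WithLp.toLp 2 z : EuclideanSpace ℝ A) ξ : ℝ)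
      * Complex.I) ∂(Measure.pi fun _ => gaussianReal 0 1)
        = Complex.exp (-((∑ α, ξ α ^ 2 : ℝ) : ℂ) / 2) := by
    have h1 : charFun ((Measure.pi fun _ : A => gaussianReal 0 1).map
        (WithLp.toLp 2 : (A → ℝ) → EuclideanSpace ℝ A)) ξ
        = Complex.exp (-((∑ α, ξ α ^ 2 : ℝ) : ℂ) / 2) := by
      rw [charFun_pi]
      simp_rw [charFun_gaussianReal]
      rw [← Complex.exp_sum]
      congr 1
      push_cast
      rw [neg_div, Finset.sum_div, ← Finset.sum_neg_distrib]
      exact Finset.sum_congr rfl fun α _ => by simp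
    rw [← h1, charFun_apply, integral_map (by fun_prop) (by fun_prop)]
  rw [hlim]
  have key := tendsto_integral_cexp_triangular hX hind
    (ψ := fun n i x => ∑ α, ξ α * ψ α n i x) (G := fun x => (∑ α, |ξ α|) * G x) (P := P)
    (fun n i => Finset.measurable_fun_sum _ fun α _ => (hψ α n i).const_mul _)
    (hG.const_mul _) ?_ ?_ (s := ∑ α, ξ α ^ 2) ?_
  · refine key.congr fun n => ?_
    refine integral_congr_ae (Eventually.of_forall fun ω => ?_)
    simp only
    congr 3
    rw [PiLp.inner_apply, Finset.sum_comm, Finset.mul_sum]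
    refine Finset.sum_congr rfl fun α _ => ?_
    simp only [RCLike.inner_apply, conj_trivial]
    rw [← Finset.mul_sum]
    ring
  · intro n i x
    refine (Finset.abs_sum_le_sum_abs _ _).trans ?_
    rw [Finset.sum_mul]
    refine Finset.sum_le_sum fun α _ => ?_
    rw [abs_mul]
    exact mul_le_mul_of_nonneg_left (hb α n i x) (abs_nonneg _)
  · intro n i
    rw [integral_finsetSum _ fun α _ => ((hmem α n i).integrable (by norm_num)).const_mul _]
    simp [integral_const_mul, h0]
  · have e : ∀ n : ℕ, (n : ℝ)⁻¹ * ∑ i ∈ Finset.range n, ∫ x, (∑ α, ξ α * ψ α n i x) ^ 2 ∂ν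
        = ∑ α, ∑ β, ξ α * ξ β * ((n : ℝ)⁻¹ * ∑ i ∈ Finset.range n,
          ∫ x, ψ α n i x * ψ β n i x ∂ν) := by
      intro n
      have e1 : ∀ i, ∫ x, (∑ α, ξ α * ψ α n i x) ^ 2 ∂ν
          = ∑ α, ∑ β, ξ α * ξ β * ∫ x, ψ α n i x * ψ β n i x ∂ν := by
        intro i
        have e2 : ∀ x, (∑ α, ξ α * ψ α n i x) ^ 2
            = ∑ α, ∑ β, ξ α * ξ β * (ψ α n i x * ψ β n i x) := by
          intro x
          rw [sq, Finset.sum_mul_sum]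
          exact Finset.sum_congr rfl fun α _ => Finset.sum_congr rfl fun β _ => by ring
        have hi : ∀ α β, Integrable (fun x => ξ α * ξ β * (ψ α n i x * ψ β n i x)) ν :=
          fun α β => ((hmem α n i).integrable_mul (hmem β n i)).const_mul _
        simp_rw [e2]
        rw [integral_finsetSum _ fun α _ => integrable_finsetSum _ fun β _ => hi α β]
        refine Finset.sum_congr rfl fun α _ => ?_
        rw [integral_finsetSum _ fun β _ => hi α β]
        exact Finset.sum_congr rfl fun β _ => integral_const_mul _ _
      simp_rw [e1]
      rw [Finset.sum_comm, Finset.mul_sum]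
      refine Finset.sum_congr rfl fun α _ => ?_
      rw [Finset.sum_comm, Finset.mul_sum]
      refine Finset.sum_congr rfl fun β _ => ?_
      rw [← Finset.mul_sum]
      ring
    simp_rw [e]
    have := tendsto_finsetSum Finset.univ fun α _ => tendsto_finsetSum Finset.univ fun β _ =>
      (hgram α β).const_mul (ξ α * ξ β)
    convert this using 2
    refine Finset.sum_congr rfl fun α _ => ?_
    simp [sq]

/-- Limit of the characteristic function of a quadratic form in linear statistics. -/
theorem tendsto_integral_cexp_quadratic (hX : ∀ i, HasLaw (X i) ν P)
    (hind : iIndepFun X P) {A : Type*} [Fintype A] [DecidableEq A] {ψ : A → ℕ → ℕ → 𝓧 → ℝ}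
    (hψ : ∀ α n i, Measurable (ψ α n i)) {G : 𝓧 → ℝ} (hG : MemLp G 2 ν)
    (hb : ∀ α n i x, |ψ α n i x| ≤ G x) (h0 : ∀ α n i, ∫ x, ψ α n i x ∂ν = 0)
    (hgram : ∀ α β, Tendsto (fun n : ℕ => (n : ℝ)⁻¹ * ∑ i ∈ Finset.range n,
      ∫ x, ψ α n i x * ψ β n i x ∂ν) atTop (𝓝 (if α = β then 1 else 0)))
    (κ : A → ℝ) {D : ℕ → Ω → ℝ} (hDm : ∀ n, AEMeasurable (D n) P)
    (hD : TendstoInMeasure P D atTop (fun _ => 1 / 2 * ∑ α, κ α)) (t : ℝ) :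
    Tendsto (fun n : ℕ => ∫ ω, Complex.exp ((t * (∑ α, 1 / 2 * κ α *
      ((√(n : ℝ))⁻¹ * ∑ i ∈ Finset.range n, ψ α n i (X i ω)) ^ 2 - D n ω) : ℝ) * Complex.I) ∂P)
      atTop (𝓝 (∏ α, chiSqCharFun (t * κ α))) := by
  -- Continuous mapping for the quadratic form, followed by Slutsky's theorem for the correction D,
  -- whose limit is constant.
  have h1 := (tendstoInDistribution_linear_statistics hX hind hψ hG hb h0 hgram).continuous_comp
    (g := fun z : EuclideanSpace ℝ A => ∑ α, 1 / 2 * κ α * z α ^ 2) (by fun_prop)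
  have hD' : TendstoInMeasure P (fun n ω => -D n ω) atTop (fun _ => -(1 / 2 * ∑ α, κ α)) := by
    intro ε hε
    refine (hD ε hε).congr fun n => ?_
    simp only [edist_neg_neg]
  have h2 := (h1.add_of_tendstoInMeasure_const hD' fun n => (hDm n).neg).tendsto_integral_cexp t
  rw [← integral_cexp_pi_gaussian]
  simp only [Function.comp_def, Pi.add_apply, ← sub_eq_add_neg] at h2
  exact h2

end Quadratic

/-! ### The cyclic U-statistic as a weighted kernel sum -/

section CyclicSum

variable {Ω 𝓧 : Type*}

theorem add_mod_eq_ite {n i j : ℕ} (hi : i < n) (hj : j < n) :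
    (i + j) % n = if i + j < n then i + j else i + j - n := by
  split_ifs with h
  · exact Nat.mod_eq_of_lt h
  · rw [Nat.mod_eq_sub_mod (by omega), Nat.mod_eq_of_lt (by omega)]

theorem sum_range_add_mod {M : Type*} [AddCommMonoid M] {n i : ℕ} (hi : i < n) (f : ℕ → M) :
    ∑ j ∈ Finset.range n, f ((i + j) % n) = ∑ k ∈ Finset.range n, f k := by
  refine Finset.sum_nbij' (fun j => (i + j) % n) (fun k => (n - i + k) % n) ?_ ?_ ?_ ?_ ?_
  · intro j _
    exact Finset.mem_range.2 (Nat.mod_lt _ (by omega))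
  · intro j _
    exact Finset.mem_range.2 (Nat.mod_lt _ (by omega))
  · intro j hj
    rw [Finset.mem_range] at hj
    simp only [Nat.add_mod_mod]
    rw [show n - i + (i + j) = j + n by omega, Nat.add_mod_right, Nat.mod_eq_of_lt hj]
  · intro j hj
    rw [Finset.mem_range] at hj
    simp only [Nat.add_mod_mod]
    rw [show i + (n - i + j) = j + n by omega, Nat.add_mod_right, Nat.mod_eq_of_lt hj]
  · intros; rfl

/-- The index set of the pairs `(i, i + j)`, `1 ≤ j < n`, modulo `n`. -/
def cyclicIndex (n : ℕ) : Finset (ℕ × ℕ) := Finset.range n ×ˢ Finset.Icc 1 (n - 1)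

/-- The pair of sample indices belonging to the shift `(i, j)`. -/
def cyclicPair (n : ℕ) (a : ℕ × ℕ) : ℕ × ℕ := (a.1, (a.1 + a.2) % n)

theorem cyclicPair_ne {n : ℕ} {a : ℕ × ℕ} (ha : a ∈ cyclicIndex n) :
    (cyclicPair n a).1 ≠ (cyclicPair n a).2 := by
  simp only [cyclicIndex, Finset.mem_product, Finset.mem_range, Finset.mem_Icc] at ha
  simp only [cyclicPair, ne_eq]
  rw [add_mod_eq_ite ha.1 (by omega)]
  split_ifs <;> omega

theorem cyclicPair_injOn (n : ℕ) : Set.InjOn (cyclicPair n) (cyclicIndex n) := by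
  rintro ⟨i, j⟩ ha ⟨k, l⟩ hb h
  simp only [cyclicIndex, Finset.coe_product, Set.mem_prod, Finset.mem_coe, Finset.mem_range,
    Finset.mem_Icc] at ha hb
  simp only [cyclicPair, Prod.mk.injEq] at h ⊢
  obtain ⟨rfl, h⟩ := h
  refine ⟨rfl, ?_⟩
  rw [add_mod_eq_ite ha.1 (by omega), add_mod_eq_ite hb.1 (by omega)] at h
  split_ifs at h <;> omega

theorem sum_Icc_filter_eq {M : Type*} [AddCommMonoid M] (n : ℕ) (f : ℕ → M) :
    ∑ j ∈ (Finset.Icc 1 n).filter (fun j => 2 * j < n), f j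
      = ∑ j ∈ (Finset.Icc 1 (n - 1)).filter (fun j => 2 * j < n), f j := by
  refine Finset.sum_congr ?_ fun _ _ => rfl
  ext j
  simp only [Finset.mem_filter, Finset.mem_Icc]
  omega

theorem cyclicU_eq_sum (f : 𝓧 → 𝓧 → ℝ) (X : ℕ → Ω → 𝓧) (n : ℕ) (ω : Ω) :
    cyclicU f X n ω = ∑ a ∈ (cyclicIndex n).filter (fun a => 2 * a.2 < n),
      1 * f (X (cyclicPair n a).1 ω) (X (cyclicPair n a).2 ω) := by
  rw [cyclicU, Finset.sum_filter, cyclicIndex, Finset.sum_product]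
  refine Finset.sum_congr rfl fun i _ => ?_
  rw [sum_Icc_filter_eq, Finset.sum_filter]
  refine Finset.sum_congr rfl fun j _ => ?_
  simp [cyclicPair]

/-- The indicator of j < n/2 becomes 1/2 plus a centred square wave, the function to be expanded in
a Fourier series. For even n, the value -1/2 of the wave at its jump excludes j = n/2. -/
theorem cyclicU_eq_weighted_sum (f : 𝓧 → 𝓧 → ℝ) (X : ℕ → Ω → 𝓧) (n : ℕ) (ω : Ω) :
    cyclicU f X n ω = ∑ a ∈ cyclicIndex n, (1 / 2 + squareWave ((a.2 : ℝ) / n)) *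
      f (X (cyclicPair n a).1 ω) (X (cyclicPair n a).2 ω) := by
  rw [cyclicU_eq_sum, Finset.sum_filter]
  refine Finset.sum_congr rfl fun a ha => ?_
  simp only [cyclicIndex, Finset.mem_product, Finset.mem_range] at ha
  have hn : (0 : ℝ) < n := by exact_mod_cast (by omega : 0 < n)
  have h : (a.2 : ℝ) / n < 1 / 2 ↔ 2 * a.2 < n := by
    rw [div_lt_div_iff₀ hn (by norm_num)]
    rw [← Nat.cast_lt (α := ℝ)]
    push_cast
    constructor <;> intro h <;> linarith
  simp only [squareWave, h]
  split_ifs <;> ring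

theorem oddSin_sub (k : ℕ) (a b : ℝ) :
    oddSin k (a - b) = oddSin k a * oddCos k b - oddCos k a * oddSin k b := by
  simp only [oddSin, oddCos, mul_sub, Real.sin_sub]

theorem oddSin_sub_one (k : ℕ) (a : ℝ) : oddSin k (a - 1) = oddSin k a := by
  simp only [oddSin]
  rw [show 2 * Real.pi * (2 * (k : ℝ) + 1) * (a - 1)
    = 2 * Real.pi * (2 * k + 1) * a - ((2 * k + 1 : ℕ) : ℝ) * (2 * Real.pi) by push_cast; ring]
  exact Real.sin_sub_nat_mul_two_pi _ _

/-- The partial sums have period 1, so reduction modulo n goes unnoticed. The weight thereby becomes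
a function of the difference of the two positions. -/
theorem wavePartial_shift (M : ℕ) {n i j : ℕ} (hi : i < n) (hj : j < n) :
    wavePartial M (((i + j) % n : ℕ) / n - i / n : ℝ) = wavePartial M ((j : ℝ) / n) := by
  have hn : (n : ℝ) ≠ 0 := by exact_mod_cast (by omega : n ≠ 0)
  rw [add_mod_eq_ite hi hj]
  split_ifs with h
  · congr 1
    push_cast
    ring
  · have e : (((i + j - n : ℕ) : ℝ) / n - i / n) = (j : ℝ) / n - 1 := by
      rw [Nat.cast_sub (by omega)]
      push_cast
      field_simp
      ring
    rw [e]
    simp only [wavePartial, oddSin_sub_one]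

/-- Adding the diagonal turns the sum over shifts into a double sum. -/
theorem sum_wavePartial_add_diag (M : ℕ) (F : ℕ → ℕ → ℝ) (n : ℕ) :
    ∑ a ∈ cyclicIndex n, (1 / 2 + wavePartial M ((a.2 : ℝ) / n)) *
        F (cyclicPair n a).1 (cyclicPair n a).2
      + ∑ i ∈ Finset.range n, 1 / 2 * F i i
      = ∑ i ∈ Finset.range n, ∑ k ∈ Finset.range n,
        (1 / 2 + wavePartial M ((k : ℝ) / n - i / n)) * F i k := by
  rw [cyclicIndex, Finset.sum_product, ← Finset.sum_add_distrib]
  refine Finset.sum_congr rfl fun i hi => ?_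
  rw [Finset.mem_range] at hi
  rw [← sum_range_add_mod hi]
  have h0 : Finset.range n = insert 0 (Finset.Icc 1 (n - 1)) := by
    ext j
    simp only [Finset.mem_range, Finset.mem_insert, Finset.mem_Icc]
    omega
  rw [h0, Finset.sum_insert (by simp), add_comm]
  congr 1
  -- The diagonal is the shift j = 0, where all sines vanish and the weight is 1/2.
  · rw [wavePartial_shift M hi (by omega), add_zero, Nat.mod_eq_of_lt hi]
    simp [wavePartial, oddSin]
  · refine Finset.sum_congr rfl fun j hj => ?_
    rw [Finset.mem_Icc] at hj
    rw [wavePartial_shift M hi (by omega)]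
    simp [cyclicPair]

/-- A double sum with trigonometric weights factorizes. -/
theorem sum_wavePartial_mul (M n : ℕ) (x y : ℕ → ℝ) :
    ∑ i ∈ Finset.range n, ∑ k ∈ Finset.range n,
        (1 / 2 + wavePartial M ((k : ℝ) / n - i / n)) * (x i * y k)
      = 1 / 2 * ((∑ i ∈ Finset.range n, x i) * ∑ i ∈ Finset.range n, y i)
        + ∑ m ∈ Finset.range M, waveCoeff m *
          ((∑ i ∈ Finset.range n, oddCos m (i / n) * x i)
              * (∑ i ∈ Finset.range n, oddSin m (i / n) * y i)
            - (∑ i ∈ Finset.range n, oddSin m (i / n) * x i)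
              * (∑ i ∈ Finset.range n, oddCos m (i / n) * y i)) := by
  have e : ∀ i k : ℕ, (1 / 2 + wavePartial M ((k : ℝ) / n - i / n)) * (x i * y k)
      = 1 / 2 * (x i * y k) + ∑ m ∈ Finset.range M, waveCoeff m *
        ((oddCos m (i / n) * x i) * (oddSin m (k / n) * y k)
          - (oddSin m (i / n) * x i) * (oddCos m (k / n) * y k)) := by
    intro i k
    rw [add_mul, wavePartial, Finset.sum_mul]
    congr 1
    refine Finset.sum_congr rfl fun m _ => ?_
    rw [oddSin_sub]
    ring
  simp only [e, Finset.sum_add_distrib]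
  congr 1
  · rw [Finset.sum_mul_sum, Finset.mul_sum]
    exact Finset.sum_congr rfl fun i _ => (Finset.mul_sum _ _ _).symm
  · have e2 : ∀ i : ℕ, ∑ k ∈ Finset.range n, ∑ m ∈ Finset.range M, waveCoeff m *
        ((oddCos m (i / n) * x i) * (oddSin m (k / n) * y k)
          - (oddSin m (i / n) * x i) * (oddCos m (k / n) * y k))
        = ∑ m ∈ Finset.range M, waveCoeff m * ∑ k ∈ Finset.range n,
        ((oddCos m (i / n) * x i) * (oddSin m (k / n) * y k)
          - (oddSin m (i / n) * x i) * (oddCos m (k / n) * y k)) := by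
      intro i
      rw [Finset.sum_comm]
      exact Finset.sum_congr rfl fun m _ => (Finset.mul_sum _ _ _).symm
    simp only [e2]
    rw [Finset.sum_comm]
    refine Finset.sum_congr rfl fun m _ => ?_
    rw [← Finset.mul_sum]
    congr 1
    simp only [Finset.sum_sub_distrib]
    rw [Finset.sum_mul_sum, Finset.sum_mul_sum]

end CyclicSum

/-! ### The limit for kernels of finite rank -/

section FiniteRank

variable {Ω 𝓧 I B : Type*} [MeasurableSpace Ω] [MeasurableSpace 𝓧] {P : Measure Ω}
  [IsProbabilityMeasure P] {ν : Measure 𝓧} [IsProbabilityMeasure ν] {X : ℕ → Ω → 𝓧}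

/-- The kernel `∑ λ_r e_r ⊗ e_r + ∑ l_q (u_q ⊗ v_q - v_q ⊗ u_q)` of finite rank. -/
def finiteRankKernel [Fintype I] [Fintype B] (a : I → ℝ) (e : I → 𝓧 → ℝ) (l : B → ℝ)
    (w : B × Bool → 𝓧 → ℝ) (x y : 𝓧) : ℝ :=
  ∑ r, a r * (e r x * e r y)
    + ∑ q, l q * (w (q, true) x * w (q, false) y - w (q, false) x * w (q, true) y)

/-- The sign `±1` of a Boolean. -/
def boolSign (b : Bool) : ℝ := if b then 1 else -1

/-- Index set of the Gaussian coordinates in the finite rank limit. -/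
abbrev RankIndex (I B : Type*) (M : ℕ) : Type _ := I ⊕ B × Fin M × Bool × Bool

/-- First trigonometric coefficient of a linear statistic. -/
def trigCoeff₁ {M : ℕ} : RankIndex I B M → ℝ → ℝ
  | .inl _ => fun _ => 1
  | .inr q => oddCos q.2.1

/-- Second trigonometric coefficient of a linear statistic. -/
def trigCoeff₂ {M : ℕ} : RankIndex I B M → ℝ → ℝ
  | .inl _ => fun _ => 0
  | .inr q => fun τ => boolSign q.2.2.2 * oddSin q.2.1 τ

/-- Function multiplying `trigCoeff₁`. -/
def rankFun₁ {M : ℕ} (e : I → 𝓧 → ℝ) (w : B × Bool → 𝓧 → ℝ) : RankIndex I B M → 𝓧 → ℝ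
  | .inl r => e r
  | .inr q => w (q.1, q.2.2.1)

/-- Function multiplying `trigCoeff₂`. -/
def rankFun₂ {M : ℕ} (e : I → 𝓧 → ℝ) (w : B × Bool → 𝓧 → ℝ) : RankIndex I B M → 𝓧 → ℝ
  | .inl r => e r
  | .inr q => w (q.1, !q.2.2.1)

/-- The coefficient of the square of a linear statistic. -/
def rankCoeff {M : ℕ} (a : I → ℝ) (l : B → ℝ) : RankIndex I B M → ℝ
  | .inl r => a r
  | .inr q => boolSign q.2.2.1 * boolSign q.2.2.2 * (l q.1 * waveCoeff q.2.1)

/-- The summands of the linear statistics. -/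
def rankSummand {M : ℕ} (e : I → 𝓧 → ℝ) (w : B × Bool → 𝓧 → ℝ) (α : RankIndex I B M) (n i : ℕ)
    (x : 𝓧) : ℝ :=
  trigCoeff₁ α (i / n) * rankFun₁ e w α x + trigCoeff₂ α (i / n) * rankFun₂ e w α x

theorem abs_trigCoeff₁_le_one {M : ℕ} (α : RankIndex I B M) (τ : ℝ) : |trigCoeff₁ α τ| ≤ 1 := by
  rcases α with r | q
  · simp [trigCoeff₁]
  · exact abs_oddCos_le_one _ _

theorem abs_trigCoeff₂_le_one {M : ℕ} (α : RankIndex I B M) (τ : ℝ) : |trigCoeff₂ α τ| ≤ 1 := by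
  rcases α with r | ⟨q, m, σ, ε⟩
  · simp [trigCoeff₂]
  · have := abs_oddSin_le_one m τ
    cases ε <;> simpa [trigCoeff₂, boolSign] using this

theorem rankFun₁_properties {M : ℕ} {e : I → 𝓧 → ℝ} {w : B × Bool → 𝓧 → ℝ}
    (he : IsCentredSystem e ν) (hw : IsCentredSystem w ν) (α : RankIndex I B M) :
    Measurable (rankFun₁ e w α) ∧ MemLp (rankFun₁ e w α) 2 ν ∧ ∫ x, rankFun₁ e w α x ∂ν = 0 := by
  rcases α with r | q
  · exact ⟨he.measurable r, he.memLp r, he.integral_eq_zero r⟩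
  · exact ⟨hw.measurable _, hw.memLp _, hw.integral_eq_zero _⟩

theorem rankFun₂_properties {M : ℕ} {e : I → 𝓧 → ℝ} {w : B × Bool → 𝓧 → ℝ}
    (he : IsCentredSystem e ν) (hw : IsCentredSystem w ν) (α : RankIndex I B M) :
    Measurable (rankFun₂ e w α) ∧ MemLp (rankFun₂ e w α) 2 ν ∧ ∫ x, rankFun₂ e w α x ∂ν = 0 := by
  rcases α with r | q
  · exact ⟨he.measurable r, he.memLp r, he.integral_eq_zero r⟩
  · exact ⟨hw.measurable _, hw.memLp _, hw.integral_eq_zero _⟩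

/-- Position and sample value separate: as all X_i have the same law, each averaged covariance is a
grid average times an integral against ν. -/
theorem average_integral_mul_eq_gridAvg {φ φ' χ χ' : 𝓧 → ℝ} (hφ : MemLp φ 2 ν)
    (hφ' : MemLp φ' 2 ν) (hχ : MemLp χ 2 ν) (hχ' : MemLp χ' 2 ν) (p p' q q' : ℝ → ℝ) (n : ℕ) :
    (n : ℝ)⁻¹ * ∑ i ∈ Finset.range n, ∫ x, (p (i / n) * φ x + p' (i / n) * φ' x)
        * (q (i / n) * χ x + q' (i / n) * χ' x) ∂ν
      = gridAvg (fun τ => p τ * q τ) n * ∫ x, φ x * χ x ∂ν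
        + gridAvg (fun τ => p τ * q' τ) n * ∫ x, φ x * χ' x ∂ν
        + gridAvg (fun τ => p' τ * q τ) n * ∫ x, φ' x * χ x ∂ν
        + gridAvg (fun τ => p' τ * q' τ) n * ∫ x, φ' x * χ' x ∂ν := by
  have e : ∀ i : ℕ, ∫ x, (p (i / n) * φ x + p' (i / n) * φ' x)
        * (q (i / n) * χ x + q' (i / n) * χ' x) ∂ν
      = p (i / n) * q (i / n) * ∫ x, φ x * χ x ∂ν
        + p (i / n) * q' (i / n) * ∫ x, φ x * χ' x ∂ν
        + p' (i / n) * q (i / n) * ∫ x, φ' x * χ x ∂ν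
        + p' (i / n) * q' (i / n) * ∫ x, φ' x * χ' x ∂ν := by
    intro i
    have i1 : Integrable (fun x => p (i / n) * q (i / n) * (φ x * χ x)) ν :=
      (hφ.integrable_mul hχ).const_mul _
    have i2 : Integrable (fun x => p (i / n) * q' (i / n) * (φ x * χ' x)) ν :=
      (hφ.integrable_mul hχ').const_mul _
    have i3 : Integrable (fun x => p' (i / n) * q (i / n) * (φ' x * χ x)) ν :=
      (hφ'.integrable_mul hχ).const_mul _
    have i4 : Integrable (fun x => p' (i / n) * q' (i / n) * (φ' x * χ' x)) ν :=
      (hφ'.integrable_mul hχ').const_mul _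
    have i12 : Integrable (fun x => p (i / n) * q (i / n) * (φ x * χ x)
      + p (i / n) * q' (i / n) * (φ x * χ' x)) ν := i1.add i2
    have i123 : Integrable (fun x => p (i / n) * q (i / n) * (φ x * χ x)
      + p (i / n) * q' (i / n) * (φ x * χ' x) + p' (i / n) * q (i / n) * (φ' x * χ x)) ν :=
      i12.add i3
    simp only [← integral_const_mul]
    rw [← integral_add i1 i2, ← integral_add i12 i3, ← integral_add i123 i4]
    refine integral_congr_ae (Eventually.of_forall fun x => ?_)
    simp only
    ring
  simp only [e, Finset.sum_add_distrib, ← Finset.sum_mul, gridAvg]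
  ring

/-- Mixed terms between the two systems vanish because odd harmonics have mean zero; no
orthogonality between `e` and `w` is required, and this is why the two parts of the kernel decouple
in the limit. For equal q, m and σ the limit is ½ + εε'/2. For unequal σ the nonzero integrals meet
only the vanishing averages of cos times sin. -/
theorem tendsto_gram_rankSummand [DecidableEq I] [DecidableEq B] {M : ℕ} {e : I → 𝓧 → ℝ}
    {w : B × Bool → 𝓧 → ℝ} (he : IsCentredSystem e ν) (hw : IsCentredSystem w ν)
    (α β : RankIndex I B M) :
    Tendsto (fun n : ℕ => (n : ℝ)⁻¹ * ∑ i ∈ Finset.range n,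
      ∫ x, rankSummand e w α n i x * rankSummand e w β n i x ∂ν) atTop
      (𝓝 (if α = β then 1 else 0)) := by
  have hg : ∀ n : ℕ, _ := fun n => average_integral_mul_eq_gridAvg
    (rankFun₁_properties he hw α).2.1 (rankFun₂_properties he hw α).2.1
    (rankFun₁_properties he hw β).2.1 (rankFun₂_properties he hw β).2.1
    (trigCoeff₁ α) (trigCoeff₂ α) (trigCoeff₁ β) (trigCoeff₂ β) n
  simp only [rankSummand, hg]
  have hsc : ∀ k m, Tendsto (gridAvg fun τ => oddCos k τ * oddSin m τ) atTop (𝓝 0) := by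
    intro k m
    simpa only [mul_comm] using tendsto_gridAvg_oddSin_mul_oddCos m k
  have hww : ∀ p q : B × Bool, ∫ x, w p x * w q x ∂ν = if p = q then 1 else 0 := by
    intro p q
    split_ifs with h
    · rw [h, hw.integral_mul_self]
    · exact hw.integral_mul p q h
  rcases α with r | ⟨q, m, σ, ε⟩ <;> rcases β with r' | ⟨q', m', σ', ε'⟩
  · simp only [trigCoeff₁, trigCoeff₂, rankFun₁, mul_one, mul_zero]
    have h0 : gridAvg (fun _ => (0 : ℝ)) = fun _ => 0 := by ext n; simp [gridAvg]
    have h1 : ∫ x, e r x * e r' x ∂ν = if r = r' then 1 else 0 := by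
      split_ifs with h
      · rw [h, he.integral_mul_self]
      · exact he.integral_mul r r' h
    simp only [h0, h1, zero_mul, add_zero]
    have := (tendsto_gridAvg_const 1).mul_const (if r = r' then (1 : ℝ) else 0)
    simpa using this
  · simp only [trigCoeff₁, trigCoeff₂, rankFun₁, rankFun₂, one_mul, zero_mul]
    have h0 : gridAvg (fun _ => (0 : ℝ)) = fun _ => 0 := by ext n; simp [gridAvg]
    simp only [h0, zero_mul, add_zero, gridAvg_const_mul]
    have := ((tendsto_gridAvg_oddCos m').mul_const (∫ x, e r x * w (q', σ') x ∂ν)).add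
      (((tendsto_gridAvg_oddSin m').const_mul (boolSign ε')).mul_const
        (∫ x, e r x * w (q', !σ') x ∂ν))
    simpa using this
  · simp only [trigCoeff₁, trigCoeff₂, rankFun₁, rankFun₂, mul_one, mul_zero]
    have h0 : gridAvg (fun _ => (0 : ℝ)) = fun _ => 0 := by ext n; simp [gridAvg]
    simp only [h0, zero_mul, add_zero, gridAvg_const_mul]
    have := ((tendsto_gridAvg_oddCos m).mul_const (∫ x, w (q, σ) x * e r' x ∂ν)).add
      (((tendsto_gridAvg_oddSin m).const_mul (boolSign ε)).mul_const
        (∫ x, w (q, !σ) x * e r' x ∂ν))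
    simpa using this
  · simp only [trigCoeff₁, trigCoeff₂, rankFun₁, rankFun₂, hww]
    have e1 : (fun τ => oddCos m τ * (boolSign ε' * oddSin m' τ))
        = fun τ => boolSign ε' * (oddCos m τ * oddSin m' τ) := by ext; ring
    have e2 : (fun τ => boolSign ε * oddSin m τ * oddCos m' τ)
        = fun τ => boolSign ε * (oddSin m τ * oddCos m' τ) := by ext; ring
    have e3 : (fun τ => boolSign ε * oddSin m τ * (boolSign ε' * oddSin m' τ))
        = fun τ => boolSign ε * boolSign ε' * (oddSin m τ * oddSin m' τ) := by ext; ring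
    simp only [e1, e2, e3, gridAvg_const_mul]
    have := ((((tendsto_gridAvg_oddCos_mul_oddCos m m').mul_const
        (if (q, σ) = (q', σ') then (1 : ℝ) else 0)).add
      (((hsc m m').const_mul (boolSign ε')).mul_const
        (if (q, σ) = (q', !σ') then (1 : ℝ) else 0))).add
      (((tendsto_gridAvg_oddSin_mul_oddCos m m').const_mul (boolSign ε)).mul_const
        (if (q, !σ) = (q', σ') then (1 : ℝ) else 0))).add
      (((tendsto_gridAvg_oddSin_mul_oddSin m m').const_mul (boolSign ε * boolSign ε')).mul_const
        (if (q, !σ) = (q', !σ') then (1 : ℝ) else 0))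
    convert this using 2
    by_cases hq : q = q' <;> by_cases hm : m = m' <;> cases σ <;> cases σ' <;> cases ε <;>
      cases ε' <;> simp [hq, hm, boolSign, Fin.val_inj] <;> norm_num

/-- The signs in each antisymmetric block cancel, so only the symmetric part needs centring, in
agreement with the limit of the diagonal. -/
theorem sum_rankCoeff [Fintype I] [Fintype B] {M : ℕ} (a : I → ℝ) (l : B → ℝ) :
    ∑ α : RankIndex I B M, rankCoeff a l α = ∑ r, a r := by
  rw [Fintype.sum_sum_type]
  simp [rankCoeff, Fintype.sum_prod_type, boolSign]

theorem sum_sum_sum_rotate {J R : Type*} [Fintype J] [AddCommMonoid R] (s : Finset ℕ)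
    (G : ℕ → ℕ → J → R) :
    ∑ i ∈ s, ∑ k ∈ s, ∑ r, G i k r = ∑ r, ∑ i ∈ s, ∑ k ∈ s, G i k r := by
  simp only [Finset.sum_comm (s := s) (t := (Finset.univ : Finset J))]

/-- With trigonometric weights, the statistic of a finite rank kernel is a quadratic form. -/
theorem sum_wavePartial_finiteRankKernel [Fintype I] [Fintype B] (M n : ℕ) (a : I → ℝ)
    (e : I → 𝓧 → ℝ) (l : B → ℝ) (w : B × Bool → 𝓧 → ℝ) (x : ℕ → 𝓧) :
    ∑ i ∈ Finset.range n, ∑ k ∈ Finset.range n,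
        (1 / 2 + wavePartial M ((k : ℝ) / n - i / n)) * finiteRankKernel a e l w (x i) (x k)
      = ∑ α : RankIndex I B M, 1 / 2 * rankCoeff a l α *
        (∑ i ∈ Finset.range n, rankSummand e w α n i (x i)) ^ 2 := by
  have e1 : ∀ i k : ℕ, (1 / 2 + wavePartial M ((k : ℝ) / n - i / n))
        * finiteRankKernel a e l w (x i) (x k)
      = ∑ r, a r * ((1 / 2 + wavePartial M ((k : ℝ) / n - i / n)) * (e r (x i) * e r (x k)))
        + ∑ q, l q * ((1 / 2 + wavePartial M ((k : ℝ) / n - i / n))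
            * (w (q, true) (x i) * w (q, false) (x k))
          - (1 / 2 + wavePartial M ((k : ℝ) / n - i / n))
            * (w (q, false) (x i) * w (q, true) (x k))) := by
    intro i k
    rw [finiteRankKernel, mul_add, Finset.mul_sum, Finset.mul_sum]
    congr 1 <;> exact Finset.sum_congr rfl fun _ _ => by ring
  simp only [e1, Finset.sum_add_distrib]
  rw [sum_sum_sum_rotate, sum_sum_sum_rotate, Fintype.sum_sum_type]
  congr 1
  · refine Finset.sum_congr rfl fun r _ => ?_
    simp only [← Finset.mul_sum]
    rw [sum_wavePartial_mul M n (fun i => e r (x i)) (fun i => e r (x i))]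
    simp only [rankCoeff, rankSummand, trigCoeff₁, trigCoeff₂, rankFun₁, one_mul, zero_mul,
      add_zero]
    -- With the same function in both places the cos–sin products cancel, and only the constant
    -- weight is left.
    rw [Finset.sum_eq_zero (s := Finset.range M) fun m _ => by ring]
    ring
  · rw [Fintype.sum_prod_type]
    refine Finset.sum_congr rfl fun q _ => ?_
    simp only [← Finset.mul_sum, Finset.sum_sub_distrib]
    rw [sum_wavePartial_mul M n (fun i => w (q, true) (x i)) (fun i => w (q, false) (x i)),
      sum_wavePartial_mul M n (fun i => w (q, false) (x i)) (fun i => w (q, true) (x i)),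
      mul_comm (∑ i ∈ Finset.range n, w (q, false) (x i)), add_sub_add_left_eq_sub,
      ← Finset.sum_sub_distrib, Fintype.sum_prod_type, Finset.mul_sum,
      ← Fin.sum_univ_eq_sum_range (fun m => l q * _)]
    refine Finset.sum_congr rfl fun m _ => ?_
    -- The constant weight has cancelled. Writing Cu, Su, Cv, Sv for the sums of u and v with cosine
    -- and sine weights, the remaining form is polarized: 2(Cu Sv - Su Cv) = ½[(Cu + Sv)² - (Cu -
    -- Sv)² - (Cv + Su)² + (Cv - Su)²].
    rw [Fintype.sum_prod_type]
    simp only [Fintype.sum_bool, rankCoeff, rankSummand, trigCoeff₁, trigCoeff₂, rankFun₁, rankFun₂,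
      boolSign, Finset.sum_add_distrib, Bool.not_true, Bool.not_false, if_true,
      Bool.false_eq_true, if_false, one_mul, neg_mul, Finset.sum_neg_distrib]
    ring

/-- For fixed q and m the four sign choices give the coefficients a, -a, -a, a, which is the block
evaluated in `chiSqCharFun_block`. -/
theorem prod_chiSqCharFun_rankCoeff [Fintype I] [Fintype B] (M : ℕ) (a : I → ℝ) (l : B → ℝ)
    (t : ℝ) :
    ∏ α : RankIndex I B M, chiSqCharFun (t * rankCoeff a l α)
      = (∏ r, chiSqCharFun (t * a r)) * ∏ q, ((∏ m ∈ Finset.range M,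
        (1 + (t * l q * waveCoeff m) ^ 2)⁻¹ : ℝ) : ℂ) := by
  rw [Fintype.prod_sum_type]
  congr 1
  rw [Fintype.prod_prod_type]
  refine Finset.prod_congr rfl fun q _ => ?_
  rw [Complex.ofReal_prod, ← Fin.prod_univ_eq_prod_range (fun m =>
    (((1 + (t * l q * waveCoeff m) ^ 2)⁻¹ : ℝ) : ℂ)), Fintype.prod_prod_type]
  refine Finset.prod_congr rfl fun m _ => ?_
  rw [← chiSqCharFun_block, Fintype.prod_prod_type]
  simp only [Fintype.prod_bool, rankCoeff, boolSign, if_true, Bool.false_eq_true, if_false]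
  rw [show t * (1 * 1 * (l q * waveCoeff m)) = t * l q * waveCoeff m by ring,
    show t * (1 * -1 * (l q * waveCoeff m)) = -(t * l q * waveCoeff m) by ring,
    show t * (-1 * 1 * (l q * waveCoeff m)) = -(t * l q * waveCoeff m) by ring,
    show t * (-1 * -1 * (l q * waveCoeff m)) = t * l q * waveCoeff m by ring]
  ring

theorem isCanonical_finiteRankKernel [Fintype I] [Fintype B] {e : I → 𝓧 → ℝ}
    {w : B × Bool → 𝓧 → ℝ} (he : IsCentredSystem e ν) (hw : IsCentredSystem w ν) (a : I → ℝ)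
    (l : B → ℝ) : IsCanonical (finiteRankKernel a e l w) ν := by
  have hmul : ∀ {φ ψ : 𝓧 → ℝ}, MemLp φ 2 ν → MemLp ψ 2 ν →
      MemLp (fun p : 𝓧 × 𝓧 => φ p.1 * ψ p.2) 2 (ν.prod ν) := fun hφ hψ => by
    simpa using memLp_mul_conj hφ hψ
  have hei : ∀ r, Integrable (e r) ν := fun r => (he.memLp r).integrable (by norm_num)
  have hwi : ∀ q, Integrable (w q) ν := fun q => (hw.memLp q).integrable (by norm_num)
  have hright : ∀ x, ∫ y, finiteRankKernel a e l w x y ∂ν = 0 := by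
    intro x
    have i1 : ∀ r, Integrable (fun y => a r * (e r x * e r y)) ν := fun r =>
      ((hei r).const_mul _).const_mul _
    have i2 : ∀ q, Integrable (fun y => w (q, true) x * w (q, false) y) ν := fun q =>
      (hwi _).const_mul _
    have i3 : ∀ q, Integrable (fun y => w (q, false) x * w (q, true) y) ν := fun q =>
      (hwi _).const_mul _
    have i4 : ∀ q, Integrable (fun y => l q * (w (q, true) x * w (q, false) y
      - w (q, false) x * w (q, true) y)) ν := fun q => ((i2 q).sub (i3 q)).const_mul _
    simp only [finiteRankKernel]
    rw [integral_add (integrable_finsetSum _ fun r _ => i1 r)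
      (integrable_finsetSum _ fun q _ => i4 q), integral_finsetSum _ fun r _ => i1 r,
      integral_finsetSum _ fun q _ => i4 q]
    simp only [integral_const_mul]
    rw [Finset.sum_eq_zero fun r _ => by rw [he.integral_eq_zero]; ring,
      Finset.sum_eq_zero fun q _ => by
        rw [integral_sub (i2 q) (i3 q), integral_const_mul, integral_const_mul,
          hw.integral_eq_zero, hw.integral_eq_zero]; ring]
    simp
  have hleft : ∀ y, ∫ x, finiteRankKernel a e l w x y ∂ν = 0 := by
    intro y
    have i1 : ∀ r, Integrable (fun x => a r * (e r x * e r y)) ν := fun r =>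
      ((hei r).mul_const _).const_mul _
    have i2 : ∀ q, Integrable (fun x => w (q, true) x * w (q, false) y) ν := fun q =>
      (hwi _).mul_const _
    have i3 : ∀ q, Integrable (fun x => w (q, false) x * w (q, true) y) ν := fun q =>
      (hwi _).mul_const _
    have i4 : ∀ q, Integrable (fun x => l q * (w (q, true) x * w (q, false) y
      - w (q, false) x * w (q, true) y)) ν := fun q => ((i2 q).sub (i3 q)).const_mul _
    simp only [finiteRankKernel]
    rw [integral_add (integrable_finsetSum _ fun r _ => i1 r)
      (integrable_finsetSum _ fun q _ => i4 q), integral_finsetSum _ fun r _ => i1 r,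
      integral_finsetSum _ fun q _ => i4 q]
    simp only [integral_const_mul]
    rw [Finset.sum_eq_zero fun r _ => by rw [integral_mul_const, he.integral_eq_zero]; ring,
      Finset.sum_eq_zero fun q _ => by
        rw [integral_sub (i2 q) (i3 q), integral_mul_const, integral_mul_const,
          hw.integral_eq_zero, hw.integral_eq_zero]; ring]
    simp
  refine ⟨?_, ?_, Eventually.of_forall hright, Eventually.of_forall hleft⟩
  · have h1 := he.measurable
    have h2 := hw.measurable
    unfold finiteRankKernel Function.uncurry
    fun_prop
  · refine MemLp.add (memLp_finsetSum _ fun r _ => ?_) (memLp_finsetSum _ fun q _ => ?_)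
    · exact (hmul (he.memLp r) (he.memLp r)).const_mul (a r)
    · exact ((hmul (hw.memLp _) (hw.memLp _)).sub (hmul (hw.memLp _) (hw.memLp _))).const_mul (l q)

/-- The strong law of large numbers: the antisymmetric part is zero on the diagonal and each e_r²
has mean 1. This limit supplies the -1 in ζ_r² - 1. -/
theorem tendsto_diagonal_finiteRankKernel [Fintype I] [Fintype B]
    (hX : ∀ i, HasLaw (X i) ν P) (hind : iIndepFun X P) {e : I → 𝓧 → ℝ}
    {w : B × Bool → 𝓧 → ℝ} (he : IsCentredSystem e ν) (a : I → ℝ) (l : B → ℝ) :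
    TendstoInMeasure P (fun (n : ℕ) ω => (n : ℝ)⁻¹ * ∑ i ∈ Finset.range n,
      1 / 2 * finiteRankKernel a e l w (X i ω) (X i ω)) atTop (fun _ => 1 / 2 * ∑ r, a r) := by
  let h : 𝓧 → ℝ := fun x => 1 / 2 * ∑ r, a r * (e r x * e r x)
  have hk : ∀ x, 1 / 2 * finiteRankKernel a e l w x x = h x := fun x => by
    simp only [finiteRankKernel, h]
    rw [Finset.sum_eq_zero (s := (Finset.univ : Finset B)) fun q _ => by ring, add_zero]
  have hhm : Measurable h := by
    have h1 := he.measurable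
    fun_prop
  have hei : ∀ r, Integrable (fun x => a r * (e r x * e r x)) ν := fun r =>
    ((he.memLp r).integrable_mul (he.memLp r)).const_mul (a r)
  have hhi : Integrable h ν := (integrable_finsetSum _ fun r _ => hei r).const_mul _
  have hmean : ∫ x, h x ∂ν = 1 / 2 * ∑ r, a r := by
    simp only [h]
    rw [integral_const_mul, integral_finsetSum _ fun r _ => hei r]
    simp only [integral_const_mul, he.integral_mul_self, mul_one]
  simp only [hk]
  have hslln := strong_law_ae_real (fun i ω => h (X i ω)) (μ := P)
    (memLp_one_iff_integrable.1 (memLp_comp_of_hasLaw (hX 0) (memLp_one_iff_integrable.2 hhi))) (fun i j hij =>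
      (hind.indepFun hij).comp hhm hhm) (fun i =>
      ((hX i).identDistrib (hX 0)).comp hhm)
  have hE : ∫ ω, h (X 0 ω) ∂P = 1 / 2 * ∑ r, a r := by
    rw [← hmean]
    exact (hX 0).integral_comp hhm.aestronglyMeasurable
  refine tendstoInMeasure_of_tendsto_ae (fun n => ?_) ?_
  · refine AEMeasurable.aestronglyMeasurable ?_
    exact (Finset.aemeasurable_fun_sum _ fun i _ =>
      hhm.comp_aemeasurable (hX i).aemeasurable).const_mul _
  · filter_upwards [hslln] with ω hω
    rw [hE] at hω
    refine hω.congr fun n => ?_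
    rw [div_eq_inv_mul]

/-- The second moment of the error made by truncating the Fourier series of the weights. -/
theorem integral_cyclicU_sub_wavePartial_sq_le (hX : ∀ i, HasLaw (X i) ν P)
    (hind : iIndepFun X P) {g : 𝓧 → 𝓧 → ℝ} (hg : IsCanonical g ν) (M n : ℕ) :
    ∫ ω, ((n : ℝ)⁻¹ * cyclicU g X n ω - (n : ℝ)⁻¹ * ∑ a ∈ cyclicIndex n,
        (1 / 2 + wavePartial M ((a.2 : ℝ) / n)) *
          g (X (cyclicPair n a).1 ω) (X (cyclicPair n a).2 ω)) ^ 2 ∂P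
      ≤ 2 * gridAvg (fun τ => (squareWave τ - wavePartial M τ) ^ 2) n
        * ∫ z, g z.1 z.2 ^ 2 ∂(ν.prod ν) := by
  rcases Nat.eq_zero_or_pos n with rfl | hn
  · simp [gridAvg]
  have hn' : (0 : ℝ) < n := by exact_mod_cast hn
  have h1 := integral_weighted_kernel_sum_sq_le hX hind hg (cyclicIndex n) (cyclicPair n)
    (fun a => squareWave ((a.2 : ℝ) / n) - wavePartial M ((a.2 : ℝ) / n))
    (fun a ha => cyclicPair_ne ha) (cyclicPair_injOn n)
  have h2 : ∀ ω, ((n : ℝ)⁻¹ * cyclicU g X n ω - (n : ℝ)⁻¹ * ∑ a ∈ cyclicIndex n,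
        (1 / 2 + wavePartial M ((a.2 : ℝ) / n)) *
          g (X (cyclicPair n a).1 ω) (X (cyclicPair n a).2 ω)) ^ 2
      = (n : ℝ)⁻¹ ^ 2 * (∑ a ∈ cyclicIndex n,
        (squareWave ((a.2 : ℝ) / n) - wavePartial M ((a.2 : ℝ) / n)) *
          g (X (cyclicPair n a).1 ω) (X (cyclicPair n a).2 ω)) ^ 2 := by
    intro ω
    rw [cyclicU_eq_weighted_sum, ← mul_sub, mul_pow, ← Finset.sum_sub_distrib]
    congr 2
    exact Finset.sum_congr rfl fun a _ => by ring
  simp only [h2]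
  rw [integral_const_mul]
  have h3 : ∑ a ∈ cyclicIndex n,
      (squareWave ((a.2 : ℝ) / n) - wavePartial M ((a.2 : ℝ) / n)) ^ 2
      ≤ (n : ℝ) ^ 2 * gridAvg (fun τ => (squareWave τ - wavePartial M τ) ^ 2) n := by
    rw [cyclicIndex, Finset.sum_product]
    simp only [Finset.sum_const, Finset.card_range, nsmul_eq_mul, gridAvg]
    have : ∑ j ∈ Finset.Icc 1 (n - 1), (squareWave ((j : ℝ) / n) - wavePartial M ((j : ℝ) / n)) ^ 2
        ≤ ∑ j ∈ Finset.range n, (squareWave ((j : ℝ) / n) - wavePartial M ((j : ℝ) / n)) ^ 2 := by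
      refine Finset.sum_le_sum_of_subset_of_nonneg (fun j hj => ?_) fun _ _ _ => sq_nonneg _
      rw [Finset.mem_Icc] at hj
      rw [Finset.mem_range]
      omega
    calc _ ≤ (n : ℝ) * _ := mul_le_mul_of_nonneg_left this hn'.le
      _ = _ := by field_simp
  have hg0 : 0 ≤ ∫ z, g z.1 z.2 ^ 2 ∂(ν.prod ν) := integral_nonneg fun _ => sq_nonneg _
  calc (n : ℝ)⁻¹ ^ 2 * _ ≤ (n : ℝ)⁻¹ ^ 2 * (2 * ((n : ℝ) ^ 2 *
        gridAvg (fun τ => (squareWave τ - wavePartial M τ) ^ 2) n)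
          * ∫ z, g z.1 z.2 ^ 2 ∂(ν.prod ν)) := by
        refine mul_le_mul_of_nonneg_left (h1.trans ?_) (by positivity)
        exact mul_le_mul_of_nonneg_right (by linarith) hg0
    _ = _ := by field_simp

/-- With truncated weights the statistic is a quadratic form in finitely many linear statistics
minus a diagonal term. The form tends in law to a combination of squares of independent normals, the
diagonal to a constant. -/
theorem tendsto_integral_cexp_wavePartial [Fintype I] [Fintype B]
    (hX : ∀ i, HasLaw (X i) ν P) (hind : iIndepFun X P) {e : I → 𝓧 → ℝ}
    {w : B × Bool → 𝓧 → ℝ} (he : IsCentredSystem e ν) (hw : IsCentredSystem w ν) (a : I → ℝ)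
    (l : B → ℝ) (M : ℕ) (t : ℝ) :
    Tendsto (fun n : ℕ => ∫ ω, Complex.exp ((t * ((n : ℝ)⁻¹ * ∑ b ∈ cyclicIndex n,
        (1 / 2 + wavePartial M ((b.2 : ℝ) / n)) * finiteRankKernel a e l w
          (X (cyclicPair n b).1 ω) (X (cyclicPair n b).2 ω)) : ℝ) * Complex.I) ∂P) atTop
      (𝓝 ((∏ r, chiSqCharFun (t * a r)) * ∏ q, ((∏ m ∈ Finset.range M,
        (1 + (t * l q * waveCoeff m) ^ 2)⁻¹ : ℝ) : ℂ))) := by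
  classical
  have p1 := rankFun₁_properties (M := M) he hw
  have p2 := rankFun₂_properties (M := M) he hw
  have key := tendsto_integral_cexp_quadratic hX hind (ψ := rankSummand (M := M) e w)
    (G := fun x => ∑ α : RankIndex I B M, (|rankFun₁ e w α x| + |rankFun₂ e w α x|))
    (fun α n i => ((p1 α).1.const_mul _).add ((p2 α).1.const_mul _))
    (memLp_finsetSum _ fun α _ => (p1 α).2.1.abs.add (p2 α).2.1.abs) ?_ ?_
    (tendsto_gram_rankSummand he hw) (rankCoeff a l)
    (D := fun n ω => (n : ℝ)⁻¹ * ∑ i ∈ Finset.range n,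
      1 / 2 * finiteRankKernel a e l w (X i ω) (X i ω)) ?_ ?_ t
  · rw [prod_chiSqCharFun_rankCoeff] at key
    refine key.congr fun n => ?_
    refine integral_congr_ae (Eventually.of_forall fun ω => ?_)
    simp only
    congr 4
    rw [sub_eq_iff_eq_add, ← mul_add, sum_wavePartial_add_diag M
      (fun i k => finiteRankKernel a e l w (X i ω) (X k ω)),
      sum_wavePartial_finiteRankKernel, Finset.mul_sum]
    refine Finset.sum_congr rfl fun α _ => ?_
    rw [mul_pow, inv_pow, Real.sq_sqrt (Nat.cast_nonneg n)]
    ring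
  · intro α n i x
    refine le_trans ?_ (Finset.single_le_sum
      (f := fun α : RankIndex I B M => |rankFun₁ e w α x| + |rankFun₂ e w α x|)
      (fun β _ => by positivity) (Finset.mem_univ α))
    refine (abs_add_le _ _).trans (add_le_add ?_ ?_)
    · rw [abs_mul]
      exact mul_le_of_le_one_left (abs_nonneg _) (abs_trigCoeff₁_le_one α _)
    · rw [abs_mul]
      exact mul_le_of_le_one_left (abs_nonneg _) (abs_trigCoeff₂_le_one α _)
  · intro α n i
    simp only [rankSummand]
    rw [integral_add (((p1 α).2.1.integrable (by norm_num)).const_mul _)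
      (((p2 α).2.1.integrable (by norm_num)).const_mul _), integral_const_mul, integral_const_mul,
      (p1 α).2.2, (p2 α).2.2]
    ring
  · intro n
    have hm := (isCanonical_finiteRankKernel he hw a l).measurable
    refine (Finset.aemeasurable_fun_sum _ fun i _ => ?_).const_mul _
    exact (hm.comp_aemeasurable ((hX i).aemeasurable.prodMk (hX i).aemeasurable)).const_mul _
  · rw [sum_rankCoeff]
    exact tendsto_diagonal_finiteRankKernel hX hind he a l

theorem memLp_cyclicU (hX : ∀ i, HasLaw (X i) ν P) (hind : iIndepFun X P) {g : 𝓧 → 𝓧 → ℝ}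
    (hg : MemLp (Function.uncurry g) 2 (ν.prod ν)) (n : ℕ) : MemLp (cyclicU g X n) 2 P := by
  have h := memLp_weighted_kernel_sum hX hind hg (cyclicIndex n) (cyclicPair n)
    (fun a => 1 / 2 + squareWave ((a.2 : ℝ) / n)) fun a ha => cyclicPair_ne ha
  exact h.ae_eq (Eventually.of_forall fun ω => (cyclicU_eq_weighted_sum g X n ω).symm)

/-- The limit law of the cyclic U-statistic of a kernel of finite rank. -/
theorem tendsto_integral_cexp_finiteRank [Fintype I] [Fintype B]
    (hX : ∀ i, HasLaw (X i) ν P) (hind : iIndepFun X P) {e : I → 𝓧 → ℝ}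
    {w : B × Bool → 𝓧 → ℝ} (he : IsCentredSystem e ν) (hw : IsCentredSystem w ν) (a : I → ℝ)
    (l : B → ℝ) (t : ℝ) :
    Tendsto (fun n : ℕ => ∫ ω, Complex.exp ((t * ((n : ℝ)⁻¹ *
        cyclicU (finiteRankKernel a e l w) X n ω) : ℝ) * Complex.I) ∂P) atTop
      (𝓝 ((∏ r, chiSqCharFun (t * a r)) * ∏ q, (((Real.cosh (t * l q))⁻¹ : ℝ) : ℂ))) := by
  have hg := isCanonical_finiteRankKernel he hw a l
  set C : ℝ := ∫ z, finiteRankKernel a e l w z.1 z.2 ^ 2 ∂(ν.prod ν) with hC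
  have hC0 : 0 ≤ C := integral_nonneg fun _ => sq_nonneg _
  have hM1 : Tendsto (fun M : ℕ => (∏ r, chiSqCharFun (t * a r)) * ∏ q, ((∏ m ∈ Finset.range M,
      (1 + (t * l q * waveCoeff m) ^ 2)⁻¹ : ℝ) : ℂ)) atTop
      (𝓝 ((∏ r, chiSqCharFun (t * a r)) * ∏ q, (((Real.cosh (t * l q))⁻¹ : ℝ) : ℂ))) := by
    refine (tendsto_finsetProd _ fun q _ => ?_).const_mul _
    exact (Complex.continuous_ofReal.tendsto _).comp (tendsto_prod_inv_cosh (t * l q))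
  have hM2 : Tendsto (fun M : ℕ => |t| * √(2 * (1 / 4 - 1 / 2 * ∑ k ∈ Finset.range M,
      waveCoeff k ^ 2) * C)) atTop (𝓝 0) := by
    have := ((tendsto_wave_error.const_mul 2).mul_const C).sqrt.const_mul |t|
    simpa using this
  refine tendsto_of_forall_approx fun ε hε => ?_
  -- M is fixed first, so that both the limiting mean square error of the weights and the distance
  -- between the partial product and its limit are below ε; only then does n grow.
  obtain ⟨M, hMa, hMb⟩ := ((hM2.eventually (gt_mem_nhds hε)).and
    (Metric.tendsto_nhds.1 hM1 ε hε)).exists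
  refine ⟨_, _, tendsto_integral_cexp_wavePartial hX hind he hw a l M t, ?_, ?_⟩
  · have h1 : Tendsto (fun n : ℕ => |t| * √(2 * gridAvg
        (fun τ => (squareWave τ - wavePartial M τ) ^ 2) n * C)) atTop
        (𝓝 (|t| * √(2 * (1 / 4 - 1 / 2 * ∑ k ∈ Finset.range M, waveCoeff k ^ 2) * C))) :=
      (((tendsto_gridAvg_wave_error M).const_mul 2).mul_const C).sqrt.const_mul |t|
    filter_upwards [h1.eventually (gt_mem_nhds hMa)] with n hn
    have m1 := ((memLp_cyclicU hX hind hg.memLp n).const_mul (n : ℝ)⁻¹).const_mul t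
    have m2 := ((memLp_weighted_kernel_sum hX hind hg.memLp (cyclicIndex n) (cyclicPair n)
      (fun b => 1 / 2 + wavePartial M ((b.2 : ℝ) / n))
      fun b hb => cyclicPair_ne hb).const_mul (n : ℝ)⁻¹).const_mul t
    refine (norm_integral_cexp_sub_cexp_le m1 m2).trans (le_trans ?_ hn.le)
    simp only [← mul_sub t, mul_pow t]
    rw [integral_const_mul, Real.sqrt_mul (sq_nonneg t), Real.sqrt_sq_eq_abs]
    exact mul_le_mul_of_nonneg_left
      (Real.sqrt_le_sqrt (integral_cyclicU_sub_wavePartial_sq_le hX hind hg M n)) (abs_nonneg t)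
  · rw [← dist_eq_norm, dist_comm]
    exact hMb.le

end FiniteRank

/-! ### Hoeffding decomposition, variance and central limit theorem -/

section Hoeffding

variable {Ω 𝓧 : Type*} [MeasurableSpace Ω] [MeasurableSpace 𝓧] {P : Measure Ω}
  [IsProbabilityMeasure P] {ν : Measure 𝓧} [IsProbabilityMeasure ν] {X : ℕ → Ω → 𝓧}
  {f : 𝓧 → 𝓧 → ℝ}

theorem measurable_proj₁ (hfm : Measurable (Function.uncurry f)) : Measurable (proj₁ f ν) :=
  (hfm.stronglyMeasurable.integral_prod_right (ν := ν)).measurable.sub_const _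

theorem measurable_proj₂ (hfm : Measurable (Function.uncurry f)) : Measurable (proj₂ f ν) :=
  (hfm.stronglyMeasurable.integral_prod_left (μ := ν)).measurable.sub_const _

theorem integral_proj₁ (hf : MemLp (Function.uncurry f) 2 (ν.prod ν)) :
    ∫ x, proj₁ f ν x ∂ν = 0 := by
  have hi : Integrable (Function.uncurry f) (ν.prod ν) := hf.integrable (by norm_num)
  have h1 : Integrable (fun x => ∫ y, f x y ∂ν) ν := hi.integral_prod_left
  simp only [proj₁]
  rw [integral_sub h1 (integrable_const _), kernelMean]
  simp [integral_prod (fun p => f p.1 p.2) hi]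

theorem integral_proj₂ (hf : MemLp (Function.uncurry f) 2 (ν.prod ν)) :
    ∫ x, proj₂ f ν x ∂ν = 0 := by
  have hi : Integrable (Function.uncurry f) (ν.prod ν) := hf.integrable (by norm_num)
  have h1 : Integrable (fun y => ∫ x, f x y ∂ν) ν := hi.integral_prod_right
  simp only [proj₂]
  rw [integral_sub h1 (integrable_const _), kernelMean]
  simp [integral_prod_symm (fun p => f p.1 p.2) hi]

theorem isCanonical_proj₁₂ (hfm : Measurable (Function.uncurry f))
    (hf : MemLp (Function.uncurry f) 2 (ν.prod ν)) : IsCanonical (proj₁₂ f ν) ν where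
  measurable := ((hfm.sub ((measurable_proj₁ hfm).comp measurable_fst)).sub
    ((measurable_proj₂ hfm).comp measurable_snd)).sub measurable_const
  memLp := memLp_proj₁₂ hf
  right := by
    have hi : Integrable (Function.uncurry f) (ν.prod ν) := hf.integrable (by norm_num)
    have h2 : Integrable (proj₂ f ν) ν := (memLp_proj₂ hf).integrable (by norm_num)
    filter_upwards [hi.prod_right_ae] with x hx
    have hx' : Integrable (fun y => f x y) ν := hx
    have i1 : Integrable (fun y => f x y - proj₁ f ν x) ν := hx'.sub (integrable_const _)
    have i2 : Integrable (fun y => f x y - proj₁ f ν x - proj₂ f ν y) ν := i1.sub h2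
    simp only [proj₁₂]
    rw [integral_sub i2 (integrable_const _), integral_sub i1 h2,
      integral_sub hx' (integrable_const _), integral_proj₂ hf]
    simp [proj₁]
  left := by
    have hi : Integrable (Function.uncurry f) (ν.prod ν) := hf.integrable (by norm_num)
    have h1 : Integrable (proj₁ f ν) ν := (memLp_proj₁ hf).integrable (by norm_num)
    filter_upwards [hi.prod_left_ae] with y hy
    have hy' : Integrable (fun x => f x y) ν := hy
    have i1 : Integrable (fun x => f x y - proj₁ f ν x) ν := hy'.sub h1
    have i2 : Integrable (fun x => f x y - proj₁ f ν x - proj₂ f ν y) ν :=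
      i1.sub (integrable_const _)
    simp only [proj₁₂]
    rw [integral_sub i2 (integrable_const _), integral_sub i1 (integrable_const _),
      integral_sub hy' h1, integral_proj₁ hf]
    simp [proj₂]

theorem card_shifts (n : ℕ) :
    ((Finset.Icc 1 n).filter fun j => 2 * j < n).card = (n - 1) / 2 := by
  have : (Finset.Icc 1 n).filter (fun j => 2 * j < n) = Finset.Icc 1 ((n - 1) / 2) := by
    ext j
    simp only [Finset.mem_filter, Finset.mem_Icc]
    omega
  rw [this, Nat.card_Icc]
  omega

/-- The Hoeffding decomposition of the cyclic U-statistic. -/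
theorem cyclicU_hoeffding (f : 𝓧 → 𝓧 → ℝ) (X : ℕ → Ω → 𝓧) (n : ℕ) (ω : Ω) :
    cyclicU f X n ω = (n : ℝ) * ((n - 1) / 2 : ℕ) * kernelMean f ν
      + ((n - 1) / 2 : ℕ) * ∑ i ∈ Finset.range n, (proj₁ f ν (X i ω) + proj₂ f ν (X i ω))
      + cyclicU (proj₁₂ f ν) X n ω := by
  set J := (Finset.Icc 1 n).filter fun j => 2 * j < n with hJ
  have hcard : (J.card : ℝ) = ((n - 1) / 2 : ℕ) := by rw [hJ, card_shifts]
  -- For a fixed shift j the map i ↦ i + j is a bijection modulo n, so each variable is the second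
  -- argument exactly once per shift.
  have h2 : ∑ i ∈ Finset.range n, ∑ j ∈ J, proj₂ f ν (X ((i + j) % n) ω)
      = J.card * ∑ i ∈ Finset.range n, proj₂ f ν (X i ω) := by
    rw [Finset.sum_comm, Finset.sum_congr rfl fun j hj => ?_, Finset.sum_const, nsmul_eq_mul]
    simp only [hJ, Finset.mem_filter] at hj
    rw [← sum_range_add_mod (i := j) (n := n) (by omega) fun i => proj₂ f ν (X i ω)]
    exact Finset.sum_congr rfl fun i _ => by rw [add_comm]
  have h1 : ∀ i j, f (X i ω) (X ((i + j) % n) ω) = kernelMean f ν + proj₁ f ν (X i ω)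
      + proj₂ f ν (X ((i + j) % n) ω) + proj₁₂ f ν (X i ω) (X ((i + j) % n) ω) := by
    intro i j
    simp only [proj₁₂]
    ring
  simp only [cyclicU, ← hJ]
  simp only [h1, Finset.sum_add_distrib]
  rw [h2]
  simp only [Finset.sum_const, Finset.card_range, nsmul_eq_mul, ← Finset.mul_sum, hcard]
  ring

theorem abs_half_sub_le (n : ℕ) : |(((n - 1) / 2 : ℕ) : ℝ) - n / 2| ≤ 1 := by
  have h1 : n ≤ 2 * ((n - 1) / 2) + 2 := by omega
  have h2 : 2 * ((n - 1) / 2) ≤ n := by omega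
  have h1' : (n : ℝ) ≤ 2 * ((n - 1) / 2 : ℕ) + 2 := by exact_mod_cast h1
  have h2' : 2 * (((n - 1) / 2 : ℕ) : ℝ) ≤ n := by exact_mod_cast h2
  rw [abs_le]
  constructor <;> linarith

theorem half_le (n : ℕ) : (((n - 1) / 2 : ℕ) : ℝ) ≤ n / 2 := by
  have h2 : 2 * ((n - 1) / 2) ≤ n := by omega
  have h2' : 2 * (((n - 1) / 2 : ℕ) : ℝ) ≤ n := by exact_mod_cast h2
  linarith

theorem abs_mul_half_sub_le (n : ℕ) :
    |(n : ℝ) * ((n - 1) / 2 : ℕ) - (n : ℝ) ^ 2 / 2| ≤ (n : ℝ) := by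
  have e : (n : ℝ) * ((n - 1) / 2 : ℕ) - (n : ℝ) ^ 2 / 2
      = n * ((((n - 1) / 2 : ℕ) : ℝ) - n / 2) := by ring
  rw [e, abs_mul, abs_of_nonneg (Nat.cast_nonneg n)]
  exact mul_le_of_le_one_right (Nat.cast_nonneg n) (abs_half_sub_le n)

theorem tendsto_half_div : Tendsto (fun n : ℕ => (((n - 1) / 2 : ℕ) : ℝ) / n) atTop
    (𝓝 (1 / 2)) := by
  rw [tendsto_iff_norm_sub_tendsto_zero]
  refine squeeze_zero' (Eventually.of_forall fun _ => norm_nonneg _) ?_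
    tendsto_one_div_atTop_nhds_zero_nat
  filter_upwards [eventually_gt_atTop 0] with n hn
  have hn' : (0 : ℝ) < n := by exact_mod_cast hn
  have e : (((n - 1) / 2 : ℕ) : ℝ) / n - 1 / 2 = ((((n - 1) / 2 : ℕ) : ℝ) - n / 2) / n := by
    field_simp
  rw [e, Real.norm_eq_abs, abs_div, abs_of_pos hn']
  exact div_le_div_of_nonneg_right (abs_half_sub_le n) hn'.le

/-- Reversing a pair turns the shift j into n - j, and two shifts below n/2 cannot add up to n. The
strict inequality matters for even n. -/
theorem cyclicPair_ne_swap {n : ℕ} {a b : ℕ × ℕ}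
    (ha : a ∈ (cyclicIndex n).filter (fun a => 2 * a.2 < n))
    (hb : b ∈ (cyclicIndex n).filter (fun a => 2 * a.2 < n)) :
    cyclicPair n a ≠ (cyclicPair n b).swap := by
  simp only [cyclicIndex, Finset.mem_filter, Finset.mem_product, Finset.mem_range,
    Finset.mem_Icc] at ha hb
  intro h
  simp only [cyclicPair, Prod.swap_prod_mk, Prod.mk.injEq] at h
  obtain ⟨h1, h2⟩ := h
  rw [add_mod_eq_ite hb.1.1 (by omega)] at h1
  rw [add_mod_eq_ite ha.1.1 (by omega)] at h2
  split_ifs at h1 h2 <;> omega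

theorem card_cyclicIndex_filter (n : ℕ) :
    ((cyclicIndex n).filter fun a => 2 * a.2 < n).card = n * ((n - 1) / 2) := by
  have : (cyclicIndex n).filter (fun a => 2 * a.2 < n)
      = Finset.range n ×ˢ Finset.Icc 1 ((n - 1) / 2) := by
    ext a
    simp only [cyclicIndex, Finset.mem_filter, Finset.mem_product, Finset.mem_range,
      Finset.mem_Icc]
    omega
  rw [this, Finset.card_product, Finset.card_range, Nat.card_Icc]
  simp

/-- All summands are orthogonal, so only their number and the norm of g count. Up to a factor
depending on n the map from canonical kernels to statistics is an isometry, which makes kernel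
approximation uniform in n. -/
theorem integral_cyclicU_sq (hX : ∀ i, HasLaw (X i) ν P) (hind : iIndepFun X P)
    {g : 𝓧 → 𝓧 → ℝ} (hg : IsCanonical g ν) (n : ℕ) :
    ∫ ω, cyclicU g X n ω ^ 2 ∂P
      = (n : ℝ) * ((n - 1) / 2 : ℕ) * ∫ p, g p.1 p.2 ^ 2 ∂(ν.prod ν) := by
  have h := integral_weighted_kernel_sum_sq hX hind hg
    ((cyclicIndex n).filter fun a => 2 * a.2 < n) (cyclicPair n) (fun _ => 1)
    (fun a ha => cyclicPair_ne (Finset.mem_filter.1 ha).1)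
    ((cyclicPair_injOn n).mono fun a ha => (Finset.mem_filter.1 ha).1)
    (fun a ha b hb => cyclicPair_ne_swap ha hb)
  simp only [cyclicU_eq_sum]
  rw [h]
  simp [card_cyclicIndex_filter]

theorem integral_cyclicU_eq_zero (hX : ∀ i, HasLaw (X i) ν P) (hind : iIndepFun X P)
    {g : 𝓧 → 𝓧 → ℝ} (hg : IsCanonical g ν) (n : ℕ) : ∫ ω, cyclicU g X n ω ∂P = 0 := by
  simp only [cyclicU_eq_sum]
  rw [integral_finsetSum _ fun a ha => ((memLp_kernel_pair hX hind
    (cyclicPair_ne (Finset.mem_filter.1 ha).1) hg.memLp).integrable (by norm_num)).const_mul 1]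
  refine Finset.sum_eq_zero fun a ha => ?_
  rw [integral_const_mul,
    integral_kernel_pair_eq_zero hX hind hg (cyclicPair_ne (Finset.mem_filter.1 ha).1), mul_zero]

theorem integral_fun_mul_cyclicU_eq_zero (hX : ∀ i, HasLaw (X i) ν P) (hind : iIndepFun X P)
    {g : 𝓧 → 𝓧 → ℝ} (hg : IsCanonical g ν) {φ : 𝓧 → ℝ} (hφ : Measurable φ) (hφ2 : MemLp φ 2 ν)
    (i n : ℕ) : ∫ ω, φ (X i ω) * cyclicU g X n ω ∂P = 0 := by
  simp only [cyclicU_eq_sum, Finset.mul_sum, one_mul]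
  have hi : ∀ a ∈ (cyclicIndex n).filter (fun a => 2 * a.2 < n), Integrable
      (fun ω => φ (X i ω) * g (X (cyclicPair n a).1 ω) (X (cyclicPair n a).2 ω)) P := fun a ha =>
    (memLp_comp_of_hasLaw (hX i) hφ2).integrable_mul
      (memLp_kernel_pair hX hind (cyclicPair_ne (Finset.mem_filter.1 ha).1) hg.memLp)
  rw [integral_finsetSum _ hi]
  exact Finset.sum_eq_zero fun a ha =>
    integral_fun_mul_kernel_eq_zero hX hind hg hφ hφ2 i (cyclicPair_ne (Finset.mem_filter.1 ha).1)

theorem integral_sum_fun_sq (hX : ∀ i, HasLaw (X i) ν P) (hind : iIndepFun X P)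
    {φ : 𝓧 → ℝ} (hφ : Measurable φ) (hφ2 : MemLp φ 2 ν) (h0 : ∫ x, φ x ∂ν = 0) (n : ℕ) :
    ∫ ω, (∑ i ∈ Finset.range n, φ (X i ω)) ^ 2 ∂P = n * ∫ x, φ x ^ 2 ∂ν := by
  have hE : ∀ i, ∫ ω, φ (X i ω) ∂P = 0 := fun i => by
    rw [← h0]
    exact (hX i).integral_comp hφ.aestronglyMeasurable
  have hE2 : ∀ i, ∫ ω, φ (X i ω) ^ 2 ∂P = ∫ x, φ x ^ 2 ∂ν := fun i =>
    (hX i).integral_comp (f := fun x => φ x ^ 2) (hφ.pow_const 2).aestronglyMeasurable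
  rw [integral_sum_sq_of_pairwise_orthogonal (Finset.range n)
    (fun i _ => memLp_comp_of_hasLaw (hX i) hφ2)]
  · simp [hE2]
  · intro i _ j _ hij
    have := (hind.indepFun hij).comp hφ hφ
    have h2 := this.integral_fun_mul_eq_mul_integral
      (memLp_comp_of_hasLaw (hX i) hφ2).1 (memLp_comp_of_hasLaw (hX j) hφ2).1
    simp only [Function.comp_def] at h2
    rw [h2, hE, zero_mul]

theorem memLp_sum_fun (hX : ∀ i, HasLaw (X i) ν P) {φ : 𝓧 → ℝ} (hφ2 : MemLp φ 2 ν) (n : ℕ) :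
    MemLp (fun ω => ∑ i ∈ Finset.range n, φ (X i ω)) 2 P :=
  memLp_finsetSum _ fun i _ => memLp_comp_of_hasLaw (hX i) hφ2

theorem integral_cyclicU (hX : ∀ i, HasLaw (X i) ν P) (hind : iIndepFun X P)
    (hfm : Measurable (Function.uncurry f)) (hf : MemLp (Function.uncurry f) 2 (ν.prod ν)) (n : ℕ) :
    ∫ ω, cyclicU f X n ω ∂P = (n : ℝ) * ((n - 1) / 2 : ℕ) * kernelMean f ν := by
  have hg := isCanonical_proj₁₂ hfm hf
  have hH2 := (memLp_proj₁ hf).add (memLp_proj₂ hf)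
  have hHm := (measurable_proj₁ hfm (ν := ν)).add (measurable_proj₂ hfm (ν := ν))
  have hV := (memLp_cyclicU hX hind hg.memLp n).integrable (q := 2) (by norm_num)
  have hHi : ∀ i, Integrable (fun ω => proj₁ f ν (X i ω) + proj₂ f ν (X i ω)) P := fun i =>
    (memLp_comp_of_hasLaw (hX i) hH2).integrable (by norm_num)
  have hE : ∀ i, ∫ ω, (proj₁ f ν (X i ω) + proj₂ f ν (X i ω)) ∂P = 0 := fun i => by
    have := (hX i).integral_comp (f := fun x => proj₁ f ν x + proj₂ f ν x) hHm.aestronglyMeasurable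
    simp only [Function.comp_def] at this
    rw [this, integral_add ((memLp_proj₁ hf).integrable (by norm_num))
      ((memLp_proj₂ hf).integrable (by norm_num)), integral_proj₁ hf, integral_proj₂ hf, add_zero]
  simp only [cyclicU_hoeffding (ν := ν) f X n]
  have i1 : Integrable (fun ω => (((n - 1) / 2 : ℕ) : ℝ)
      * ∑ i ∈ Finset.range n, (proj₁ f ν (X i ω) + proj₂ f ν (X i ω))) P :=
    (integrable_finsetSum _ fun i _ => hHi i).const_mul _
  have i2 : Integrable (fun ω => (n : ℝ) * ((n - 1) / 2 : ℕ) * kernelMean f ν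
      + (((n - 1) / 2 : ℕ) : ℝ)
      * ∑ i ∈ Finset.range n, (proj₁ f ν (X i ω) + proj₂ f ν (X i ω))) P :=
    (integrable_const _).add i1
  have hS : ∫ ω, (((n - 1) / 2 : ℕ) : ℝ)
      * ∑ i ∈ Finset.range n, (proj₁ f ν (X i ω) + proj₂ f ν (X i ω)) ∂P = 0 := by
    rw [integral_const_mul, integral_finsetSum _ fun i _ => hHi i]
    simp [hE]
  rw [integral_add i2 hV, integral_add (integrable_const _) i1, hS,
    integral_cyclicU_eq_zero hX hind hg]
  simp

/-- The linear and the canonical part are orthogonal. The coefficient c is free because two values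
are used: m = ⌊(n-1)/2⌋ for the variance, and m - n/2 for the error in the central limit theorem. -/
theorem integral_linear_add_cyclicU_sq (hX : ∀ i, HasLaw (X i) ν P) (hind : iIndepFun X P)
    {φ : 𝓧 → ℝ} (hφ : Measurable φ) (hφ2 : MemLp φ 2 ν) (h0 : ∫ x, φ x ∂ν = 0)
    {g : 𝓧 → 𝓧 → ℝ} (hg : IsCanonical g ν) (c : ℝ) (n : ℕ) :
    ∫ ω, (c * ∑ i ∈ Finset.range n, φ (X i ω) + cyclicU g X n ω) ^ 2 ∂P
      = c ^ 2 * n * ∫ x, φ x ^ 2 ∂ν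
        + (n : ℝ) * ((n - 1) / 2 : ℕ) * ∫ p, g p.1 p.2 ^ 2 ∂(ν.prod ν) := by
  have hV := memLp_cyclicU hX hind hg.memLp n
  have hS := memLp_sum_fun hX hφ2 n
  have hcross : ∫ ω, (∑ i ∈ Finset.range n, φ (X i ω)) * cyclicU g X n ω ∂P = 0 := by
    simp only [Finset.sum_mul]
    have hi : ∀ i ∈ Finset.range n, Integrable (fun ω => φ (X i ω) * cyclicU g X n ω) P :=
      fun i _ => (memLp_comp_of_hasLaw (hX i) hφ2).integrable_mul hV
    rw [integral_finsetSum _ hi]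
    exact Finset.sum_eq_zero fun i _ => integral_fun_mul_cyclicU_eq_zero hX hind hg hφ hφ2 i n
  have i1 : Integrable (fun ω => c ^ 2 * (∑ i ∈ Finset.range n, φ (X i ω)) ^ 2) P :=
    hS.integrable_sq.const_mul _
  have i2 : Integrable (fun ω => 2 * c * ((∑ i ∈ Finset.range n, φ (X i ω))
      * cyclicU g X n ω)) P := (hS.integrable_mul hV).const_mul _
  have i12 : Integrable (fun ω => c ^ 2 * (∑ i ∈ Finset.range n, φ (X i ω)) ^ 2
      + 2 * c * ((∑ i ∈ Finset.range n, φ (X i ω)) * cyclicU g X n ω)) P := i1.add i2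
  have e : ∀ ω, (c * ∑ i ∈ Finset.range n, φ (X i ω) + cyclicU g X n ω) ^ 2
      = c ^ 2 * (∑ i ∈ Finset.range n, φ (X i ω)) ^ 2
      + 2 * c * ((∑ i ∈ Finset.range n, φ (X i ω)) * cyclicU g X n ω) + cyclicU g X n ω ^ 2 :=
    fun ω => by ring
  simp only [e]
  rw [integral_add i12 hV.integrable_sq, integral_add i1 i2, integral_const_mul, integral_const_mul,
    hcross, integral_cyclicU_sq hX hind hg, integral_sum_fun_sq hX hind hφ hφ2 h0]
  ring

theorem measurable_proj_add (hfm : Measurable (Function.uncurry f)) :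
    Measurable fun x => proj₁ f ν x + proj₂ f ν x :=
  (measurable_proj₁ hfm).add (measurable_proj₂ hfm)

theorem memLp_proj_add (hf : MemLp (Function.uncurry f) 2 (ν.prod ν)) :
    MemLp (fun x => proj₁ f ν x + proj₂ f ν x) 2 ν :=
  (memLp_proj₁ hf).add (memLp_proj₂ hf)

theorem integral_proj_add (hf : MemLp (Function.uncurry f) 2 (ν.prod ν)) :
    ∫ x, (proj₁ f ν x + proj₂ f ν x) ∂ν = 0 := by
  rw [integral_add ((memLp_proj₁ hf).integrable (by norm_num))
    ((memLp_proj₂ hf).integrable (by norm_num)), integral_proj₁ hf, integral_proj₂ hf, add_zero]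

theorem variance_proj_add (hf : MemLp (Function.uncurry f) 2 (ν.prod ν)) :
    Var[fun x => proj₁ f ν x + proj₂ f ν x; ν] = ∫ x, (proj₁ f ν x + proj₂ f ν x) ^ 2 ∂ν :=
  variance_of_integral_eq_zero (memLp_proj_add hf).1.aemeasurable (integral_proj_add hf)

theorem variance_kernel_pair (hX : ∀ i, HasLaw (X i) ν P) (hind : iIndepFun X P)
    {g : 𝓧 → 𝓧 → ℝ} (hg : IsCanonical g ν) :
    Var[fun ω => g (X 0 ω) (X 1 ω); P] = ∫ p, g p.1 p.2 ^ 2 ∂(ν.prod ν) := by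
  rw [variance_of_integral_eq_zero
    (memLp_kernel_pair hX hind zero_ne_one hg.memLp).1.aemeasurable
    (integral_kernel_pair_eq_zero hX hind hg zero_ne_one)]
  exact integral_kernel_pair hX hind zero_ne_one (G := fun p => g p.1 p.2 ^ 2)
    (hg.memLp.1.pow 2)

/-- The variance of the cyclic U-statistic. -/
theorem variance_cyclicU (hX : ∀ i, HasLaw (X i) ν P) (hind : iIndepFun X P)
    (hfm : Measurable (Function.uncurry f)) (hf : MemLp (Function.uncurry f) 2 (ν.prod ν)) (n : ℕ) :
    Var[cyclicU f X n; P] = (((n - 1) / 2 : ℕ) : ℝ) ^ 2 * n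
        * Var[fun x => proj₁ f ν x + proj₂ f ν x; ν]
      + (n : ℝ) * ((n - 1) / 2 : ℕ) * Var[fun ω => proj₁₂ f ν (X 0 ω) (X 1 ω); P] := by
  have hg := isCanonical_proj₁₂ hfm hf
  rw [variance_eq_integral (memLp_cyclicU hX hind hf n).1.aemeasurable,
    integral_cyclicU hX hind hfm hf, variance_kernel_pair hX hind hg, variance_proj_add hf,
    ← integral_linear_add_cyclicU_sq hX hind (measurable_proj_add hfm) (memLp_proj_add hf)
      (integral_proj_add hf) hg]
  refine integral_congr_ae (Eventually.of_forall fun ω => ?_)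
  simp only [cyclicU_hoeffding (ν := ν) f X n]
  ring

theorem isBigO_mul_half_sub (c : ℝ) : (fun n : ℕ => (n : ℝ) * ((n - 1) / 2 : ℕ) * c
    - (n : ℝ) ^ 2 / 2 * c) =O[atTop] (fun n : ℕ => (n : ℝ)) := by
  refine Asymptotics.IsBigO.of_bound |c| (Eventually.of_forall fun n => ?_)
  rw [← sub_mul, norm_mul, Real.norm_eq_abs, Real.norm_eq_abs, Real.norm_eq_abs, mul_comm,
    abs_of_nonneg (Nat.cast_nonneg n : (0 : ℝ) ≤ n)]
  exact mul_le_mul_of_nonneg_left (abs_mul_half_sub_le n) (abs_nonneg c)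

theorem rpow_neg_three (n : ℕ) : (n : ℝ) ^ (-3 : ℝ) = ((n : ℝ) ^ 3)⁻¹ := by
  rw [Real.rpow_neg (Nat.cast_nonneg n)]
  norm_cast

theorem tendsto_variance_cyclicU (hX : ∀ i, HasLaw (X i) ν P) (hind : iIndepFun X P)
    (hfm : Measurable (Function.uncurry f)) (hf : MemLp (Function.uncurry f) 2 (ν.prod ν)) :
    Tendsto (fun n : ℕ => (n : ℝ) ^ (-3 : ℝ) * Var[cyclicU f X n; P]) atTop
      (𝓝 (1 / 4 * Var[fun x => proj₁ f ν x + proj₂ f ν x; ν])) := by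
  have h1 := (tendsto_half_div.pow 2).mul_const Var[fun x => proj₁ f ν x + proj₂ f ν x; ν]
  have h2 := (tendsto_half_div.mul tendsto_one_div_atTop_nhds_zero_nat).mul_const
    Var[fun ω => proj₁₂ f ν (X 0 ω) (X 1 ω); P]
  have h3 := h1.add h2
  rw [show (1 / 2 : ℝ) ^ 2 * Var[fun x => proj₁ f ν x + proj₂ f ν x; ν] + 1 / 2 * 0
    * Var[fun ω => proj₁₂ f ν (X 0 ω) (X 1 ω); P]
    = 1 / 4 * Var[fun x => proj₁ f ν x + proj₂ f ν x; ν] by ring] at h3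
  refine h3.congr' ?_
  filter_upwards [eventually_gt_atTop 0] with n hn
  have hn' : (n : ℝ) ≠ 0 := by positivity
  rw [variance_cyclicU hX hind hfm hf, rpow_neg_three]
  field_simp

theorem eLpNorm_two_eq_sqrt {α : Type*} [MeasurableSpace α] {m : Measure α} {Y : α → ℝ}
    (hY : MemLp Y 2 m) : eLpNorm Y 2 m = ENNReal.ofReal √(∫ a, Y a ^ 2 ∂m) := by
  rw [hY.eLpNorm_eq_integral_rpow_norm (by norm_num) (by norm_num), Real.sqrt_eq_rpow]
  norm_num

theorem tendstoInMeasure_of_integral_sq {Y : ℕ → Ω → ℝ} {c : ℝ} (hY : ∀ n, MemLp (Y n) 2 P)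
    (h : Tendsto (fun n => ∫ ω, (Y n ω - c) ^ 2 ∂P) atTop (𝓝 0)) :
    TendstoInMeasure P Y atTop fun _ => c := by
  refine tendstoInMeasure_of_tendsto_eLpNorm (p := 2) (by norm_num) (fun n => (hY n).1)
    aestronglyMeasurable_const ?_
  have h1 : ∀ n, eLpNorm (Y n - fun _ => c) 2 P = ENNReal.ofReal √(∫ ω, (Y n ω - c) ^ 2 ∂P) :=
    fun n => eLpNorm_two_eq_sqrt ((hY n).sub (memLp_const c))
  simp only [h1]
  have := (ENNReal.continuous_ofReal.tendsto _).comp h.sqrt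
  simpa [Function.comp_def] using this

/-- The weak law of large numbers for the cyclic U-statistic. -/
theorem tendstoInMeasure_cyclicU (hX : ∀ i, HasLaw (X i) ν P) (hind : iIndepFun X P)
    (hfm : Measurable (Function.uncurry f)) (hf : MemLp (Function.uncurry f) 2 (ν.prod ν)) :
    TendstoInMeasure P (fun (n : ℕ) ω => 2 / (n : ℝ) ^ 2 * cyclicU f X n ω) atTop
      (fun _ => kernelMean f ν) := by
  refine tendstoInMeasure_of_integral_sq (fun n => (memLp_cyclicU hX hind hf n).const_mul _) ?_
  have hvar : ∀ n : ℕ, ∫ ω, (2 / (n : ℝ) ^ 2 * cyclicU f X n ω - kernelMean f ν) ^ 2 ∂P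
      = (2 / (n : ℝ) ^ 2) ^ 2 * Var[cyclicU f X n; P]
        + (2 / (n : ℝ) ^ 2 * ((n : ℝ) * ((n - 1) / 2 : ℕ) * kernelMean f ν) - kernelMean f ν) ^ 2 := by
    intro n
    have hU := memLp_cyclicU hX hind hf n
    have h1 : MemLp (fun ω => 2 / (n : ℝ) ^ 2 * cyclicU f X n ω - kernelMean f ν) 2 P :=
      (hU.const_mul _).sub (memLp_const _)
    have h2 := variance_eq_sub h1
    have h3 : Var[fun ω => 2 / (n : ℝ) ^ 2 * cyclicU f X n ω - kernelMean f ν; P]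
        = (2 / (n : ℝ) ^ 2) ^ 2 * Var[cyclicU f X n; P] := by
      rw [variance_sub_const (hU.const_mul (2 / (n : ℝ) ^ 2)).1, variance_const_mul]
    have h4 : ∫ ω, (2 / (n : ℝ) ^ 2 * cyclicU f X n ω - kernelMean f ν) ∂P
        = 2 / (n : ℝ) ^ 2 * ((n : ℝ) * ((n - 1) / 2 : ℕ) * kernelMean f ν) - kernelMean f ν := by
      rw [integral_sub ((hU.integrable (by norm_num)).const_mul _) (integrable_const _),
        integral_const_mul, integral_cyclicU hX hind hfm hf]
      simp
    rw [h3, h4] at h2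
    simp only [Pi.pow_apply] at h2
    linarith
  simp only [hvar]
  -- The variance is O(n³) against the normalization n⁴; the other term is the squared bias, which
  -- tends to zero because m/n tends to 1/2.
  have h1 := ((tendsto_variance_cyclicU hX hind hfm hf).mul
    tendsto_one_div_atTop_nhds_zero_nat).const_mul 4
  have h2 := ((((tendsto_half_div.const_mul 2).mul_const (kernelMean f ν)).sub_const
    (kernelMean f ν))).pow 2
  have h3 := h1.add h2
  rw [show 4 * (1 / 4 * Var[fun x => proj₁ f ν x + proj₂ f ν x; ν] * 0)
    + (2 * (1 / 2) * kernelMean f ν - kernelMean f ν) ^ 2 = 0 by ring] at h3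
  refine h3.congr' ?_
  filter_upwards [eventually_gt_atTop 0] with n hn
  have hn' : (n : ℝ) ≠ 0 := by positivity
  rw [rpow_neg_three]
  field_simp
  ring

theorem rpow_neg_three_halves (n : ℕ) : (n : ℝ) ^ (-(3 / 2) : ℝ) = (√(n : ℝ))⁻¹ * (n : ℝ)⁻¹ := by
  rcases Nat.eq_zero_or_pos n with rfl | hn
  · norm_num
  have hn' : (0 : ℝ) < n := by exact_mod_cast hn
  rw [show (-(3 / 2) : ℝ) = -(1 / 2) + -1 by norm_num, Real.rpow_add hn', Real.rpow_neg hn'.le,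
    Real.rpow_neg_one, Real.sqrt_eq_rpow]

/-- Replacing ⌊(n-1)/2⌋ by n/2 leaves a rounding error in the mean and one in the linear part; the
canonical part is the third error. Their sum has second moment O(n²), while the squared
normalization is n⁻³. -/
theorem cyclicU_sub_linear_eq (f : 𝓧 → 𝓧 → ℝ) (X : ℕ → Ω → 𝓧) {n : ℕ} (hn : 0 < n) (ω : Ω) :
    (n : ℝ) ^ (-(3 / 2) : ℝ) * (cyclicU f X n ω - (n : ℝ) ^ 2 / 2 * kernelMean f ν)
        - (√(n : ℝ))⁻¹ * ∑ i ∈ Finset.range n, 1 / 2 * (proj₁ f ν (X i ω) + proj₂ f ν (X i ω))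
      = (√(n : ℝ))⁻¹ * (n : ℝ)⁻¹ * (((n : ℝ) * ((n - 1) / 2 : ℕ) - (n : ℝ) ^ 2 / 2) * kernelMean f ν
        + (((((n - 1) / 2 : ℕ) : ℝ) - n / 2) * ∑ i ∈ Finset.range n,
          (proj₁ f ν (X i ω) + proj₂ f ν (X i ω)) + cyclicU (proj₁₂ f ν) X n ω)) := by
  have hn' : (n : ℝ) ≠ 0 := by positivity
  rw [rpow_neg_three_halves, cyclicU_hoeffding (ν := ν) f X n ω, ← Finset.mul_sum]
  generalize ∑ i ∈ Finset.range n, (proj₁ f ν (X i ω) + proj₂ f ν (X i ω)) = S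
  generalize cyclicU (proj₁₂ f ν) X n ω = V
  generalize (((n - 1) / 2 : ℕ) : ℝ) = m
  generalize (√(n : ℝ))⁻¹ = s
  field_simp
  ring

theorem integral_const_add_sq_le {R : Ω → ℝ} (hR : MemLp R 2 P) (c : ℝ) :
    ∫ ω, (c + R ω) ^ 2 ∂P ≤ 2 * c ^ 2 + 2 * ∫ ω, R ω ^ 2 ∂P := by
  have hRi : Integrable (fun ω => 2 * R ω ^ 2) P := hR.integrable_sq.const_mul 2
  have j1 : MemLp (fun ω => c + R ω) 2 P := (memLp_const c).add hR
  have j2 : Integrable (fun ω => 2 * c ^ 2 + 2 * R ω ^ 2) P := (integrable_const _).add hRi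
  have h := integral_mono j1.integrable_sq j2 fun ω => by
    simp only
    nlinarith [sq_nonneg (c - R ω)]
  rw [integral_add (integrable_const _) hRi, integral_const_mul 2 fun ω => R ω ^ 2] at h
  simpa using h

/-- The arithmetic of the error bound, with m in the role of ⌊(n-1)/2⌋: each of the mean, linear and
canonical errors is bounded by a constant times n². -/
theorem linear_error_le {n m μ v C : ℝ} (hn : 1 ≤ n) (hm1 : |m - n / 2| ≤ 1) (hm2 : m ≤ n / 2)
    (hm3 : |n * m - n ^ 2 / 2| ≤ n) (hv : 0 ≤ v) (hC : 0 ≤ C) :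
    2 * ((n * m - n ^ 2 / 2) * μ) ^ 2 + 2 * ((m - n / 2) ^ 2 * n * v + n * m * C)
      ≤ 2 * (μ ^ 2 + v + C) * n ^ 2 := by
  have h6 : (n * m - n ^ 2 / 2) ^ 2 ≤ n ^ 2 :=
    sq_le_sq' (by linarith [(abs_le.1 hm3).1]) (abs_le.1 hm3).2
  have h7 : (m - n / 2) ^ 2 ≤ 1 := by
    rw [sq_le_one_iff_abs_le_one]
    exact hm1
  have a1 : ((n * m - n ^ 2 / 2) * μ) ^ 2 ≤ n ^ 2 * μ ^ 2 := by
    rw [mul_pow]; exact mul_le_mul_of_nonneg_right h6 (sq_nonneg _)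
  have a2 : (m - n / 2) ^ 2 * n * v ≤ n ^ 2 * v := by
    refine mul_le_mul_of_nonneg_right ?_ hv
    nlinarith
  have a3 : n * m * C ≤ n ^ 2 * C := by
    refine mul_le_mul_of_nonneg_right ?_ hC
    nlinarith
  linarith

/-- The cyclic U-statistic is close to a linear statistic in mean square. -/
theorem integral_cyclicU_sub_linear_sq_le (hX : ∀ i, HasLaw (X i) ν P) (hind : iIndepFun X P)
    (hfm : Measurable (Function.uncurry f)) (hf : MemLp (Function.uncurry f) 2 (ν.prod ν)) {n : ℕ}
    (hn : 0 < n) :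
    ∫ ω, ((n : ℝ) ^ (-(3 / 2) : ℝ) * (cyclicU f X n ω - (n : ℝ) ^ 2 / 2 * kernelMean f ν)
        - (√(n : ℝ))⁻¹ * ∑ i ∈ Finset.range n,
          1 / 2 * (proj₁ f ν (X i ω) + proj₂ f ν (X i ω))) ^ 2 ∂P
      ≤ 2 * (kernelMean f ν ^ 2 + ∫ x, (proj₁ f ν x + proj₂ f ν x) ^ 2 ∂ν
        + ∫ p, proj₁₂ f ν p.1 p.2 ^ 2 ∂(ν.prod ν)) * (1 / (n : ℝ)) := by
  have hg := isCanonical_proj₁₂ hfm hf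
  have hH2 := memLp_proj_add hf
  have hR2 := integral_linear_add_cyclicU_sq hX hind (measurable_proj_add hfm) hH2
    (integral_proj_add hf) hg ((((n - 1) / 2 : ℕ) : ℝ) - n / 2) n
  have hRm : MemLp (fun ω => ((((n - 1) / 2 : ℕ) : ℝ) - n / 2) * ∑ i ∈ Finset.range n,
      (proj₁ f ν (X i ω) + proj₂ f ν (X i ω)) + cyclicU (proj₁₂ f ν) X n ω) 2 P :=
    ((memLp_sum_fun hX hH2 n).const_mul _).add (memLp_cyclicU hX hind hg.memLp n)
  have h5 := integral_const_add_sq_le hRm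
    (((n : ℝ) * ((n - 1) / 2 : ℕ) - (n : ℝ) ^ 2 / 2) * kernelMean f ν)
  rw [hR2] at h5
  have hn' : (0 : ℝ) < n := by exact_mod_cast hn
  have h8 := linear_error_le (n := n) (μ := kernelMean f ν) (by exact_mod_cast hn)
    (abs_half_sub_le n) (half_le n) (abs_mul_half_sub_le n)
    (integral_nonneg (μ := ν) fun x => sq_nonneg (proj₁ f ν x + proj₂ f ν x))
    (integral_nonneg (μ := ν.prod ν) fun p : 𝓧 × 𝓧 => sq_nonneg (proj₁₂ f ν p.1 p.2))
  have hsq : √(n : ℝ) ^ 2 = n := Real.sq_sqrt hn'.le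
  simp only [cyclicU_sub_linear_eq f X hn, mul_pow ((√(n : ℝ))⁻¹ * (n : ℝ)⁻¹)]
  rw [integral_const_mul, mul_pow, inv_pow, hsq]
  refine (mul_le_mul_of_nonneg_left (h5.trans h8) (by positivity)).trans (le_of_eq ?_)
  field_simp

/-- The central limit theorem for the cyclic U-statistic. -/
theorem tendstoInDistribution_cyclicU (hX : ∀ i, HasLaw (X i) ν P) (hind : iIndepFun X P)
    (hfm : Measurable (Function.uncurry f)) (hf : MemLp (Function.uncurry f) 2 (ν.prod ν)) :
    TendstoInDistribution (fun (n : ℕ) ω =>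
        (n : ℝ) ^ (-(3 / 2) : ℝ) * (cyclicU f X n ω - (n : ℝ) ^ 2 / 2 * kernelMean f ν))
      atTop (id : ℝ → ℝ) (fun _ => P)
      (gaussianReal 0 (1 / 4 * Var[fun x => proj₁ f ν x + proj₂ f ν x; ν]).toNNReal) := by
  have hHm := measurable_proj_add (ν := ν) hfm
  have hH2 := memLp_proj_add hf
  have hUm : ∀ n : ℕ, MemLp (fun ω => (n : ℝ) ^ (-(3 / 2) : ℝ)
      * (cyclicU f X n ω - (n : ℝ) ^ 2 / 2 * kernelMean f ν)) 2 P := fun n =>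
    ((memLp_cyclicU hX hind hf n).sub (memLp_const ((n : ℝ) ^ 2 / 2 * kernelMean f ν))).const_mul _
  have hv0 := variance_nonneg (fun x => proj₁ f ν x + proj₂ f ν x) ν
  have hv := variance_proj_add hf
  generalize Var[fun x => proj₁ f ν x + proj₂ f ν x; ν] = v at *
  refine tendstoInDistribution_of_tendsto_integral_cexp (fun n => (hUm n).1.aemeasurable)
    aemeasurable_id fun ξ => ?_
  have hlim : ∫ z : ℝ, Complex.exp ((inner ℝ (id z) ξ : ℝ) * Complex.I)
      ∂(gaussianReal 0 (1 / 4 * v).toNNReal) = Complex.exp (-((ξ ^ 2 * v / 4 : ℝ) : ℂ) / 2) := by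
    have h1 := charFun_gaussianReal (μ := 0) (v := (1 / 4 * v).toNNReal) ξ
    rw [charFun_apply] at h1
    simp only [id]
    rw [h1, Real.coe_toNNReal _ (by positivity)]
    congr 1
    push_cast
    ring
  rw [hlim]
  have hmain := tendsto_integral_cexp_triangular hX hind
    (ψ := fun _ _ x => ξ * (1 / 2 * (proj₁ f ν x + proj₂ f ν x)))
    (G := fun x => |ξ * (1 / 2 * (proj₁ f ν x + proj₂ f ν x))|)
    (fun _ _ => (hHm.const_mul _).const_mul _)
    ((hH2.const_mul _).const_mul _).abs (fun _ _ _ => le_rfl) (fun _ _ => by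
      rw [integral_const_mul, integral_const_mul, integral_proj_add hf, mul_zero, mul_zero])
    (s := ξ ^ 2 * v / 4) (by
      refine tendsto_const_nhds.congr' ?_
      filter_upwards [eventually_gt_atTop 0] with n hn
      have hn' : (n : ℝ) ≠ 0 := by positivity
      simp only [mul_pow, integral_const_mul, Finset.sum_const, Finset.card_range, nsmul_eq_mul,
        ← hv]
      field_simp
      ring)
  have hbound := fun (n : ℕ) (hn : 0 < n) => integral_cyclicU_sub_linear_sq_le hX hind hfm hf hn
  generalize 2 * (kernelMean f ν ^ 2 + ∫ x, (proj₁ f ν x + proj₂ f ν x) ^ 2 ∂ν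
        + ∫ p, proj₁₂ f ν p.1 p.2 ^ 2 ∂(ν.prod ν)) = C at hbound
  have hdiff : Tendsto (fun n : ℕ => ∫ ω, Complex.exp ((inner ℝ ((n : ℝ) ^ (-(3 / 2) : ℝ)
          * (cyclicU f X n ω - (n : ℝ) ^ 2 / 2 * kernelMean f ν)) ξ : ℝ) * Complex.I) ∂P
        - ∫ ω, Complex.exp (((√(n : ℝ))⁻¹ * ∑ i ∈ Finset.range n,
          ξ * (1 / 2 * (proj₁ f ν (X i ω) + proj₂ f ν (X i ω))) : ℝ) * Complex.I) ∂P) atTop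
        (𝓝 0) := by
    have hb0 : Tendsto (fun n : ℕ => √(ξ ^ 2 * (C * (1 / (n : ℝ))))) atTop (𝓝 0) := by
      have := ((tendsto_one_div_atTop_nhds_zero_nat.const_mul C).const_mul (ξ ^ 2)).sqrt
      simpa using this
    refine squeeze_zero_norm' ?_ hb0
    filter_upwards [eventually_gt_atTop 0] with n hn
    have hZ : MemLp (fun ω => (√(n : ℝ))⁻¹ * ∑ i ∈ Finset.range n,
        ξ * (1 / 2 * (proj₁ f ν (X i ω) + proj₂ f ν (X i ω)))) 2 P :=
      (memLp_sum_fun hX ((hH2.const_mul (1 / 2)).const_mul ξ) n).const_mul _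
    have hY : MemLp (fun ω => inner ℝ ((n : ℝ) ^ (-(3 / 2) : ℝ)
          * (cyclicU f X n ω - (n : ℝ) ^ 2 / 2 * kernelMean f ν)) ξ) 2 P := by
      refine ((hUm n).const_mul ξ).ae_eq (Eventually.of_forall fun ω => ?_)
      simp
    refine (norm_integral_cexp_sub_cexp_le hY hZ).trans (Real.sqrt_le_sqrt ?_)
    refine le_trans (le_of_eq ?_) (mul_le_mul_of_nonneg_left (hbound n hn) (sq_nonneg ξ))
    rw [← integral_const_mul]
    refine integral_congr_ae (Eventually.of_forall fun ω => ?_)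
    simp only [RCLike.inner_apply, conj_trivial]
    rw [← mul_pow, ← Finset.mul_sum]
    ring
  simpa using hdiff.add hmain

theorem variance_proj_add_eq (hf : MemLp (Function.uncurry f) 2 (ν.prod ν)) :
    1 / 4 * Var[fun x => proj₁ f ν x + proj₂ f ν x; ν]
      = 1 / 4 * (∫ x, proj₁ f ν x ^ 2 ∂ν + ∫ x, proj₂ f ν x ^ 2 ∂ν
          + 2 * ∫ x, proj₁ f ν x * proj₂ f ν x ∂ν) := by
  have h1 := memLp_proj₁ hf
  have h2 := memLp_proj₂ hf
  have i3 : Integrable (fun x => 2 * (proj₁ f ν x * proj₂ f ν x)) ν :=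
    (h1.integrable_mul h2).const_mul 2
  have i12 : Integrable (fun x => proj₁ f ν x ^ 2 + proj₂ f ν x ^ 2) ν :=
    h1.integrable_sq.add h2.integrable_sq
  rw [variance_proj_add hf, ← integral_const_mul 2, ← integral_add h1.integrable_sq h2.integrable_sq,
    ← integral_add i12 i3]
  congr 1
  exact integral_congr_ae (Eventually.of_forall fun x => by ring)

theorem variance_proj_add_pos_iff (hf : MemLp (Function.uncurry f) 2 (ν.prod ν)) :
    0 < 1 / 4 * Var[fun x => proj₁ f ν x + proj₂ f ν x; ν]
      ↔ ¬ ∀ᵐ x ∂ν, proj₁ f ν x + proj₂ f ν x = 0 := by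
  have h0 := variance_nonneg (fun x => proj₁ f ν x + proj₂ f ν x) ν
  have h1 : (∫ x, (proj₁ f ν x + proj₂ f ν x) ^ 2 ∂ν = 0)
      ↔ ∀ᵐ x ∂ν, proj₁ f ν x + proj₂ f ν x = 0 := by
    rw [integral_eq_zero_iff_of_nonneg (fun x => sq_nonneg _) (memLp_proj_add hf).integrable_sq]
    refine ⟨fun h => ?_, fun h => ?_⟩
    · filter_upwards [h] with x hx
      simpa using hx
    · filter_upwards [h] with x hx
      simp [hx]
  rw [← h1, ← variance_proj_add hf]
  constructor
  · intro h h'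
    rw [h'] at h
    simp at h
  · intro h
    have : 0 < Var[fun x => proj₁ f ν x + proj₂ f ν x; ν] := lt_of_le_of_ne h0 (Ne.symm h)
    positivity

end Hoeffding

/-! ### The stochastic area distribution -/

section AreaLaw

/-- The two coordinates on `ℝ × ℝ`, as a system indexed by one pair. -/
def planeCoord (i : Unit × Bool) (z : ℝ × ℝ) : ℝ := if i.2 then z.1 else z.2

theorem integral_sq_gaussianReal : ∫ x : ℝ, x ^ 2 ∂(gaussianReal 0 1) = 1 := by
  have h := variance_id_gaussianReal (μ := 0) (v := 1)
  rw [variance_of_integral_eq_zero aemeasurable_id (by simp [integral_id_gaussianReal])] at h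
  simpa using h

theorem isCentredSystem_planeCoord :
    IsCentredSystem planeCoord ((gaussianReal 0 1).prod (gaussianReal 0 1)) where
  measurable := by
    rintro ⟨_, _ | _⟩
    · exact measurable_snd
    · exact measurable_fst
  memLp := by
    rintro ⟨_, _ | _⟩
    · exact (memLp_id_gaussianReal 2).comp_snd (gaussianReal 0 1)
    · exact (memLp_id_gaussianReal 2).comp_fst (gaussianReal 0 1)
  integral_eq_zero := by
    rintro ⟨_, _ | _⟩
    · simp only [planeCoord, Bool.false_eq_true, if_false]
      rw [integral_fun_snd (fun x : ℝ => x)]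
      simp [integral_id_gaussianReal]
    · simp only [planeCoord, if_true]
      rw [integral_fun_fst (fun x : ℝ => x)]
      simp [integral_id_gaussianReal]
  integral_mul_self := by
    rintro ⟨_, _ | _⟩
    · simp only [planeCoord, Bool.false_eq_true, if_false]
      rw [integral_fun_snd (fun x : ℝ => x * x)]
      simp [← sq, integral_sq_gaussianReal]
    · simp only [planeCoord, if_true]
      rw [integral_fun_fst (fun x : ℝ => x * x)]
      simp [← sq, integral_sq_gaussianReal]
  integral_mul := by
    have h : ∫ z : ℝ × ℝ, z.1 * z.2 ∂((gaussianReal 0 1).prod (gaussianReal 0 1)) = 0 := by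
      rw [integral_prod_mul (fun x : ℝ => x) (fun x : ℝ => x)]
      simp [integral_id_gaussianReal]
    rintro ⟨_, _ | _⟩ ⟨_, _ | _⟩ hne
    · exact absurd rfl hne
    · simpa [planeCoord, mul_comm] using h
    · simpa [planeCoord] using h
    · exact absurd rfl hne

/-- Lévy's continuity theorem without a given limit law: continuity at 0 yields tightness,
Prokhorov's theorem a compact closure, and a nonprincipal ultrafilter on the indices picks a limit
without extracting a subsequence. -/
theorem exists_charFun_eq_of_tendsto {μ : ℕ → ProbabilityMeasure ℝ} {φ : ℝ → ℂ}
    (hφ : ContinuousAt φ 0)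
    (h : ∀ t, Tendsto (fun n => charFun (μ n : Measure ℝ) t) atTop (𝓝 (φ t))) :
    ∃ μ' : ProbabilityMeasure ℝ, ∀ t, charFun (μ' : Measure ℝ) t = φ t := by
  have ht : IsTightMeasureSet (Set.range fun n => (μ n : Measure ℝ)) :=
    isTightMeasureSet_of_tendsto_charFun hφ h
  have hK : IsCompact (closure (Set.range μ)) := by
    refine isCompact_closure_of_isTightMeasureSet ?_
    convert ht using 1
    ext m
    simp
  obtain ⟨μ', -, hμ'⟩ := hK.ultrafilter_le_nhds (Ultrafilter.map μ (hyperfilter ℕ))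
    (by
      rw [le_principal_iff]
      exact Ultrafilter.mem_map.2
        (Filter.univ_mem' fun n => subset_closure (Set.mem_range_self n)))
  refine ⟨μ', fun t => ?_⟩
  have h1 : Tendsto μ (hyperfilter ℕ : Filter ℕ) (𝓝 μ') := hμ'
  have h2 : Tendsto (fun n => charFun (μ n : Measure ℝ) t) (hyperfilter ℕ : Filter ℕ)
      (𝓝 (charFun (μ' : Measure ℝ) t)) := by
    rw [ProbabilityMeasure.tendsto_iff_forall_integral_rclike_tendsto ℂ] at h1
    simp_rw [charFun_eq_integral_innerProbChar]
    exact h1 _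
  exact tendsto_nhds_unique h2 ((h t).mono_left (Nat.hyperfilter_le_atTop))

/-- The law arises as a weak limit of the cyclic statistics of the area kernel x₁y₂ - x₂y₁ at
independent Gaussian points of the plane. This is a finite rank kernel with empty symmetric part and
one antisymmetric pair, so its limiting characteristic function is already known. -/
theorem exists_stochasticArea : ∃ μ : Measure ℝ, IsProbabilityMeasure μ ∧
    ∀ t : ℝ, charFun μ t = 1 / ((Real.cosh t : ℝ) : ℂ) := by
  obtain ⟨Ω, _, P, X, hXm, hX, hind, _⟩ :=
    exists_iid ℕ ((gaussianReal 0 1).prod (gaussianReal 0 1))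
  let e : Empty → ℝ × ℝ → ℝ := fun r => r.elim
  have he : IsCentredSystem e ((gaussianReal 0 1).prod (gaussianReal 0 1)) :=
    ⟨fun r => r.elim, fun r => r.elim, fun r => r.elim, fun r => r.elim, fun r => r.elim⟩
  let a : Empty → ℝ := fun r => r.elim
  let l : Unit → ℝ := fun _ => 1
  have hmem := memLp_cyclicU hX hind
    (isCanonical_finiteRankKernel he isCentredSystem_planeCoord a l).memLp
  have hlim := tendsto_integral_cexp_finiteRank hX hind he isCentredSystem_planeCoord a l
  set U : ℕ → Ω → ℝ := fun n ω =>
    (n : ℝ)⁻¹ * cyclicU (finiteRankKernel a e l planeCoord) X n ω with hU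
  have hUm : ∀ n, AEMeasurable (U n) P := fun n => (hmem n).1.aemeasurable.const_mul _
  obtain ⟨μ', h⟩ := exists_charFun_eq_of_tendsto
    (μ := fun n => ⟨P.map (U n), Measure.isProbabilityMeasure_map (hUm n)⟩)
    (φ := fun t => 1 / ((Real.cosh t : ℝ) : ℂ)) (by
      refine Continuous.continuousAt ?_
      refine continuous_const.div (Complex.continuous_ofReal.comp Real.continuous_cosh) fun t => ?_
      exact_mod_cast (Real.cosh_pos t).ne') (fun t => by
      have h1 := hlim t
      simp only [l, Finset.univ_eq_empty, Finset.prod_empty, one_mul, mul_one, Finset.univ_unique,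
        Finset.prod_singleton] at h1
      simp only [ProbabilityMeasure.coe_mk, charFun_apply_real]
      refine (h1.congr fun n => ?_).trans_eq ?_
      · rw [integral_map (hUm n) (by fun_prop)]
        simp [hU, l]
      · simp)
  exact ⟨μ', inferInstance, h⟩

theorem exists_isNormalAreaFamily (ι κ : Type) :
    ∃ (Ω' : Type) (_ : MeasurableSpace Ω') (P' : Measure Ω') (ζ : ι → Ω' → ℝ) (η : κ → Ω' → ℝ),
      IsProbabilityMeasure P' ∧ IsNormalAreaFamily P' ζ η := by
  obtain ⟨μ, hμ, hchar⟩ := exists_stochasticArea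
  let law : ι ⊕ κ → Measure ℝ := Sum.elim (fun _ => gaussianReal 0 1) (fun _ => μ)
  have hlaw : ∀ i, IsProbabilityMeasure (law i) := by
    rintro (i | i)
    · exact inferInstanceAs (IsProbabilityMeasure (gaussianReal 0 1))
    · exact hμ
  obtain ⟨Ω', _, P', X, -, hX, hind, hP⟩ := exists_hasLaw_indepFun (fun _ : ι ⊕ κ => ℝ) law
  refine ⟨Ω', _, P', fun r => X (Sum.inl r), fun q => X (Sum.inr q), hP,
    fun r => hX (Sum.inl r), fun q => ⟨(hX (Sum.inr q)).aemeasurable, fun t => ?_⟩, ?_⟩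
  · rw [(hX (Sum.inr q)).map_eq]
    exact hchar t
  · convert hind using 1
    exact Sum.elim_comp_inl_inr X

theorem tendsto_sin_div (x : ℝ) :
    Tendsto (fun n : ℕ => ((n : ℝ) + 1) * Real.sin ((1 / ((n : ℝ) + 1)) * x)) atTop (𝓝 x) := by
  have h0 : HasDerivAt (fun s => Real.sin (s * x)) x 0 := by
    simpa using ((hasDerivAt_id (0 : ℝ)).mul_const x).sin
  have h1 := h0.tendsto_slope_zero
  have h2 : Tendsto (fun n : ℕ => 1 / ((n : ℝ) + 1)) atTop (𝓝[≠] 0) :=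
    tendsto_nhdsWithin_iff.2 ⟨tendsto_one_div_add_atTop_nhds_zero_nat,
      Eventually.of_forall fun n => by simpa using (by positivity : ((n : ℝ) + 1) ≠ 0)⟩
  simpa [Function.comp_def] using h1.comp h2

theorem tendsto_sinh_div :
    Tendsto (fun n : ℕ => ((n : ℝ) + 1) * Real.sinh (1 / ((n : ℝ) + 1))) atTop (𝓝 1) := by
  have h0 : HasDerivAt (fun s => Real.sinh s) 1 0 := by
    simpa using (hasDerivAt_id (0 : ℝ)).sinh
  have h1 := h0.tendsto_slope_zero
  have h2 : Tendsto (fun n : ℕ => 1 / ((n : ℝ) + 1)) atTop (𝓝[≠] 0) :=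
    tendsto_nhdsWithin_iff.2 ⟨tendsto_one_div_add_atTop_nhds_zero_nat,
      Eventually.of_forall fun n => by simpa using (by positivity : ((n : ℝ) + 1) ≠ 0)⟩
  simpa [Function.comp_def] using h1.comp h2

/-! ### Mean and variance of the stochastic area, read off from its characteristic function -/

section Moments

variable {Ω : Type*} [MeasurableSpace Ω] {P : Measure Ω} [IsProbabilityMeasure P] {η : Ω → ℝ}

theorem HasStochasticAreaLaw.integral_cexp (h : HasStochasticAreaLaw η P) (t : ℝ) :
    ∫ ω, Complex.exp ((t * η ω : ℝ) * Complex.I) ∂P = (((Real.cosh t)⁻¹ : ℝ) : ℂ) := by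
  have h1 := h.2 t
  rw [charFun_apply_real, integral_map h.1 (by fun_prop)] at h1
  simpa using h1

theorem HasStochasticAreaLaw.integral_cos (h : HasStochasticAreaLaw η P) (t : ℝ) :
    ∫ ω, Real.cos (t * η ω) ∂P = (Real.cosh t)⁻¹ := by
  have h1 := congrArg Complex.re (h.integral_cexp t)
  have hi := integrable_cexp_mul_I (h.1.const_mul t)
  rw [← RCLike.re_eq_complex_re, ← integral_re hi, RCLike.re_eq_complex_re] at h1
  simpa only [Complex.exp_ofReal_mul_I_re, Complex.ofReal_re] using h1

theorem HasStochasticAreaLaw.integral_sin (h : HasStochasticAreaLaw η P) (t : ℝ) :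
    ∫ ω, Real.sin (t * η ω) ∂P = 0 := by
  have h1 := congrArg Complex.im (h.integral_cexp t)
  have hi := integrable_cexp_mul_I (h.1.const_mul t)
  rw [← RCLike.im_eq_complex_im, ← integral_im hi, RCLike.im_eq_complex_im] at h1
  simpa only [Complex.exp_ofReal_mul_I_im, Complex.ofReal_im] using h1

/-- Squares of sines are bounded and their means follow from the characteristic function. With s =
1/(n + 1), the rescaled sine approximates η before anything is known about its moments. -/
theorem HasStochasticAreaLaw.integral_sin_sq (h : HasStochasticAreaLaw η P) (s : ℝ) :
    ∫ ω, Real.sin (s * η ω) ^ 2 ∂P = Real.sinh s ^ 2 * (Real.cosh (2 * s))⁻¹ := by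
  have hc := h.integral_cos (2 * s)
  have hi : Integrable (fun ω => Real.cos (2 * s * η ω)) P := by
    refine (integrable_const (1 : ℝ)).mono' ?_ (Eventually.of_forall fun ω => Real.abs_cos_le_one _)
    exact (Real.measurable_cos.comp_aemeasurable (h.1.const_mul (2 * s))).aestronglyMeasurable
  have e : ∀ ω, Real.sin (s * η ω) ^ 2 = 1 / 2 - 1 / 2 * Real.cos (2 * s * η ω) := fun ω => by
    rw [show 2 * s * η ω = 2 * (s * η ω) by ring, Real.cos_two_mul]
    have := Real.sin_sq_add_cos_sq (s * η ω)
    linarith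
  simp only [e]
  rw [integral_sub (integrable_const _) (hi.const_mul _), integral_const_mul, hc]
  have h2 := Real.cosh_two_mul s
  have h3 := Real.cosh_sq s
  have h4 := (Real.cosh_pos (2 * s)).ne'
  simp only [integral_const, probReal_univ, smul_eq_mul, one_mul]
  field_simp
  linarith

theorem HasStochasticAreaLaw.tendsto_integral_sin_sq (h : HasStochasticAreaLaw η P) :
    Tendsto (fun n : ℕ => ∫ ω, (((n : ℝ) + 1) * Real.sin ((1 / ((n : ℝ) + 1)) * η ω)) ^ 2 ∂P)
      atTop (𝓝 1) := by
  have h1 : Tendsto (fun n : ℕ => (Real.cosh (2 * (1 / ((n : ℝ) + 1))))⁻¹) atTop (𝓝 1) := by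
    have hc : Continuous fun s : ℝ => (Real.cosh (2 * s))⁻¹ :=
      (Real.continuous_cosh.comp (continuous_const.mul continuous_id)).inv₀
        fun s => (Real.cosh_pos _).ne'
    have := (hc.tendsto 0).comp tendsto_one_div_add_atTop_nhds_zero_nat
    simpa [Function.comp_def] using this
  have h2 := (tendsto_sinh_div.pow 2).mul h1
  simp only [one_pow, mul_one] at h2
  refine h2.congr fun n => ?_
  simp only [mul_pow]
  rw [integral_const_mul, h.integral_sin_sq, mul_assoc]

theorem HasStochasticAreaLaw.abs_sin_le (n : ℕ) (x : ℝ) :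
    |((n : ℝ) + 1) * Real.sin ((1 / ((n : ℝ) + 1)) * x)| ≤ |x| := by
  have hn : (0 : ℝ) < (n : ℝ) + 1 := by positivity
  rw [abs_mul, abs_of_pos hn]
  calc ((n : ℝ) + 1) * |Real.sin ((1 / ((n : ℝ) + 1)) * x)|
      ≤ ((n : ℝ) + 1) * |(1 / ((n : ℝ) + 1)) * x| :=
        mul_le_mul_of_nonneg_left Real.abs_sin_le_abs hn.le
    _ = |x| := by
        rw [abs_mul, abs_of_pos (by positivity : (0 : ℝ) < 1 / ((n : ℝ) + 1))]
        field_simp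

/-- Fatou's lemma: the squares of (n + 1) sin(η/(n + 1)) tend to η² pointwise while their means tend
to 1. -/
theorem HasStochasticAreaLaw.memLp (h : HasStochasticAreaLaw η P) : MemLp η 2 P := by
  refine (memLp_two_iff_integrable_sq h.1.aestronglyMeasurable).2 ?_
  have hm : ∀ n : ℕ, AEMeasurable
      (fun ω => ((n : ℝ) + 1) * Real.sin ((1 / ((n : ℝ) + 1)) * η ω)) P := fun n =>
    (Real.measurable_sin.comp_aemeasurable (h.1.const_mul _)).const_mul _
  have hint : ∀ n : ℕ, Integrable
      (fun ω => (((n : ℝ) + 1) * Real.sin ((1 / ((n : ℝ) + 1)) * η ω)) ^ 2) P := fun n => by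
    refine (integrable_const (((n : ℝ) + 1) ^ 2)).mono' ((hm n).pow_const 2).aestronglyMeasurable
      (Eventually.of_forall fun ω => ?_)
    rw [Real.norm_of_nonneg (sq_nonneg _), mul_pow]
    exact mul_le_of_le_one_right (sq_nonneg _) (Real.sin_sq_le_one _)
  refine ⟨(h.1.pow_const 2).aestronglyMeasurable, ?_⟩
  have hF := lintegral_liminf_le' (μ := P) (u := atTop) (f := fun (n : ℕ) ω =>
    ENNReal.ofReal ((((n : ℝ) + 1) * Real.sin ((1 / ((n : ℝ) + 1)) * η ω)) ^ 2))
    (fun n => ((hm n).pow_const 2).ennreal_ofReal)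
  have hL : ∀ ω, liminf (fun n : ℕ =>
      ENNReal.ofReal ((((n : ℝ) + 1) * Real.sin ((1 / ((n : ℝ) + 1)) * η ω)) ^ 2)) atTop
      = ENNReal.ofReal (η ω ^ 2) := fun ω =>
    ((ENNReal.continuous_ofReal.tendsto _).comp ((tendsto_sin_div (η ω)).pow 2)).liminf_eq
  have hR : liminf (fun n : ℕ => ∫⁻ ω,
      ENNReal.ofReal ((((n : ℝ) + 1) * Real.sin ((1 / ((n : ℝ) + 1)) * η ω)) ^ 2) ∂P) atTop
      = ENNReal.ofReal 1 := by
    refine Tendsto.liminf_eq ?_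
    refine ((ENNReal.continuous_ofReal.tendsto _).comp h.tendsto_integral_sin_sq).congr fun n => ?_
    exact ofReal_integral_eq_lintegral_ofReal (hint n) (Eventually.of_forall fun ω => sq_nonneg _)
  simp only [hL] at hF
  rw [hR] at hF
  refine (hasFiniteIntegral_iff_ofReal (Eventually.of_forall fun ω => sq_nonneg _)).2 ?_
  exact hF.trans_lt (by simp)

/-- Once η² is integrable it dominates the squared sines, and Fatou's inequality sharpens to a
limit. -/
theorem HasStochasticAreaLaw.integral_sq (h : HasStochasticAreaLaw η P) :
    ∫ ω, η ω ^ 2 ∂P = 1 := by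
  refine tendsto_nhds_unique ?_ h.tendsto_integral_sin_sq
  refine tendsto_integral_of_dominated_convergence (fun ω => η ω ^ 2) (fun n => ?_)
    h.memLp.integrable_sq (fun n => Eventually.of_forall fun ω => ?_)
    (Eventually.of_forall fun ω => (tendsto_sin_div (η ω)).pow 2)
  · exact (((Real.measurable_sin.comp_aemeasurable (h.1.const_mul _)).const_mul _).pow_const
      2).aestronglyMeasurable
  · rw [Real.norm_of_nonneg (sq_nonneg _)]
    exact sq_le_sq.2 (abs_sin_le n (η ω))

/-- The characteristic function is real, so the rescaled sines have mean zero; they are dominated by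
|η|. -/
theorem HasStochasticAreaLaw.integral_eq_zero (h : HasStochasticAreaLaw η P) :
    ∫ ω, η ω ∂P = 0 := by
  have h1 := tendsto_integral_of_dominated_convergence (μ := P) (f := η)
    (F := fun (n : ℕ) ω => ((n : ℝ) + 1) * Real.sin ((1 / ((n : ℝ) + 1)) * η ω))
    (fun ω => |η ω|) (fun n => ((Real.measurable_sin.comp_aemeasurable
      (h.1.const_mul _)).const_mul _).aestronglyMeasurable)
    (h.memLp.integrable (by norm_num)).abs (fun n => Eventually.of_forall fun ω => abs_sin_le n _)
    (Eventually.of_forall fun ω => tendsto_sin_div (η ω))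
  refine tendsto_nhds_unique h1 ?_
  simp only [integral_const_mul, h.integral_sin, mul_zero]
  exact tendsto_const_nhds

end Moments

/-! ### Moments of the centred square of a standard normal variable -/

section ChiSquare

variable {Ω : Type*} [MeasurableSpace Ω] {P : Measure Ω} [IsProbabilityMeasure P] {ζ : Ω → ℝ}

theorem integral_cexp_chiSq (h : HasLaw ζ (gaussianReal 0 1) P) (a : ℝ) :
    ∫ ω, Complex.exp ((a * (1 / 2 * (ζ ω ^ 2 - 1)) : ℝ) * Complex.I) ∂P = chiSqCharFun a :=
  h.integral_comp (f := fun z : ℝ => Complex.exp ((a * (1 / 2 * (z ^ 2 - 1)) : ℝ) * Complex.I))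
    (by fun_prop)

theorem deriv_mul_exp_half_sq {p q : ℝ → ℝ} (h : ∀ t, HasDerivAt p (q t) t) :
    deriv (fun t => p t * Real.exp (t ^ 2 / 2))
      = fun t => (q t + t * p t) * Real.exp (t ^ 2 / 2) := by
  ext t
  have h1 : HasDerivAt (fun t : ℝ => t ^ 2 / 2) t t := by
    simpa using (hasDerivAt_pow 2 t).div_const 2
  have h2 : HasDerivAt (fun t => p t * Real.exp (t ^ 2 / 2))
      (q t * Real.exp (t ^ 2 / 2) + p t * (Real.exp (t ^ 2 / 2) * t)) t := (h t).mul h1.exp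
  rw [h2.deriv]
  ring

/-- Fourth derivative at 0 of exp(t²/2). The polynomial prefactors of the successive derivatives are
1, t, 1 + t², 3t + t³ and 3 + 6t² + t⁴. -/
theorem integral_pow_four_gaussianReal : ∫ x : ℝ, x ^ 4 ∂(gaussianReal 0 1) = 3 := by
  have h := iteratedDeriv_mgf_zero (X := fun x : ℝ => x) (μ := gaussianReal 0 1) (n := 4)
    (by simp)
  have e : mgf (fun x : ℝ => x) (gaussianReal 0 1)
      = fun t => (fun _ => (1 : ℝ)) t * Real.exp (t ^ 2 / 2) := by
    rw [mgf_fun_id_gaussianReal]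
    ext t
    simp
  rw [e, iteratedDeriv_succ', iteratedDeriv_succ', iteratedDeriv_succ', iteratedDeriv_succ',
    iteratedDeriv_zero, deriv_mul_exp_half_sq (fun t => hasDerivAt_const t (1 : ℝ)),
    deriv_mul_exp_half_sq (p := fun t => 0 + t * 1) (q := fun t => 1) (fun t => by
      simpa using hasDerivAt_id' t),
    deriv_mul_exp_half_sq (p := fun t => 1 + t * (0 + t * 1)) (q := fun t => 2 * t) (fun t => by
      simpa [← sq] using (hasDerivAt_pow 2 t).const_add 1),
    deriv_mul_exp_half_sq (p := fun t => 2 * t + t * (1 + t * (0 + t * 1)))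
      (q := fun t => 3 + 3 * t ^ 2) (fun t => by
      have h3 := ((hasDerivAt_id t).const_mul 3).add (hasDerivAt_pow 3 t)
      refine (h3.congr_deriv (by norm_num)).congr_of_eventuallyEq (Eventually.of_forall fun s => ?_)
      simp only [id, Pi.add_apply]
      ring)] at h
  simpa using h.symm

theorem memLp_sq_gaussianReal : MemLp (fun z : ℝ => z ^ 2) 2 (gaussianReal 0 1) := by
  have h4 := (memLp_id_gaussianReal (μ := 0) (v := 1) 4).integrable_norm_pow (by norm_num)
  refine (memLp_two_iff_integrable_sq (by fun_prop)).2 (h4.congr (Eventually.of_forall fun z => ?_))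
  simp only [id, Real.norm_eq_abs, ← pow_mul]
  exact Even.pow_abs (by decide) z

theorem memLp_sq_sub_one (h : HasLaw ζ (gaussianReal 0 1) P) :
    MemLp (fun ω => ζ ω ^ 2 - 1) 2 P :=
  (memLp_comp_of_hasLaw h memLp_sq_gaussianReal).sub (memLp_const (1 : ℝ))

theorem integral_sq_sub_one (h : HasLaw ζ (gaussianReal 0 1) P) :
    ∫ ω, (ζ ω ^ 2 - 1) ∂P = 0 := by
  have h1 : ∫ ω, (ζ ω ^ 2 - 1) ∂P = ∫ z, (z ^ 2 - 1) ∂(gaussianReal 0 1) :=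
    h.integral_comp (f := fun z : ℝ => z ^ 2 - 1) (by fun_prop)
  have hi : Integrable (fun z : ℝ => z ^ 2) (gaussianReal 0 1) :=
    memLp_sq_gaussianReal.integrable (by norm_num)
  rw [h1, integral_sub hi (integrable_const _)]
  simp [integral_sq_gaussianReal]

theorem integral_sq_sub_one_sq (h : HasLaw ζ (gaussianReal 0 1) P) :
    ∫ ω, (ζ ω ^ 2 - 1) ^ 2 ∂P = 2 := by
  have h1 : ∫ ω, (ζ ω ^ 2 - 1) ^ 2 ∂P = ∫ z, (z ^ 2 - 1) ^ 2 ∂(gaussianReal 0 1) :=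
    h.integral_comp (f := fun z : ℝ => (z ^ 2 - 1) ^ 2) (by fun_prop)
  have hi : Integrable (fun z : ℝ => z ^ 2) (gaussianReal 0 1) :=
    memLp_sq_gaussianReal.integrable (by norm_num)
  have hi4 : Integrable (fun z : ℝ => z ^ 4) (gaussianReal 0 1) := by
    simpa [← pow_mul] using memLp_sq_gaussianReal.integrable_sq
  have e : ∀ z : ℝ, (z ^ 2 - 1) ^ 2 = (z ^ 4 - 2 * z ^ 2) + 1 := fun z => by ring
  have hi2 : Integrable (fun z : ℝ => 2 * z ^ 2) (gaussianReal 0 1) := hi.const_mul 2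
  have hi3 : Integrable (fun z : ℝ => z ^ 4 - 2 * z ^ 2) (gaussianReal 0 1) := hi4.sub hi2
  rw [h1]
  simp only [e]
  rw [integral_add hi3 (integrable_const _), integral_sub hi4 hi2, integral_const_mul,
    integral_pow_four_gaussianReal, integral_sq_gaussianReal]
  simp
  norm_num

end ChiSquare

end AreaLaw

/-! ### Sums of independent chi-square and stochastic area variables -/

section LimitVariable

/-- By Pythagoras the Cauchy criterion for Σ ‖v_i‖² is that for Σ v_i. -/
theorem exists_hasSum_of_orthogonal {ι H : Type*} [NormedAddCommGroup H] [InnerProductSpace ℝ H]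
    [CompleteSpace H] {v : ι → H} (h0 : ∀ i j, i ≠ j → inner ℝ (v i) (v j) = 0) {s : ℝ}
    (hs : HasSum (fun i => ‖v i‖ ^ 2) s) : ∃ w, HasSum v w ∧ ‖w‖ ^ 2 = s := by
  classical
  have hF : ∀ F : Finset ι, ‖∑ i ∈ F, v i‖ ^ 2 = ∑ i ∈ F, ‖v i‖ ^ 2 := fun F => by
    rw [← real_inner_self_eq_norm_sq, sum_inner]
    refine Finset.sum_congr rfl fun i hi => ?_
    rw [inner_sum, Finset.sum_eq_single i (fun j _ hj => h0 i j hj.symm) (fun h => absurd hi h),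
      real_inner_self_eq_norm_sq]
  have hv : Summable v := by
    rw [summable_iff_vanishing_norm]
    intro ε hε
    obtain ⟨S, hS⟩ := summable_iff_vanishing_norm.1 hs.summable (ε ^ 2) (by positivity)
    refine ⟨S, fun T hT => ?_⟩
    have h1 := (le_abs_self _).trans_lt (hS T hT)
    rw [← hF] at h1
    exact lt_of_pow_lt_pow_left₀ 2 hε.le h1
  refine ⟨∑' i, v i, hv.hasSum, ?_⟩
  refine tendsto_nhds_unique ((tendsto_finset_sum_of_hasSum hv.hasSum).norm.pow 2) ?_
  exact (tendsto_finset_sum_of_hasSum hs).congr fun F => (hF F).symm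

variable {Ω ι κ : Type*} [MeasurableSpace Ω] {P : Measure Ω} [IsProbabilityMeasure P]

theorem inner_toLp_eq {f g : Ω → ℝ} (hf : MemLp f 2 P) (hg : MemLp g 2 P) :
    inner ℝ hf.toLp hg.toLp = ∫ ω, f ω * g ω ∂P := by
  rw [L2.inner_def]
  refine integral_congr_ae ?_
  filter_upwards [hf.coeFn_toLp, hg.coeFn_toLp] with ω h1 h2
  rw [h1, h2, real_inner_eq_re_inner]
  simp [mul_comm]

theorem sum_toLp {Y : ι → Ω → ℝ} (hY : ∀ i, MemLp (Y i) 2 P) (F : Finset ι) :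
    ∑ i ∈ F, (hY i).toLp = (memLp_finsetSum F fun i _ => hY i).toLp
      (fun ω => ∑ i ∈ F, Y i ω) := by
  classical
  induction F using Finset.induction_on with
  | empty =>
    simp only [Finset.sum_empty]
    rfl
  | insert i F hi ih =>
    rw [Finset.sum_insert hi, ih, ← MemLp.toLp_add]
    refine MemLp.toLp_congr _ _ (Eventually.of_forall fun ω => ?_)
    simp [Finset.sum_insert hi]

theorem tendsto_eLpNorm_of_hasSum {Y : ι → Ω → ℝ} (hY : ∀ i, MemLp (Y i) 2 P) {W : Ω → ℝ}
    (hW : MemLp W 2 P) (h : HasSum (fun i => (hY i).toLp) hW.toLp) :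
    Tendsto (fun F : Finset ι => eLpNorm (fun ω => W ω - ∑ i ∈ F, Y i ω) 2 P) atTop (𝓝 0) := by
  have h1 := (tendsto_finset_sum_of_hasSum h).edist (tendsto_const_nhds (x := hW.toLp))
  rw [edist_self] at h1
  refine h1.congr fun F => ?_
  rw [edist_comm, sum_toLp, Lp.edist_toLp_toLp]
  rfl

/-- The `L²` sum of an independent centred family. -/
theorem exists_l2_sum_of_iIndepFun {Y : ι → Ω → ℝ} (hY : ∀ i, MemLp (Y i) 2 P)
    (hind : Pairwise fun i j => IndepFun (Y i) (Y j) P)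
    (h0 : ∀ i, ∫ ω, Y i ω ∂P = 0) {s : ℝ} (hs : HasSum (fun i => ∫ ω, Y i ω ^ 2 ∂P) s) :
    ∃ (W : Ω → ℝ) (hW : MemLp W 2 P), HasSum (fun i => (hY i).toLp) hW.toLp ∧
      ∫ ω, W ω ∂P = 0 ∧ ∫ ω, W ω ^ 2 ∂P = s := by
  have hn : ∀ i, ‖(hY i).toLp‖ ^ 2 = ∫ ω, Y i ω ^ 2 ∂P := fun i => by
    rw [← real_inner_self_eq_norm_sq, inner_toLp_eq]
    simp only [sq]
  simp only [← hn] at hs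
  obtain ⟨w, hw, hws⟩ := exists_hasSum_of_orthogonal (v := fun i => (hY i).toLp)
    (fun i j hij => by
      rw [inner_toLp_eq]
      have := (hind hij).integral_fun_mul_eq_mul_integral (hY i).1 (hY j).1
      rw [this, h0, zero_mul]) hs
  have e : (Lp.memLp w).toLp = w := Lp.toLp_coeFn w (Lp.memLp w)
  refine ⟨w, Lp.memLp w, by rwa [e], ?_, ?_⟩
  -- The mean is the inner product with the constant 1, hence continuous along the L² sum.
  · have h1 := memLp_const (μ := P) (p := 2) (1 : ℝ)
    have h2 := hw.mapL (innerSL ℝ h1.toLp)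
    have h3 : (fun i => innerSL ℝ h1.toLp (hY i).toLp) = fun _ => (0 : ℝ) := by
      ext i
      rw [innerSL_apply_apply, inner_toLp_eq]
      simpa using h0 i
    rw [h3] at h2
    have h4 := h2.unique hasSum_zero
    rw [innerSL_apply_apply, ← e, inner_toLp_eq] at h4
    simpa using h4
  · rw [← hws, ← real_inner_self_eq_norm_sq]
    conv_rhs => rw [← e]
    rw [inner_toLp_eq]
    simp only [sq]

/-- Orthogonality passes to L² sums in one argument after the other, by continuity of the inner
product. -/
theorem integral_mul_eq_zero_of_hasSum {Y : ι → Ω → ℝ} {Z : κ → Ω → ℝ}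
    (hY : ∀ i, MemLp (Y i) 2 P) (hZ : ∀ j, MemLp (Z j) 2 P)
    (h0 : ∀ i j, ∫ ω, Y i ω * Z j ω ∂P = 0) {V W : Ω → ℝ} (hV : MemLp V 2 P) (hW : MemLp W 2 P)
    (hVs : HasSum (fun i => (hY i).toLp) hV.toLp) (hWs : HasSum (fun j => (hZ j).toLp) hW.toLp) :
    ∫ ω, V ω * W ω ∂P = 0 := by
  have h1 : ∀ i, inner ℝ (hY i).toLp hW.toLp = 0 := fun i => by
    have h2 := hWs.mapL (innerSL ℝ (hY i).toLp)
    have h3 : (fun j => innerSL ℝ (hY i).toLp (hZ j).toLp) = fun _ => (0 : ℝ) := by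
      ext j
      rw [innerSL_apply_apply, inner_toLp_eq]
      exact h0 i j
    rw [h3] at h2
    exact h2.unique hasSum_zero
  have h2 := hVs.mapL (innerSL ℝ hW.toLp)
  have h3 : (fun i => innerSL ℝ hW.toLp (hY i).toLp) = fun _ => (0 : ℝ) := by
    ext i
    rw [innerSL_apply_apply, real_inner_comm]
    exact h1 i
  rw [h3] at h2
  have h4 := h2.unique hasSum_zero
  rw [innerSL_apply_apply, real_inner_comm, inner_toLp_eq] at h4
  exact h4

theorem integral_cexp_sum_eq_prod_of_iIndepFun {Y : ι → Ω → ℝ} (hY : ∀ i, AEMeasurable (Y i) P)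
    (hind : iIndepFun Y P) (S : Finset ι) :
    ∫ ω, Complex.exp ((∑ i ∈ S, Y i ω : ℝ) * Complex.I) ∂P
      = ∏ i ∈ S, ∫ ω, Complex.exp (Y i ω * Complex.I) ∂P := by
  have h := (hind.precomp (g := fun i : S => (i : ι)) Subtype.val_injective).integral_fun_prod_comp
    (f := fun (_ : S) (x : ℝ) => Complex.exp (x * Complex.I)) (fun i => hY i)
    (fun i => by fun_prop)
  rw [← Finset.prod_coe_sort]
  refine Eq.trans ?_ h
  refine integral_congr_ae (Eventually.of_forall fun ω => ?_)
  simp only []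
  rw [← Complex.exp_sum, ← Finset.sum_mul, ← Finset.sum_coe_sort]
  push_cast
  rfl

/-- The summands of the limit variable. -/
def limitTerm (a : ι → ℝ) (b : κ → ℝ) : ι ⊕ κ → ℝ → ℝ :=
  Sum.elim (fun r z => 1 / 2 * a r * (z ^ 2 - 1)) (fun q z => b q * z)

variable {ζ : ι → Ω → ℝ} {η : κ → Ω → ℝ}

theorem iIndepFun_limitTerm (h : IsNormalAreaFamily P ζ η) (a : ι → ℝ) (b : κ → ℝ) :
    iIndepFun (fun i ω => limitTerm a b i (Sum.elim ζ η i ω)) P :=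
  h.indep.comp (limitTerm a b) fun i => by
    rcases i with r | q
    · exact (by fun_prop : Measurable fun z : ℝ => 1 / 2 * a r * (z ^ 2 - 1))
    · exact (by fun_prop : Measurable fun z : ℝ => b q * z)

theorem memLp_limitTerm (h : IsNormalAreaFamily P ζ η) (a : ι → ℝ) (b : κ → ℝ) (i : ι ⊕ κ) :
    MemLp (fun ω => limitTerm a b i (Sum.elim ζ η i ω)) 2 P := by
  rcases i with r | q
  · exact (memLp_sq_sub_one (h.normal r)).const_mul (1 / 2 * a r)
  · exact (h.area q).memLp.const_mul (b q)

theorem integral_limitTerm (h : IsNormalAreaFamily P ζ η) (a : ι → ℝ) (b : κ → ℝ) (i : ι ⊕ κ) :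
    ∫ ω, limitTerm a b i (Sum.elim ζ η i ω) ∂P = 0 := by
  rcases i with r | q
  · simp only [limitTerm, Sum.elim_inl]
    rw [integral_const_mul, integral_sq_sub_one (h.normal r), mul_zero]
  · simp only [limitTerm, Sum.elim_inr]
    rw [integral_const_mul, (h.area q).integral_eq_zero, mul_zero]

theorem integral_cexp_limitTerm_sum (h : IsNormalAreaFamily P ζ η) (a : ι → ℝ) (b : κ → ℝ)
    (F : Finset ι) (G : Finset κ) (t : ℝ) :
    ∫ ω, Complex.exp ((t * (∑ r ∈ F, 1 / 2 * a r * (ζ r ω ^ 2 - 1) + ∑ q ∈ G, b q * η q ω) : ℝ)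
      * Complex.I) ∂P
      = (∏ r ∈ F, chiSqCharFun (t * a r)) * ∏ q ∈ G, (((Real.cosh (t * b q))⁻¹ : ℝ) : ℂ) := by
  have h1 := integral_cexp_sum_eq_prod_of_iIndepFun
    (fun i => (memLp_limitTerm h (fun r => t * a r) (fun q => t * b q) i).1.aemeasurable)
    (iIndepFun_limitTerm h (fun r => t * a r) (fun q => t * b q)) (F.disjSum G)
  simp only [Finset.sum_disjSum, Finset.prod_disjSum, limitTerm, Sum.elim_inl, Sum.elim_inr] at h1
  refine Eq.trans ?_ (h1.trans ?_)
  · congr 1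
    ext ω
    rw [mul_add, Finset.mul_sum, Finset.mul_sum]
    have e1 : ∑ r ∈ F, t * (1 / 2 * a r * (ζ r ω ^ 2 - 1))
        = ∑ r ∈ F, 1 / 2 * (t * a r) * (ζ r ω ^ 2 - 1) := Finset.sum_congr rfl fun r _ => by ring
    have e2 : ∑ q ∈ G, t * (b q * η q ω) = ∑ q ∈ G, t * b q * η q ω :=
      Finset.sum_congr rfl fun q _ => by ring
    rw [e1, e2]
  · congr 1
    · refine Finset.prod_congr rfl fun r _ => ?_
      rw [← integral_cexp_chiSq (h.normal r)]
      congr 1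
      ext ω
      congr 3
      ring
    · exact Finset.prod_congr rfl fun q _ => (h.area q).integral_cexp (t * b q)

/-- The limit variable `W = W₁ + W₂` and its second moments. -/
theorem exists_limit_parts (h : IsNormalAreaFamily P ζ η) {a : ι → ℝ} {b : κ → ℝ} {A B : ℝ}
    (ha : HasSum (fun r => a r ^ 2) A) (hb : HasSum (fun q => b q ^ 2) B) :
    ∃ W₁ W₂ : Ω → ℝ, MemLp W₁ 2 P ∧ MemLp W₂ 2 P ∧
      Tendsto (fun s : Finset ι =>
        eLpNorm (fun ω => W₁ ω - ∑ r ∈ s, 1 / 2 * a r * (ζ r ω ^ 2 - 1)) 2 P) atTop (𝓝 0) ∧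
      Tendsto (fun s : Finset κ =>
        eLpNorm (fun ω => W₂ ω - ∑ q ∈ s, b q * η q ω) 2 P) atTop (𝓝 0) ∧
      Var[fun ω => W₁ ω + W₂ ω; P] = 1 / 2 * A + B := by
  have hm := memLp_limitTerm h a b
  have hi := iIndepFun_limitTerm h a b
  have h0 := integral_limitTerm h a b
  have hp : Pairwise fun i j => IndepFun (fun ω => limitTerm a b i (Sum.elim ζ η i ω))
      (fun ω => limitTerm a b j (Sum.elim ζ η j ω)) P := fun i j hij => hi.indepFun hij
  -- Since ζ² - 1 has second moment 2, the term ½ a_r (ζ_r² - 1) has second moment a_r²/2.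
  have hA : HasSum (fun r => ∫ ω, limitTerm a b (Sum.inl r) (Sum.elim ζ η (Sum.inl r) ω) ^ 2 ∂P)
      (1 / 2 * A) := by
    refine (ha.mul_left (1 / 2)).congr_fun fun r => ?_
    simp only [limitTerm, Sum.elim_inl, mul_pow]
    rw [integral_const_mul, integral_sq_sub_one_sq (h.normal r)]
    ring
  have hB : HasSum (fun q => ∫ ω, limitTerm a b (Sum.inr q) (Sum.elim ζ η (Sum.inr q) ω) ^ 2 ∂P)
      B := by
    refine hb.congr_fun fun q => ?_
    simp only [limitTerm, Sum.elim_inr, mul_pow]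
    rw [integral_const_mul, (h.area q).integral_sq, mul_one]
  obtain ⟨W₁, hW₁, hs₁, hE₁, hV₁⟩ := exists_l2_sum_of_iIndepFun (fun r => hm (Sum.inl r))
    (fun i j hij => hp (Sum.inl_injective.ne hij)) (fun r => h0 (Sum.inl r)) hA
  obtain ⟨W₂, hW₂, hs₂, hE₂, hV₂⟩ := exists_l2_sum_of_iIndepFun (fun r => hm (Sum.inr r))
    (fun i j hij => hp (Sum.inr_injective.ne hij)) (fun r => h0 (Sum.inr r)) hB
  refine ⟨W₁, W₂, hW₁, hW₂, tendsto_eLpNorm_of_hasSum _ hW₁ hs₁,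
    tendsto_eLpNorm_of_hasSum _ hW₂ hs₂, ?_⟩
  have hc : ∫ ω, W₁ ω * W₂ ω ∂P = 0 := by
    refine integral_mul_eq_zero_of_hasSum _ _ (fun r q => ?_) hW₁ hW₂ hs₁ hs₂
    have := (hp (i := Sum.inl r) (j := Sum.inr q) (by simp)).integral_fun_mul_eq_mul_integral
      (hm _).1 (hm _).1
    rw [this, h0, zero_mul]
  have i1 := hW₁.integrable (q := 2) (by norm_num)
  have i2 := hW₂.integrable (q := 2) (by norm_num)
  rw [variance_of_integral_eq_zero (X := fun ω => W₁ ω + W₂ ω) (hW₁.add hW₂).1.aemeasurable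
    (by rw [integral_add i1 i2, hE₁, hE₂, add_zero])]
  have e : ∀ ω, (W₁ ω + W₂ ω) ^ 2 = W₁ ω ^ 2 + (W₂ ω ^ 2 + 2 * (W₁ ω * W₂ ω)) := fun ω => by ring
  have i12 : Integrable (fun ω => 2 * (W₁ ω * W₂ ω)) P := (hW₁.integrable_mul hW₂).const_mul 2
  have i3 : Integrable (fun ω => W₂ ω ^ 2 + 2 * (W₁ ω * W₂ ω)) P := hW₂.integrable_sq.add i12
  simp only [e]
  rw [integral_add hW₁.integrable_sq i3, integral_add hW₂.integrable_sq i12, integral_const_mul,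
    hc, hV₁, hV₂]
  ring

end LimitVariable

/-! ### The limit law in the degenerate case -/

section Degenerate

variable {Ω 𝓧 ι κ : Type*} [MeasurableSpace Ω] [MeasurableSpace 𝓧] {P : Measure Ω}
  [IsProbabilityMeasure P] {ν : Measure 𝓧} [IsProbabilityMeasure ν] {X : ℕ → Ω → 𝓧}
  {g h : 𝓧 → 𝓧 → ℝ}

theorem IsCanonical.linear_comb (hg : IsCanonical g ν) (hh : IsCanonical h ν) (a b : ℝ) :
    IsCanonical (fun x y => a * g x y + b * h x y) ν where
  measurable := (hg.measurable.const_mul a).add (hh.measurable.const_mul b)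
  memLp := (hg.memLp.const_mul a).add (hh.memLp.const_mul b)
  right := by
    have h1 := (hg.memLp.integrable (q := 2) (by norm_num)).prod_right_ae
    have h2 := (hh.memLp.integrable (q := 2) (by norm_num)).prod_right_ae
    filter_upwards [hg.right, hh.right, h1, h2] with x e1 e2 i1 i2
    have i1' : Integrable (fun y => a * g x y) ν := i1.const_mul a
    have i2' : Integrable (fun y => b * h x y) ν := i2.const_mul b
    rw [integral_add i1' i2', integral_const_mul, integral_const_mul, e1, e2]
    simp
  left := by
    have h1 := (hg.memLp.integrable (q := 2) (by norm_num)).prod_left_ae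
    have h2 := (hh.memLp.integrable (q := 2) (by norm_num)).prod_left_ae
    filter_upwards [hg.left, hh.left, h1, h2] with y e1 e2 i1 i2
    have i1' : Integrable (fun x => a * g x y) ν := i1.const_mul a
    have i2' : Integrable (fun x => b * h x y) ν := i2.const_mul b
    rw [integral_add i1' i2', integral_const_mul, integral_const_mul, e1, e2]
    simp

theorem IsCanonical.sub (hg : IsCanonical g ν) (hh : IsCanonical h ν) :
    IsCanonical (fun x y => g x y - h x y) ν := by
  simpa [sub_eq_add_neg] using hg.linear_comb hh 1 (-1)

theorem IsCanonical.symmPart (hg : IsCanonical g ν) : IsCanonical (symmPart g) ν := by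
  convert hg.linear_comb hg.flip (1 / 2) (1 / 2) using 1
  ext x y
  simp only [CyclicU.symmPart]
  ring

theorem IsCanonical.antisymmPart (hg : IsCanonical g ν) : IsCanonical (antisymmPart g) ν := by
  convert hg.linear_comb hg.flip (1 / 2) (-(1 / 2)) using 1
  ext x y
  simp only [CyclicU.antisymmPart]
  ring

/-- The cross terms cancel pointwise, and the two remaining squares have equal integrals because ν ×
ν is invariant under the swap. -/
theorem integral_symmPart_sq_add (hg : MemLp (Function.uncurry g) 2 (ν.prod ν)) :
    ∫ p, symmPart g p.1 p.2 ^ 2 ∂(ν.prod ν) + ∫ p, antisymmPart g p.1 p.2 ^ 2 ∂(ν.prod ν)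
      = ∫ p, g p.1 p.2 ^ 2 ∂(ν.prod ν) := by
  have hs : Integrable (fun p : 𝓧 × 𝓧 => symmPart g p.1 p.2 ^ 2) (ν.prod ν) :=
    (memLp_symmPart hg).integrable_sq
  have ha : Integrable (fun p : 𝓧 × 𝓧 => antisymmPart g p.1 p.2 ^ 2) (ν.prod ν) :=
    (memLp_antisymmPart hg).integrable_sq
  have h1 : Integrable (fun p : 𝓧 × 𝓧 => g p.1 p.2 ^ 2) (ν.prod ν) := hg.integrable_sq
  have h2 : Integrable (fun p : 𝓧 × 𝓧 => g p.2 p.1 ^ 2) (ν.prod ν) := (memLp_flip hg).integrable_sq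
  have hswap : ∫ p : 𝓧 × 𝓧, g p.2 p.1 ^ 2 ∂(ν.prod ν) = ∫ p, g p.1 p.2 ^ 2 ∂(ν.prod ν) :=
    integral_prod_swap (μ := ν) (ν := ν) fun p : 𝓧 × 𝓧 => g p.1 p.2 ^ 2
  rw [← integral_add hs ha]
  have e : ∀ p : 𝓧 × 𝓧, symmPart g p.1 p.2 ^ 2 + antisymmPart g p.1 p.2 ^ 2
      = 1 / 2 * g p.1 p.2 ^ 2 + 1 / 2 * g p.2 p.1 ^ 2 := fun p => by
    simp only [symmPart, antisymmPart]
    ring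
  have h1' : Integrable (fun p : 𝓧 × 𝓧 => 1 / 2 * g p.1 p.2 ^ 2) (ν.prod ν) := h1.const_mul _
  have h2' : Integrable (fun p : 𝓧 × 𝓧 => 1 / 2 * g p.2 p.1 ^ 2) (ν.prod ν) := h2.const_mul _
  simp only [e]
  rw [integral_add h1' h2', integral_const_mul, integral_const_mul, hswap]
  ring

theorem isSelfAdjoint_integralOp (hg : MemLp (Function.uncurry g) 2 (ν.prod ν))
    (hsymm : ∀ x y, g y x = g x y) : IsSelfAdjoint (integralOp g hg) := by
  rw [ContinuousLinearMap.isSelfAdjoint_iff', adjoint_integralOp]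
  refine integralOp_congr (Eventually.of_forall fun p => ?_)
  simp [Function.uncurry, hsymm]

theorem integralOp_neg {𝕜 : Type*} [RCLike 𝕜] {k : 𝓧 → 𝓧 → 𝕜}
    (hk : MemLp (Function.uncurry k) 2 (ν.prod ν))
    (hk' : MemLp (Function.uncurry fun x y => -k x y) 2 (ν.prod ν)) :
    integralOp (fun x y => -k x y) hk' = -integralOp k hk := by
  ext φ
  filter_upwards [integralOp_apply_ae _ hk' φ, integralOp_apply_ae _ hk φ,
    Lp.coeFn_neg (integralOp k hk φ)] with x h1 h2 h3
  rw [h1, neg_apply, h3, Pi.neg_apply, h2]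
  simp only [neg_mul, integral_neg]

theorem adjoint_integralOp_of_antisymm {𝕜 : Type*} [RCLike 𝕜] {k : 𝓧 → 𝓧 → 𝕜}
    (hk : MemLp (Function.uncurry k) 2 (ν.prod ν))
    (hanti : ∀ x y, starRingEnd 𝕜 (k y x) = -k x y) :
    ContinuousLinearMap.adjoint (integralOp k hk) = -integralOp k hk := by
  rw [adjoint_integralOp, ← integralOp_neg hk hk.neg]
  exact integralOp_congr (Eventually.of_forall fun p => hanti p.1 p.2)

theorem IsCentredSystem.comp_injective {e : ι → 𝓧 → ℝ} (he : IsCentredSystem e ν) {i : κ → ι}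
    (hi : Function.Injective i) : IsCentredSystem (fun k => e (i k)) ν where
  measurable k := he.measurable (i k)
  memLp k := he.memLp (i k)
  integral_eq_zero k := he.integral_eq_zero (i k)
  integral_mul_self k := he.integral_mul_self (i k)
  integral_mul k l hkl := he.integral_mul (i k) (i l) (hi.ne hkl)

theorem cyclicU_sub (g h : 𝓧 → 𝓧 → ℝ) (X : ℕ → Ω → 𝓧) (n : ℕ) (ω : Ω) :
    cyclicU (fun x y => g x y - h x y) X n ω = cyclicU g X n ω - cyclicU h X n ω := by
  simp only [cyclicU, Finset.sum_sub_distrib]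

theorem norm_integral_cexp_mul_sub_le {Y Z : Ω → ℝ} (hY : MemLp Y 2 P) (hZ : MemLp Z 2 P) (t : ℝ) :
    ‖∫ ω, Complex.exp ((t * Y ω : ℝ) * Complex.I) ∂P
        - ∫ ω, Complex.exp ((t * Z ω : ℝ) * Complex.I) ∂P‖
      ≤ |t| * √(∫ ω, (Y ω - Z ω) ^ 2 ∂P) := by
  refine (norm_integral_cexp_sub_cexp_le (hY.const_mul t) (hZ.const_mul t)).trans_eq ?_
  have e : ∀ ω, (t * Y ω - t * Z ω) ^ 2 = t ^ 2 * (Y ω - Z ω) ^ 2 := fun ω => by ring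
  simp only [e]
  rw [integral_const_mul, Real.sqrt_mul (sq_nonneg t), Real.sqrt_sq_eq_abs]

/-- The second moment of the normalized difference is n⌊(n-1)/2⌋/n² ≤ 1 times the squared norm of g
- h, so the bound does not depend on n. -/
theorem norm_integral_cexp_cyclicU_sub_le (hX : ∀ i, HasLaw (X i) ν P) (hind : iIndepFun X P)
    (hg : IsCanonical g ν) (hh : IsCanonical h ν) (t : ℝ) (n : ℕ) :
    ‖∫ ω, Complex.exp ((t * ((n : ℝ)⁻¹ * cyclicU g X n ω) : ℝ) * Complex.I) ∂P
        - ∫ ω, Complex.exp ((t * ((n : ℝ)⁻¹ * cyclicU h X n ω) : ℝ) * Complex.I) ∂P‖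
      ≤ |t| * √(∫ p, (g p.1 p.2 - h p.1 p.2) ^ 2 ∂(ν.prod ν)) := by
  refine (norm_integral_cexp_mul_sub_le ((memLp_cyclicU hX hind hg.memLp n).const_mul _)
    ((memLp_cyclicU hX hind hh.memLp n).const_mul _) t).trans ?_
  refine mul_le_mul_of_nonneg_left (Real.sqrt_le_sqrt ?_) (abs_nonneg t)
  have e : ∀ ω, ((n : ℝ)⁻¹ * cyclicU g X n ω - (n : ℝ)⁻¹ * cyclicU h X n ω) ^ 2
      = ((n : ℝ)⁻¹) ^ 2 * cyclicU (fun x y => g x y - h x y) X n ω ^ 2 := fun ω => by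
    rw [cyclicU_sub]
    ring
  simp only [e]
  rw [integral_const_mul, integral_cyclicU_sq hX hind (hg.sub hh), ← mul_assoc]
  have hC : 0 ≤ ∫ p : 𝓧 × 𝓧, (g p.1 p.2 - h p.1 p.2) ^ 2 ∂(ν.prod ν) :=
    integral_nonneg fun p : 𝓧 × 𝓧 => sq_nonneg (g p.1 p.2 - h p.1 p.2)
  refine mul_le_of_le_one_left hC ?_
  rcases Nat.eq_zero_or_pos n with rfl | hn
  · simp
  · have hn' : (0 : ℝ) < n := by exact_mod_cast hn
    rw [inv_pow, ← mul_assoc, inv_mul_eq_div, div_mul_eq_mul_div, div_le_one (by positivity)]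
    nlinarith [half_le n]

theorem integral_add_sq_le {Y Z : Ω → ℝ} (hY : MemLp Y 2 P) (hZ : MemLp Z 2 P) :
    ∫ ω, (Y ω + Z ω) ^ 2 ∂P ≤ 2 * ∫ ω, Y ω ^ 2 ∂P + 2 * ∫ ω, Z ω ^ 2 ∂P := by
  have h1 : Integrable (fun ω => 2 * Y ω ^ 2) P := hY.integrable_sq.const_mul 2
  have h2 : Integrable (fun ω => 2 * Z ω ^ 2) P := hZ.integrable_sq.const_mul 2
  have h12 : Integrable (fun ω => (Y ω + Z ω) ^ 2) P := (hY.add hZ).integrable_sq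
  rw [← integral_const_mul, ← integral_const_mul, ← integral_add h1 h2]
  refine integral_mono h12 (h1.add h2) fun ω => ?_
  nlinarith [sq_nonneg (Y ω - Z ω)]

theorem tendsto_integral_sq_of_tendsto_eLpNorm {β : Type*} {l : Filter β} {Y : β → Ω → ℝ}
    (hY : ∀ b, MemLp (Y b) 2 P) (h0 : Tendsto (fun b => eLpNorm (Y b) 2 P) l (𝓝 0)) :
    Tendsto (fun b => ∫ ω, Y b ω ^ 2 ∂P) l (𝓝 0) := by
  have h1 := ((ENNReal.tendsto_toReal ENNReal.zero_ne_top).comp h0).pow 2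
  simp only [ENNReal.toReal_zero, ne_eq, OfNat.ofNat_ne_zero, not_false_eq_true, zero_pow] at h1
  refine h1.congr fun b => ?_
  rw [Function.comp_apply, eLpNorm_two_eq_sqrt (hY b), ENNReal.toReal_ofReal (Real.sqrt_nonneg _),
    Real.sq_sqrt (integral_nonneg fun ω => sq_nonneg (Y b ω))]

theorem tendsto_abs_mul_sqrt_error {α β : Type*} {l : Filter α} {l' : Filter β} {d : α → ℝ}
    {d' : β → ℝ} (h1 : Tendsto d l (𝓝 0)) (h2 : Tendsto d' l' (𝓝 0)) (t : ℝ) :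
    Tendsto (fun p : α × β => |t| * √(2 * d p.1 + 2 * d' p.2)) (l ×ˢ l') (𝓝 0) := by
  have h3 := ((((h1.comp tendsto_fst).const_mul 2).add
    ((h2.comp (tendsto_snd (f := l))).const_mul 2)).sqrt).const_mul |t|
  simpa [Function.comp_def] using h3

/-- Finite sections of both expansions give a finite rank kernel, for which the limit is known. The
error on the side of the statistic is uniform in n, and the error on the side of W is controlled by
the L² convergence of its two sums. -/
theorem tendstoInDistribution_cyclicU_of_isCanonical {Ω' : Type*} [MeasurableSpace Ω']
    {P' : Measure Ω'} [IsProbabilityMeasure P'] (hX : ∀ i, HasLaw (X i) ν P)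
    (hind : iIndepFun X P) (hg : IsCanonical g ν) {e : ι → 𝓧 → ℝ} {w : κ × Bool → 𝓧 → ℝ}
    (he : IsCentredSystem e ν) (hw : IsCentredSystem w ν) {a : ι → ℝ} {b : κ → ℝ}
    (hs : Tendsto (fun F : Finset ι => ∫ p, (symmPart g p.1 p.2
      - ∑ r ∈ F, a r * (e r p.1 * e r p.2)) ^ 2 ∂(ν.prod ν)) atTop (𝓝 0))
    (ha : Tendsto (fun G : Finset κ => ∫ p, (antisymmPart g p.1 p.2
      - ∑ q ∈ G, b q * (w (q, true) p.1 * w (q, false) p.2 - w (q, false) p.1 * w (q, true) p.2)) ^ 2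
        ∂(ν.prod ν)) atTop (𝓝 0))
    {ζ : ι → Ω' → ℝ} {η : κ → Ω' → ℝ} (hfam : IsNormalAreaFamily P' ζ η) {W₁ W₂ : Ω' → ℝ}
    (hW₁ : MemLp W₁ 2 P') (hW₂ : MemLp W₂ 2 P')
    (ht₁ : Tendsto (fun s : Finset ι =>
      eLpNorm (fun ω => W₁ ω - ∑ r ∈ s, 1 / 2 * a r * (ζ r ω ^ 2 - 1)) 2 P') atTop (𝓝 0))
    (ht₂ : Tendsto (fun s : Finset κ =>
      eLpNorm (fun ω => W₂ ω - ∑ q ∈ s, b q * η q ω) 2 P') atTop (𝓝 0)) :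
    TendstoInDistribution (fun (n : ℕ) ω => (n : ℝ)⁻¹ * cyclicU g X n ω) atTop
      (fun ω => W₁ ω + W₂ ω) (fun _ => P) P' := by
  have hS₁ : ∀ F : Finset ι, MemLp (fun ω => ∑ r ∈ F, 1 / 2 * a r * (ζ r ω ^ 2 - 1)) 2 P' :=
    fun F => memLp_finsetSum _ fun r _ => (memLp_sq_sub_one (hfam.normal r)).const_mul _
  have hS₂ : ∀ G : Finset κ, MemLp (fun ω => ∑ q ∈ G, b q * η q ω) 2 P' :=
    fun G => memLp_finsetSum _ fun q _ => (hfam.area q).memLp.const_mul _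
  have hd₁ := tendsto_integral_sq_of_tendsto_eLpNorm (fun F => hW₁.sub (hS₁ F)) ht₁
  have hd₂ := tendsto_integral_sq_of_tendsto_eLpNorm (fun G => hW₂.sub (hS₂ G)) ht₂
  refine tendstoInDistribution_of_tendsto_integral_cexp
    (fun n => (memLp_cyclicU hX hind hg.memLp n).1.aemeasurable.const_mul _)
    (hW₁.add hW₂).1.aemeasurable fun t => ?_
  simp only [RCLike.inner_apply, conj_trivial]
  refine tendsto_of_forall_approx fun ε hε => ?_
  -- A single pair of finite index sets is made to serve both errors; this is possible because both
  -- tend to zero along the same product filter.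
  obtain ⟨⟨F, G⟩, hker, hlim⟩ := (((tendsto_abs_mul_sqrt_error hs ha t).eventually_le_const hε).and
    ((tendsto_abs_mul_sqrt_error hd₁ hd₂ t).eventually_le_const hε)).exists
  have he' : IsCentredSystem (fun r : F => e r) ν := he.comp_injective Subtype.val_injective
  have hw' : IsCentredSystem (fun p : G × Bool => w (p.1, p.2)) ν :=
    hw.comp_injective (i := fun p : G × Bool => ((p.1 : κ), p.2)) fun p q hpq => by
      simp only [Prod.mk.injEq] at hpq
      exact Prod.ext (Subtype.ext hpq.1) hpq.2
  have hh := isCanonical_finiteRankKernel he' hw' (fun r : F => a r) (fun q : G => b q)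
  have hlimit := tendsto_integral_cexp_finiteRank hX hind he' hw' (fun r : F => a r)
    (fun q : G => b q) t
  have hkeq : ∀ p : 𝓧 × 𝓧, g p.1 p.2 - finiteRankKernel (fun r : F => a r) (fun r : F => e r)
      (fun q : G => b q) (fun p : G × Bool => w (p.1, p.2)) p.1 p.2
      = (symmPart g p.1 p.2 - ∑ r ∈ F, a r * (e r p.1 * e r p.2))
        + (antisymmPart g p.1 p.2 - ∑ q ∈ G, b q * (w (q, true) p.1 * w (q, false) p.2
          - w (q, false) p.1 * w (q, true) p.2)) := fun p => by
    simp only [finiteRankKernel, symmPart, antisymmPart]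
    rw [Finset.sum_coe_sort F (fun r => a r * (e r p.1 * e r p.2)),
      Finset.sum_coe_sort G (fun q => b q * (w (q, true) p.1 * w (q, false) p.2
          - w (q, false) p.1 * w (q, true) p.2))]
    ring
  have hmul : ∀ {φ ψ : 𝓧 → ℝ}, MemLp φ 2 ν → MemLp ψ 2 ν →
      MemLp (fun p : 𝓧 × 𝓧 => φ p.1 * ψ p.2) 2 (ν.prod ν) := fun hφ hψ => by
    simpa using memLp_mul_conj hφ hψ
  have hk1 : MemLp (fun p : 𝓧 × 𝓧 => symmPart g p.1 p.2
      - ∑ r ∈ F, a r * (e r p.1 * e r p.2)) 2 (ν.prod ν) :=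
    MemLp.sub (memLp_symmPart hg.memLp) (memLp_finsetSum _ fun r _ =>
      (hmul (he.memLp r) (he.memLp r)).const_mul _)
  have hk2 : MemLp (fun p : 𝓧 × 𝓧 => antisymmPart g p.1 p.2
      - ∑ q ∈ G, b q * (w (q, true) p.1 * w (q, false) p.2
          - w (q, false) p.1 * w (q, true) p.2)) 2 (ν.prod ν) :=
    MemLp.sub (memLp_antisymmPart hg.memLp) (memLp_finsetSum _ fun q _ =>
      MemLp.const_mul (MemLp.sub (hmul (hw.memLp _) (hw.memLp _))
        (hmul (hw.memLp _) (hw.memLp _))) _)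
  refine ⟨_, _, hlimit, Eventually.of_forall fun n => ?_, ?_⟩
  · have h1 := norm_integral_cexp_cyclicU_sub_le hX hind hg hh t n
    simp only [hkeq] at h1
    refine h1.trans (le_trans ?_ hker)
    exact mul_le_mul_of_nonneg_left (Real.sqrt_le_sqrt (integral_add_sq_le hk1 hk2)) (abs_nonneg t)
  · rw [Finset.prod_coe_sort F (fun r => chiSqCharFun (t * a r)),
      Finset.prod_coe_sort G (fun q => (((Real.cosh (t * b q))⁻¹ : ℝ) : ℂ)),
      ← integral_cexp_limitTerm_sum hfam]
    refine (norm_integral_cexp_mul_sub_le (hW₁.add hW₂) ((hS₁ F).add (hS₂ G)) t).trans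
      (le_trans ?_ hlim)
    refine mul_le_mul_of_nonneg_left (Real.sqrt_le_sqrt ?_) (abs_nonneg t)
    refine le_trans (le_of_eq ?_) (integral_add_sq_le (hW₁.sub (hS₁ F)) (hW₂.sub (hS₂ G)))
    congr 1
    ext ω
    simp only [Pi.add_apply, Pi.sub_apply]
    ring

theorem cyclicU_sub_integral_ae_eq {f : 𝓧 → 𝓧 → ℝ} (hX : ∀ i, HasLaw (X i) ν P)
    (hind : iIndepFun X P) (hfm : Measurable (Function.uncurry f))
    (hf : MemLp (Function.uncurry f) 2 (ν.prod ν))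
    (h0 : ∀ᵐ x ∂ν, proj₁ f ν x + proj₂ f ν x = 0) (n : ℕ) :
    ∀ᵐ ω ∂P, cyclicU f X n ω - ∫ ω, cyclicU f X n ω ∂P = cyclicU (proj₁₂ f ν) X n ω := by
  have h1 : ∀ i, ∀ᵐ ω ∂P, proj₁ f ν (X i ω) + proj₂ f ν (X i ω) = 0 := fun i => by
    refine ae_of_ae_map (hX i).aemeasurable (p := fun x => proj₁ f ν x + proj₂ f ν x = 0) ?_
    rwa [(hX i).map_eq]
  filter_upwards [ae_all_iff.2 h1] with ω hω
  rw [integral_cyclicU hX hind hfm hf, cyclicU_hoeffding (ν := ν) f X n ω]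
  simp only [hω, Finset.sum_const_zero, mul_zero, add_zero]
  ring

end Degenerate

end CyclicU

end

/-! ### Assembly of the theorem -/

theorem theorem4p1 {Ω 𝓧 : Type*} [MeasurableSpace Ω] [MeasurableSpace 𝓧]
    (P : Measure Ω) [IsProbabilityMeasure P] (ν : Measure 𝓧) [IsProbabilityMeasure ν]
    (X : ℕ → Ω → 𝓧) (hXlaw : ∀ i, HasLaw (X i) ν P) (hXindep : iIndepFun X P)
    (f : 𝓧 → 𝓧 → ℝ) (hfm : Measurable (Function.uncurry f))
    (hf : MemLp (Function.uncurry f) 2 (ν.prod ν)) :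
    -- `Uc_n(f)` is square integrable
    (∀ n : ℕ, MemLp (cyclicU f X n) 2 P) ∧
    -- mean and weak law of large numbers
    (∀ n : ℕ, P[cyclicU f X n] = (n : ℝ) * ((n - 1) / 2 : ℕ) * kernelMean f ν) ∧
    (fun n : ℕ => P[cyclicU f X n] - (n : ℝ) ^ 2 / 2 * kernelMean f ν)
      =O[atTop] (fun n : ℕ => (n : ℝ)) ∧
    TendstoInMeasure P (fun (n : ℕ) ω => 2 / (n : ℝ) ^ 2 * cyclicU f X n ω) atTop
      (fun _ => kernelMean f ν) ∧
    -- asymptotic variance and central limit theorem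
    Tendsto (fun n : ℕ => (n : ℝ) ^ (-3 : ℝ) * Var[cyclicU f X n; P]) atTop
      (𝓝 (1 / 4 * Var[fun x => proj₁ f ν x + proj₂ f ν x; ν])) ∧
    1 / 4 * Var[fun x => proj₁ f ν x + proj₂ f ν x; ν]
      = 1 / 4 * (∫ x, proj₁ f ν x ^ 2 ∂ν + ∫ x, proj₂ f ν x ^ 2 ∂ν
          + 2 * ∫ x, proj₁ f ν x * proj₂ f ν x ∂ν) ∧
    TendstoInDistribution
      (fun (n : ℕ) ω =>
        (n : ℝ) ^ (-(3 / 2) : ℝ) * (cyclicU f X n ω - (n : ℝ) ^ 2 / 2 * kernelMean f ν))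
      atTop (id : ℝ → ℝ) (fun _ => P)
      (gaussianReal 0 (1 / 4 * Var[fun x => proj₁ f ν x + proj₂ f ν x; ν]).toNNReal) ∧
    (0 < 1 / 4 * Var[fun x => proj₁ f ν x + proj₂ f ν x; ν]
      ↔ ¬ ∀ᵐ x ∂ν, proj₁ f ν x + proj₂ f ν x = 0) ∧
    -- the degenerate case
    ((∀ᵐ x ∂ν, proj₁ f ν x + proj₂ f ν x = 0) →
      (∀ n : ℕ, Var[cyclicU f X n; P]
        = (n : ℝ) * ((n - 1) / 2 : ℕ) * Var[fun ω => proj₁₂ f ν (X 0 ω) (X 1 ω); P]) ∧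
      (fun n : ℕ => Var[cyclicU f X n; P]
          - 1 / 2 * (n : ℝ) ^ 2 * Var[fun ω => proj₁₂ f ν (X 0 ω) (X 1 ω); P])
        =O[atTop] (fun n : ℕ => (n : ℝ)) ∧
      IsSelfAdjoint (symmOp f hf) ∧
      ContinuousLinearMap.adjoint (antisymmOp f hf) = -antisymmOp f hf ∧
      ∃ (R Q : ℕ∞) (ls : SeqIndex R → ℝ) (la : SeqIndex Q → ℝ),
        ListsEigenvalues (symmOp f hf) {c : ℝ | c ≠ 0} ls ∧
        ListsEigenvalues (antisymmOp f hf) {c : ℂ | ∃ t : ℝ, 0 < t ∧ c = Complex.I * t}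
          (fun q => Complex.I * la q) ∧
        HasSum (fun r => ls r ^ 2)
          Var[fun ω => symmPart (proj₁₂ f ν) (X 0 ω) (X 1 ω); P] ∧
        HasSum (fun q => la q ^ 2)
          (1 / 2 * Var[fun ω => antisymmPart (proj₁₂ f ν) (X 0 ω) (X 1 ω); P]) ∧
        -- variables `ζ_r`, `η_q` as required exist, and the limit holds for any choice of them
        (∃ (Ω' : Type) (_ : MeasurableSpace Ω') (P' : Measure Ω')
          (ζ : SeqIndex R → Ω' → ℝ) (η : SeqIndex Q → Ω' → ℝ),
          IsProbabilityMeasure P' ∧ IsNormalAreaFamily P' ζ η) ∧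
        ∀ (Ω' : Type*) [MeasurableSpace Ω'] (P' : Measure Ω') [IsProbabilityMeasure P']
          (ζ : SeqIndex R → Ω' → ℝ) (η : SeqIndex Q → Ω' → ℝ),
          IsNormalAreaFamily P' ζ η →
          ∃ W : Ω' → ℝ, IsNormalAreaSum P' ls la ζ η W ∧
            TendstoInDistribution
              (fun (n : ℕ) ω => (n : ℝ)⁻¹ * (cyclicU f X n ω - P[cyclicU f X n]))
              atTop W (fun _ => P) P' ∧
            Var[W; P'] = 1 / 2 * ∑' r, ls r ^ 2 + ∑' q, la q ^ 2 ∧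
            Var[W; P'] = 1 / 2 * Var[fun ω => proj₁₂ f ν (X 0 ω) (X 1 ω); P]) := by
  
  have hg := isCanonical_proj₁₂ hfm hf
  refine ⟨memLp_cyclicU hXlaw hXindep hf, integral_cyclicU hXlaw hXindep hfm hf, ?_,
    tendstoInMeasure_cyclicU hXlaw hXindep hfm hf, tendsto_variance_cyclicU hXlaw hXindep hfm hf,
    variance_proj_add_eq hf, tendstoInDistribution_cyclicU hXlaw hXindep hfm hf,
    variance_proj_add_pos_iff hf, fun h0 => ?_⟩
  · simp only [integral_cyclicU hXlaw hXindep hfm hf]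
    exact isBigO_mul_half_sub _
  have hvH : Var[fun x => proj₁ f ν x + proj₂ f ν x; ν] = 0 := by
    by_contra hne
    exact (variance_proj_add_pos_iff hf).1
      (by have := (variance_nonneg _ ν).lt_of_ne' hne; linarith) h0
  have hvar : ∀ n : ℕ, Var[cyclicU f X n; P]
      = (n : ℝ) * ((n - 1) / 2 : ℕ) * Var[fun ω => proj₁₂ f ν (X 0 ω) (X 1 ω); P] := fun n => by
    rw [variance_cyclicU hXlaw hXindep hfm hf, hvH, mul_zero, zero_add]
  have hsymm : ∀ x y, symmPart (proj₁₂ f ν) y x = symmPart (proj₁₂ f ν) x y := fun x y => by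
    simp only [symmPart, add_comm]
  have hanti : ∀ x y, antisymmPart (proj₁₂ f ν) y x = -antisymmPart (proj₁₂ f ν) x y :=
    fun x y => by
      simp only [antisymmPart]
      ring
  obtain ⟨R, ls, e, he, hlsE, hlsS, hlsT⟩ := exists_symm_expansion hg.symmPart hsymm
  obtain ⟨Q, la, w, hw, hlaE, hlaS, hlaT⟩ := exists_antisymm_expansion hg.antisymmPart hanti
  rw [← variance_kernel_pair hXlaw hXindep hg.symmPart] at hlsS
  rw [← variance_kernel_pair hXlaw hXindep hg.antisymmPart] at hlaS
  refine ⟨hvar, ?_, isSelfAdjoint_integralOp _ hsymm,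
    adjoint_integralOp_of_antisymm _ fun x y => ?_, R, Q, ls, la, hlsE, hlaE, hlsS, hlaS,
    exists_isNormalAreaFamily _ _, ?_⟩
  · simp only [hvar]
    refine (isBigO_mul_half_sub Var[fun ω => proj₁₂ f ν (X 0 ω) (X 1 ω); P]).congr_left fun n => ?_
    ring
  · rw [hanti, Complex.conj_ofReal, Complex.ofReal_neg]
  intro Ω' _ P' _ ζ η hfam
  obtain ⟨W₁, W₂, hW₁, hW₂, ht₁, ht₂, hV⟩ := exists_limit_parts hfam hlsS hlaS
  refine ⟨fun ω => W₁ ω + W₂ ω, ⟨W₁, W₂, hW₁, hW₂, ht₁, ht₂, fun _ => rfl⟩, ?_, ?_, ?_⟩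
  · refine (tendstoInDistribution_cyclicU_of_isCanonical hXlaw hXindep hg he hw hlsT hlaT hfam hW₁
      hW₂ ht₁ ht₂).congr (fun n => ?_) (EventuallyEq.refl _ _)
    filter_upwards [cyclicU_sub_integral_ae_eq hXlaw hXindep hfm hf h0 n] with ω hω
    rw [hω]
  · rw [hV, hlsS.tsum_eq, hlaS.tsum_eq]
  -- The chi-square sum brings ½ times the squared norm of the symmetric part, and the area sum
  -- brings the same multiple for the antisymmetric part because its squares sum to half the norm;
  -- the two squared norms add up to that of f₁₂.
  · rw [hV, variance_kernel_pair hXlaw hXindep hg.symmPart,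
      variance_kernel_pair hXlaw hXindep hg.antisymmPart, variance_kernel_pair hXlaw hXindep hg,
      ← integral_symmPart_sq_add hg.memLp]
    ring
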